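/- Let $l\ge 1$. Write $0$ for "undefined" in crystals, and use the Cartan matrix of $G_2^{(1)}$ with nodes $0,1,2$, $\alpha_0,\alpha_1$ long, $\alpha_2$ short: $\langle h_0,\alpha_1\rangle=\langle h_1,\alpha_0\rangle=-1$, $\langle h_1,\alpha_2\rangle=-1$, $\langle h_2,\alpha_1\rangle=-3$, $\langle h_0,\alpha_2\rangle=\langle h_2,\alpha_0\rangle=0$. Nodes $\{1,2\}$ form $G_2$ and nodes $\{0,1\}$ form $A_2$. Let $$\mathcal G^l=\bigoplus_{n=0}^{l}B^{G_2}(n\Lambda_1),\qquad \mathcal A=\bigoplus_{i=0}^{[l/2]}\ \bigoplus_{i\le k,j\le l-i}B^{A_2}(k\Lambda_1+j\Lambda_0),$$ and let $b^{i}_{k,j}=b^{l,i}_{k,j}$ be the highest weight element of the summand of $\mathcal A$ labelled $(i,k,j)$ (and $b^{i}_{k,j}=0$ if $j=l-i+1$). Every element of $\mathcal A$ is uniquely $\tilde f_0^r\tilde f_1^q\tilde f_0^p b^i_{k,j}$ with $0\le p\le j$, $p\le q\le p+k$, $0\le r\le j+q-2p$. Here $B^{G_2}(n\Lambda_1)$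 is realized by rows $[\![b_1\cdots b_n]\!]$, i.e. as the connected component of $1\otimes\cdots\otimes 1$ in $B(\Lambda_1)^{\otimes n}$, the row standing for $b_n\otimes\cdots\otimes b_1$, with the convention $\tilde f_i(b\otimes b')=\tilde f_ib\otimes b'$ if $\varphi_i(b)>\varepsilon_i(b')$ and $b\otimes\tilde f_ib'$ otherwise. The 14-element crystal $B(\Lambda_1)$ is $1\xrightarrow{1}2\xrightarrow{2}3\xrightarrow{2}4\xrightarrow{2}6\xrightarrow{1}0_1\xrightarrow{1}\bar6\xrightarrow{2}\bar4\xrightarrow{2}\bar3\xrightarrow{2}\bar2\xrightarrow{1}\bar1$, $\ 4\xrightarrow{1}5\xrightarrow{2}0_2\xrightarrow{2}\bar5\xrightarrow{1}\bar4$. Define an operator $E$ on $\mathcal A$ (i.e. a map $\mathcal A\to\mathcal A\sqcup\{0\}$) by $E(\tilde f_0^r\tilde f_1^q\tilde f_0^pb^i_{k,j})=\tilde f_0^r\,E(\tilde f_1^q\tilde f_0^pb^i_{k,j})$ for $p,q,r$ in the range above and, with $[\cdot]$ the integer part, recursively in $l$ by the following values of $E(\tilde f_1^q\tilde f_0^pb^i_{k,j})$.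 1. $k>i$, $j>i$. If $p=\min(q,j)$: $\tilde f_1^q\tilde f_0^pb^i_{k-1,j}$ when $q\le j-1-[\frac{j-k}{3}]$, and $\tilde f_1^{q+1}\tilde f_0^{p+1}b^i_{k,j+1}$ otherwise. If $p\le j-1$ and $p+1\le q$: whenever, for $l-1$ in place of $l$, $E(\tilde f_1^{q-1}\tilde f_0^pb^{l-1,i}_{k-1,j-1})$ equals $\tilde f_1^{q'}\tilde f_0^{p'}b^{l-1,i'}_{k',j'}$ (resp. $0$), the value is $\tilde f_1^{q'+1}\tilde f_0^{p'}b^{l,i'}_{k'+1,j'+1}$ (resp. $0$). 2. $k=i$, $j\ge i+2$: $\tilde f_1^{q+1}\tilde f_0^pb^{i+1}_{k+1,j-1}$ when $p\le j-1-[\frac{j-i}{3}]$, and $\tilde f_1^{q+1}\tilde f_0^{p+1}b^i_{k,j+1}$ otherwise. 3. $k=i$, $j=i+1$: $\tilde f_1^{q+1}\tilde f_0^pb^i_{k+1,j-1}$ when $p\le i$, and $\tilde f_1^{q+1}\tilde f_0^{p+1}b^i_{k,j+1}$ when $p=i+1$. 4. $k=j=i$: $\tilde f_1^{q+1}\tilde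 f_0^pb^{i-1}_{k+1,j-1}$ when $p\le i-1$, and $\tilde f_1^{q+1}\tilde f_0^{p+1}b^i_{k,j+1}$ when $p=i$. 5. $k>i$, $j=i$: $\tilde f_1^q\tilde f_0^pb^i_{k-1,j}$ when $q\le p-1-[\frac{i-k}{3}]$; otherwise $\tilde f_1^{q+1}\tilde f_0^{p+1}b^i_{k,j+1}$ when $p=i$ and $\tilde f_1^{q+1}\tilde f_0^pb^{i-1}_{k+1,j-1}$ when $p\le i-1$. Then: **(a)** $E$ is well defined and injective where it is nonzero. Let $F$ be its partial inverse ($Fb'=b$ iff $Eb=b'$, for $b,b'\in\mathcal A$). Then $E\tilde f_0=\tilde f_0E$, and $\max\{m\mid F^mb\ne0\}-\max\{m\mid E^mb\ne0\}=-2\,\mathrm{wt}_1(b)-\mathrm{wt}_0(b)$ for all $b\in\mathcal A$. **(b)** There is a bijection $\Phi:\mathcal A\to\mathcal G^l$ with $\tilde e_1\Phi=\Phi\tilde e_1$, $\tilde f_1\Phi=\Phi\tilde f_1$, $\tilde f_2\Phi=\Phi F$, $\tilde e_2\Phi=\Phi E$, $\mathrm{wt}_1(\Phi(b))=\mathrm{wt}_1(b)$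 and $\mathrm{wt}_2(\Phi(b))=-2\,\mathrm{wt}_1(b)-\mathrm{wt}_0(b)$. It is the only bijection with $\tilde e_1\Phi=\Phi\tilde e_1$ and $\tilde f_2\Phi=\Phi F$. For $0\le i\le[l/2]$, $i\le j\le l-i$, $0\le p\le j$, put $y=[\frac{l-i-j}3]$ and let $\mathcal C^m$ be $6^{m/2}\bar6^{m/2}$ ($m$ even) or $6^{(m-1)/2}\,0_1\,\bar6^{(m-1)/2}$ ($m$ odd), exponents denoting repetition. Then $\Phi(\tilde f_0^pb^i_{l-i,j})$ is, for $l-i-j\equiv0,1,2\pmod 3$ respectively: - if $p\le i$: $[\![1^p6^y\mathcal C^{y+i-p}\bar2^{y+j}]\!]$; $[\![1^p6^{y+1}\mathcal C^{y+i-p-1}\bar4\,\bar2^{y+j}]\!]$ (but $[\![1^i\,\bar5\,\bar2^{j}]\!]$ if $y+i=p$); $[\![1^p6^{y+1}\mathcal C^{y+i-p}\bar3\,\bar2^{y+j}]\!]$; - if $p>i$: $[\![1^i6^{p-i+y}\mathcal C^{y}\bar2^{y+j-p+i}]\!]$; $[\![1^i6^{p-i+y+1}\mathcal C^{y-1}\bar4\,\bar2^{y+j-p+i}]\!]$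 (but $[\![1^i6^{p-i}\,\bar5\,\bar2^{j-p+i}]\!]$ if $y=0$); $[\![1^i6^{p-i+y+1}\mathcal C^{y}\bar3\,\bar2^{y+j-p+i}]\!]$. **(c)** Equip $\mathcal G^l$ with its $G_2$ Kashiwara operators $\tilde e_i,\tilde f_i$ ($i=1,2$) and with $\tilde f_0=\Phi\tilde f_0\Phi^{-1}$, $\tilde e_0=\Phi\tilde e_0\Phi^{-1}$, $\varepsilon_0(b)=\max\{n\mid\tilde e_0^nb\ne0\}$, $\varphi_0(b)=\max\{n\mid\tilde f_0^nb\ne0\}$, and weight $\mathrm{wt}=\sum_{i}(\varphi_i-\varepsilon_i)\Lambda_i\in\bigoplus_{i=0}^{2}\mathbb Z\Lambda_i$. The result $B^l$ is an affine crystal for $U_q'(G_2^{(1)})$: it satisfies the axioms of a seminormal crystal with weights in the classical weight lattice of $G_2^{(1)}$, its weights have level zero ($\mathrm{wt}_0+2\mathrm{wt}_1+\mathrm{wt}_2=0$), $\tilde f_0\tilde f_2=\tilde f_2\tilde f_0$ and $\tilde e_0\tilde e_2=\tilde e_2\tilde e_0$, and as a $\{0,1\}$-crystal it is isomorphic to $\mathcal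 A$ through $\Phi$ (as a $\{1,2\}$-crystal it is $\mathcal G^l$ by construction). -/

import Mathlib

/-! Crystals are recorded by their operators; the value `none` stands for `0`. -/

/-- Iterate of a partially defined operator (with `0 ↦ 0`). -/
def opIter {B : Type} (g : B → Option B) : ℕ → B → Option B
  | 0, b => some b
  | n + 1, b => (opIter g n b).bind g

/-- The data of a crystal with index set `I` on a set `B`:
the weight `wt b` is recorded by its coordinates `wt b i = ⟨h_i, wt b⟩`. -/
structure CrystalData (I B : Type) where
  e : I → B → Option B
  f : I → B → Option B
  wt : B → I → ℤ
  ε : I → B → ℕ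
  φ : I → B → ℕ

namespace CrystalData

variable {I B : Type}

/-- The axioms of a (seminormal) crystal for the Cartan matrix `A j i = ⟨h_j, α_i⟩`, with weights
in the lattice `⨁ ℤ Λ_i`, where `α_i = ∑ j, A j i • Λ_j`. -/
structure IsCrystal (A : I → I → ℤ) (C : CrystalData I B) : Prop where
  phi_eq : ∀ i b, (C.φ i b : ℤ) = C.ε i b + C.wt b i
  e_eq_iff : ∀ i b b', C.e i b = some b' ↔ C.f i b' = some b
  wt_e : ∀ i b b', C.e i b = some b' → ∀ j, C.wt b' j = C.wt b j + A j i
  wt_f : ∀ i b b', C.f i b = some b' → ∀ j, C.wt b' j = C.wt b j - A j i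
  eps_e : ∀ i b b', C.e i b = some b' → C.ε i b' + 1 = C.ε i b
  phi_e : ∀ i b b', C.e i b = some b' → C.φ i b' = C.φ i b + 1
  eps_f : ∀ i b b', C.f i b = some b' → C.ε i b' = C.ε i b + 1
  phi_f : ∀ i b b', C.f i b = some b' → C.φ i b' + 1 = C.φ i b
  eps_max : ∀ i b, IsGreatest {n : ℕ | opIter (C.e i) n b ≠ none} (C.ε i b)
  phi_max : ∀ i b, IsGreatest {n : ℕ | opIter (C.f i) n b ≠ none} (C.φ i b)

/-- Tensor products of elements of a crystal. The list `[b₁, …, bₙ]` stands for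
`bₙ ⊗ ⋯ ⊗ b₁`, with the tensor product rule
`f i (b ⊗ b') = f i b ⊗ b'` if `φ i b > ε i b'`, and `b ⊗ f i b'` otherwise,
`e i (b ⊗ b') = e i b ⊗ b'` if `φ i b ≥ ε i b'`, and `b ⊗ e i b'` otherwise,
`ε i (b ⊗ b') = ε i b + max 0 (ε i b' - φ i b)`, `φ i (b ⊗ b') = φ i b' + max 0 (φ i b - ε i b')`.
In `b :: w` the list `w` is the left tensor factor. -/
def wordEps (C : CrystalData I B) (i : I) : List B → ℕ × ℕ
  | [] => (0, 0)
  | b :: w => ((C.wordEps i w).1 + (C.ε i b - (C.wordEps i w).2),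
      C.φ i b + ((C.wordEps i w).2 - C.ε i b))

def wordF (C : CrystalData I B) (i : I) : List B → Option (List B)
  | [] => none
  | b :: w =>
      if C.ε i b < (C.wordEps i w).2 then (C.wordF i w).map (fun w' => b :: w')
      else (C.f i b).map (fun b' => b' :: w)

def wordE (C : CrystalData I B) (i : I) : List B → Option (List B)
  | [] => none
  | b :: w =>
      if C.ε i b ≤ (C.wordEps i w).2 then (C.wordE i w).map (fun w' => b :: w')
      else (C.e i b).map (fun b' => b' :: w)

/-- The crystal of all words in `B`. -/
def words (C : CrystalData I B) : CrystalData I (List B) where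
  e := C.wordE
  f := C.wordF
  wt w i := (w.map fun b => C.wt b i).sum
  ε i w := (C.wordEps i w).1
  φ i w := (C.wordEps i w).2

/-- One arrow of the crystal graph, in either direction. -/
def Step (C : CrystalData I B) (b b' : B) : Prop :=
  ∃ i, C.f i b = some b' ∨ C.e i b = some b'

/-- The underlying set of the connected component of `b₀`. -/
def Component (C : CrystalData I B) (b₀ : B) : Type :=
  {b : B // Relation.ReflTransGen C.Step b₀ b}

/-- The connected component of `b₀`, with the restricted operators. -/
def component (C : CrystalData I B) (b₀ : B) : CrystalData I (C.Component b₀) where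
  e i b := (C.e i b.1).pmap Subtype.mk fun _ h => b.2.tail ⟨i, Or.inr h⟩
  f i b := (C.f i b.1).pmap Subtype.mk fun _ h => b.2.tail ⟨i, Or.inl h⟩
  wt b := C.wt b.1
  ε i b := C.ε i b.1
  φ i b := C.φ i b.1

/-- The direct sum (disjoint union) of a family of crystals. -/
def directSum {T : Type} {X : T → Type} (C : ∀ t, CrystalData I (X t)) :
    CrystalData I (Σ t, X t) where
  e i b := ((C b.1).e i b.2).map (Sigma.mk b.1)
  f i b := ((C b.1).f i b.2).map (Sigma.mk b.1)
  wt b := (C b.1).wt b.2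
  ε i b := (C b.1).ε i b.2
  φ i b := (C b.1).φ i b.2

end CrystalData

/-! ### Index sets -/

/-- Nodes `0, 1, 2` of the affine Dynkin diagram `G₂⁽¹⁾`. -/
inductive AffIdx
  | zero | one | two

/-- Nodes `1, 2`: the subdiagram `G₂`. -/
inductive GIdx
  | one | two

/-- Nodes `0, 1`: the subdiagram `A₂`. -/
inductive AIdx
  | zero | one

/-- The Cartan matrix of `G₂⁽¹⁾`, entry `(j, i)` being `⟨h_j, α_i⟩`
(`α₀`, `α₁` long and `α₂` short). -/
def cartanAff : AffIdx → AffIdx → ℤ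
  | .zero, .zero => 2
  | .zero, .one => -1
  | .zero, .two => 0
  | .one, .zero => -1
  | .one, .one => 2
  | .one, .two => -1
  | .two, .zero => 0
  | .two, .one => -3
  | .two, .two => 2

/-! ### The `G₂`-crystals `B(nΛ₁)` and their direct sum -/

/-- The letters `1, …, 6, 0₁, 0₂, 6̄, …, 1̄` of the crystal `B(Λ₁)` of the adjoint representation;
`ci` is the barred letter. -/
inductive GLetter
  | b1 | b2 | b3 | b4 | b5 | b6 | z1 | z2 | c6 | c5 | c4 | c3 | c2 | c1

namespace GLetter

def f : GIdx → GLetter → Option GLetter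
  | .one, b1 => some b2
  | .one, b4 => some b5
  | .one, b6 => some z1
  | .one, z1 => some c6
  | .one, c5 => some c4
  | .one, c2 => some c1
  | .two, b2 => some b3
  | .two, b3 => some b4
  | .two, b4 => some b6
  | .two, b5 => some z2
  | .two, z2 => some c5
  | .two, c6 => some c4
  | .two, c4 => some c3
  | .two, c3 => some c2
  | _, _ => none

def e : GIdx → GLetter → Option GLetter
  | .one, b2 => some b1
  | .one, b5 => some b4
  | .one, z1 => some b6
  | .one, c6 => some z1
  | .one, c4 => some c5
  | .one, c1 => some c2
  | .two, b3 => some b2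
  | .two, b4 => some b3
  | .two, b6 => some b4
  | .two, z2 => some b5
  | .two, c5 => some z2
  | .two, c4 => some c6
  | .two, c3 => some c4
  | .two, c2 => some c3
  | _, _ => none

def eps : GIdx → GLetter → ℕ
  | .one, b2 => 1
  | .one, b5 => 1
  | .one, z1 => 1
  | .one, c6 => 2
  | .one, c4 => 1
  | .one, c1 => 1
  | .two, b3 => 1
  | .two, b4 => 2
  | .two, b6 => 3
  | .two, z2 => 1
  | .two, c5 => 2
  | .two, c4 => 1
  | .two, c3 => 2
  | .two, c2 => 3
  | _, _ => 0

def phi : GIdx → GLetter → ℕ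
  | .one, b1 => 1
  | .one, b4 => 1
  | .one, b6 => 2
  | .one, z1 => 1
  | .one, c5 => 1
  | .one, c2 => 1
  | .two, b2 => 3
  | .two, b3 => 2
  | .two, b4 => 1
  | .two, b5 => 2
  | .two, z2 => 1
  | .two, c6 => 3
  | .two, c4 => 2
  | .two, c3 => 1
  | _, _ => 0

end GLetter

/-- The crystal `B(Λ₁)` of `U_q(G₂)`. -/
def gLetters : CrystalData GIdx GLetter where
  e := GLetter.e
  f := GLetter.f
  wt b i := (GLetter.phi i b : ℤ) - GLetter.eps i b
  ε := GLetter.eps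
  φ := GLetter.phi

/-- The crystal `B(nΛ₁)` of `U_q(G₂)`: the connected component of the highest weight element
`1 ⊗ ⋯ ⊗ 1` in `B(Λ₁)^{⊗ n}`. -/
def BG2 (n : ℕ) : CrystalData GIdx (gLetters.words.Component (List.replicate n .b1)) :=
  gLetters.words.component (List.replicate n .b1)

/-- The set `𝒢^l = ⨁_{n ≤ l} B(nΛ₁)`. -/
def GSet (l : ℕ) : Type :=
  Σ n : Fin (l + 1), gLetters.words.Component (List.replicate (n : ℕ) .b1)

/-- The `U_q(G₂)`-crystal structure of `𝒢^l`. -/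
def gCrystal (l : ℕ) : CrystalData GIdx (GSet l) :=
  CrystalData.directSum fun n : Fin (l + 1) => BG2 n

/-- The row `⟦b₁ ⋯ bₙ⟧` representing an element of `𝒢^l`. -/
def GSet.row {l : ℕ} (x : GSet l) : List GLetter := x.2.1

/-! ### The `A₂`-crystals `B(j₁Λ₁ + j₀Λ₀)` and their direct sum -/

/-- `x1 → x2 → x3` are the elements of `B(Λ₁)` and `y1 → y2 → y3` those of `B(Λ₀)`. -/
inductive ALetter
  | x1 | x2 | x3 | y1 | y2 | y3

namespace ALetter

def f : AIdx → ALetter → Option ALetter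
  | .one, x1 => some x2
  | .zero, x2 => some x3
  | .zero, y1 => some y2
  | .one, y2 => some y3
  | _, _ => none

def e : AIdx → ALetter → Option ALetter
  | .one, x2 => some x1
  | .zero, x3 => some x2
  | .zero, y2 => some y1
  | .one, y3 => some y2
  | _, _ => none

def eps : AIdx → ALetter → ℕ
  | .one, x2 => 1
  | .zero, x3 => 1
  | .zero, y2 => 1
  | .one, y3 => 1
  | _, _ => 0

def phi : AIdx → ALetter → ℕ
  | .one, x1 => 1
  | .zero, x2 => 1
  | .zero, y1 => 1
  | .one, y2 => 1
  | _, _ => 0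

end ALetter

/-- The disjoint union of the `U_q(A₂)`-crystals `B(Λ₁)` and `B(Λ₀)`. -/
def aLetters : CrystalData AIdx ALetter where
  e := ALetter.e
  f := ALetter.f
  wt b i := (ALetter.phi i b : ℤ) - ALetter.eps i b
  ε := ALetter.eps
  φ := ALetter.phi

/-- The tensor product of `k` highest weight elements of `B(Λ₁)` and `j` of `B(Λ₀)`. -/
def aHighest (k j : ℕ) : List ALetter := List.replicate k .x1 ++ List.replicate j .y1

/-- The crystal `B(kΛ₁ + jΛ₀)` of `U_q(A₂)`. -/
def BA2 (k j : ℕ) : CrystalData AIdx (aLetters.words.Component (aHighest k j)) :=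
  aLetters.words.component (aHighest k j)

/-- The triples `(i, k, j)` with `0 ≤ i ≤ [l/2]` and `i ≤ k, j ≤ l - i`. -/
@[ext] structure ATriple (l : ℕ) where
  i : ℕ
  k : ℕ
  j : ℕ
  i_le : i ≤ l / 2
  i_le_k : i ≤ k
  k_le : k ≤ l - i
  i_le_j : i ≤ j
  j_le : j ≤ l - i

/-- The set `𝒜 = ⨁_i ⨁_{i ≤ k, j ≤ l - i} B(kΛ₁ + jΛ₀)`. -/
def ASet (l : ℕ) : Type := Σ t : ATriple l, aLetters.words.Component (aHighest t.k t.j)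

/-- The `U_q(A₂)`-crystal structure of `𝒜`. -/
def aCrystal (l : ℕ) : CrystalData AIdx (ASet l) :=
  CrystalData.directSum fun t : ATriple l => BA2 t.k t.j

/-- The highest weight element of the summand of `𝒜` with label `(i, k, j)`; it is `0` if there is
no such summand. -/
def aTop (l i k j : ℕ) : Option (ASet l) :=
  if h : (i ≤ l / 2 ∧ i ≤ k ∧ k ≤ l - i) ∧ i ≤ j ∧ j ≤ l - i then
    some ⟨⟨i, k, j, h.1.1, h.1.2.1, h.1.2.2, h.2.1, h.2.2⟩, aHighest k j, .refl⟩
  else none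

/-- The element `f₀^r f₁^q f₀^p` applied to the highest weight element labelled `(i, k, j)`. -/
def aElt (l i k j p q r : ℕ) : Option (ASet l) :=
  (((aTop l i k j).bind (opIter ((aCrystal l).f .zero) p)).bind
    (opIter ((aCrystal l).f .one) q)).bind (opIter ((aCrystal l).f .zero) r)

/-! ### The operators `E` and `F` on `𝒜` -/

/-- Label of the element `f₁^q f₀^p` applied to the highest weight element `(i, k, j)`. -/
structure ALabel where
  i : ℕ
  k : ℕ
  j : ℕ
  p : ℕ
  q : ℕ

/-- The operator `E` on the elements of `𝒜` killed by `e₀`, in terms of labels. The divisions by `3`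
are integer parts. A resulting label with `j > l - i` stands for `0`. In the
inductive case, if `E` sends the label `(i, k - 1, j - 1, p, q - 1)` for `l - 1` to
`(i', k', j', p', q')`, then it sends `(i, k, j, p, q)` for `l` to
`(i', k' + 1, j' + 1, p', q' + 1)`. -/
def eTop (l : ℕ) (b : ALabel) : Option ALabel :=
  match b with
  | ⟨i, k, j, p, q⟩ =>
    if p ≤ j ∧ p ≤ q ∧ q ≤ p + k ∧ k ≤ l - i ∧ j ≤ l - i then
      if i < k ∧ i < j then
        if p = min q j then
          if (q : ℤ) ≤ j - 1 - ((j : ℤ) - k) / 3 then some ⟨i, k - 1, j, p, q⟩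
          else if j < l - i then some ⟨i, k, j + 1, p + 1, q + 1⟩
          else none
        else
          match l with
          | 0 => none
          | l' + 1 =>
              (eTop l' ⟨i, k - 1, j - 1, p, q - 1⟩).map fun t =>
                ⟨t.i, t.k + 1, t.j + 1, t.p, t.q + 1⟩
      else if k = i ∧ i + 2 ≤ j then
        if (p : ℤ) ≤ j - 1 - ((j : ℤ) - i) / 3 then some ⟨i + 1, k + 1, j - 1, p, q + 1⟩
        else if j < l - i then some ⟨i, k, j + 1, p + 1, q + 1⟩
        else none
      else if k = i ∧ j = i + 1 then
        if p ≤ i then some ⟨i, k + 1, j - 1, p, q + 1⟩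
        else some ⟨i, k, j + 1, p + 1, q + 1⟩
      else if k = i ∧ j = i then
        if p < i then some ⟨i - 1, k + 1, j - 1, p, q + 1⟩
        else some ⟨i, k, j + 1, p + 1, q + 1⟩
      else if i < k ∧ j = i then
        if (q : ℤ) ≤ p - 1 - ((i : ℤ) - k) / 3 then some ⟨i, k - 1, j, p, q⟩
        else if p = i then some ⟨i, k, j + 1, p + 1, q + 1⟩
        else some ⟨i - 1, k + 1, j - 1, p, q + 1⟩
      else none
    else none

/-- The graph of `E` on `𝒜`: `E (f₀^r b) = f₀^r (E b)` whenever `e₀ b = 0` and `f₀^r b ≠ 0`. -/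
def ERel (l : ℕ) (b b' : ASet l) : Prop :=
  ∃ (i k j p q r : ℕ) (t : ALabel),
    p ≤ j ∧ p ≤ q ∧ q ≤ p + k ∧ r + 2 * p ≤ j + q ∧
    eTop l ⟨i, k, j, p, q⟩ = some t ∧
    aElt l i k j p q r = some b ∧ aElt l t.i t.k t.j t.p t.q r = some b'

open Classical in
/-- The partial map whose graph is the relation `R`. -/
noncomputable def partialMap {B : Type} (R : B → B → Prop) (b : B) : Option B :=
  if h : ∃ b', R b b' then some h.choose else none

/-- The operator `E` on `𝒜`. -/
noncomputable def EOp (l : ℕ) : ASet l → Option (ASet l) := partialMap (ERel l)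

/-- The operator `F` on `𝒜`: the partial inverse of `E`. -/
noncomputable def FOp (l : ℕ) : ASet l → Option (ASet l) := partialMap fun b b' => ERel l b' b

/-! ### The affine crystal -/

/-- The `0`-th operators on `𝒢^l` obtained by transport along `Φ : 𝒜 → 𝒢^l`. -/
def e0 {l : ℕ} (Φ : ASet l ≃ GSet l) (b : GSet l) : Option (GSet l) :=
  ((aCrystal l).e .zero (Φ.symm b)).map Φ

def f0 {l : ℕ} (Φ : ASet l ≃ GSet l) (b : GSet l) : Option (GSet l) :=
  ((aCrystal l).f .zero (Φ.symm b)).map Φ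

/-- `max {n | g^n b ≠ 0}`. -/
noncomputable def maxPow {B : Type} (g : B → Option B) (b : B) : ℕ :=
  sSup {n : ℕ | opIter g n b ≠ none}

/-- The set `𝒢^l` with its `U_q(G₂)`-crystal structure at the nodes `1, 2` and the operators
transported along `Φ` at the node `0`; the weight is `∑ (φ_i - ε_i) Λ_i`. -/
noncomputable def affineB {l : ℕ} (Φ : ASet l ≃ GSet l) : CrystalData AffIdx (GSet l) where
  e
    | .zero => e0 Φ
    | .one => (gCrystal l).e .one
    | .two => (gCrystal l).e .two
  f
    | .zero => f0 Φ
    | .one => (gCrystal l).f .one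
    | .two => (gCrystal l).f .two
  wt b
    | .zero => (maxPow (f0 Φ) b : ℤ) - maxPow (e0 Φ) b
    | .one => (gCrystal l).wt b .one
    | .two => (gCrystal l).wt b .two
  ε
    | .zero => maxPow (e0 Φ)
    | .one => (gCrystal l).ε .one
    | .two => (gCrystal l).ε .two
  φ
    | .zero => maxPow (f0 Φ)
    | .one => (gCrystal l).φ .one
    | .two => (gCrystal l).φ .two

/-- The inclusion of the nodes `0, 1` in the affine diagram. -/
def AIdx.toAff : AIdx → AffIdx
  | .zero => .zero
  | .one => .one

/-- The row `𝒞^m`: `6^{m/2} 6̄^{m/2}` for even `m`, `6^{[m/2]} 0₁ 6̄^{[m/2]}` for odd `m`. -/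
def rowC (m : ℕ) : List GLetter :=
  List.replicate (m / 2) .b6 ++ List.replicate (m % 2) .z1 ++ List.replicate (m / 2) .c6

/-- The row `Φ (f₀^p b)`, `b` being the highest weight element labelled `(i, l - i, j)`,
where `y = [(l - i - j) / 3]`. -/
def phiRow (l i j p : ℕ) : List GLetter :=
  let y := (l - i - j) / 3
  let m := (l - i - j) % 3
  if p ≤ i then
    if m = 0 then
      List.replicate p .b1 ++ List.replicate y .b6 ++ rowC (y + i - p) ++
        List.replicate (y + j) .c2
    else if m = 1 then
      if p < y + i then
        List.replicate p .b1 ++ List.replicate (y + 1) .b6 ++ rowC (y + i - p - 1) ++ [.c4] ++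
          List.replicate (y + j) .c2
      else List.replicate i .b1 ++ [.c5] ++ List.replicate j .c2
    else
      List.replicate p .b1 ++ List.replicate (y + 1) .b6 ++ rowC (y + i - p) ++ [.c3] ++
        List.replicate (y + j) .c2
  else
    if m = 0 then
      List.replicate i .b1 ++ List.replicate (p - i + y) .b6 ++ rowC y ++
        List.replicate (y + j + i - p) .c2
    else if m = 1 then
      if 0 < y then
        List.replicate i .b1 ++ List.replicate (p - i + y + 1) .b6 ++ rowC (y - 1) ++ [.c4] ++
          List.replicate (y + j + i - p) .c2
      else
        List.replicate i .b1 ++ List.replicate (p - i) .b6 ++ [.c5] ++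
          List.replicate (j + i - p) .c2
    else
      List.replicate i .b1 ++ List.replicate (p - i + y + 1) .b6 ++ rowC y ++ [.c3] ++
        List.replicate (y + j + i - p) .c2

/-!
The proof introduces coordinates on both sides and shows that, in these coordinates, `Φ` is the
inverse of an explicit piecewise linear map.

An element `f₀^r f₁^q f₀^p b^i_{k,j}` of `𝒜` is recorded by its label `(i, k, j, p, q, r)` (`ALab`);
in terms of words it is given by `ALab.word`, on which the operators at the nodes `0` and `1` can be
read off (`ALab.toASet_surjective`, `ALab.f_zero_eq_some_iff`, `ALab.f_one_eq_some_iff`). The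
recursion for `E` is solved in closed form: the recursion subtracts a number from `k`, `j` and `q`,
so that the case in which it stops and the value of `E` are given by linear inequalities in the
label (`ETarget`, `eTop_spec`). The closed form does not mention `l`, except that `E` vanishes where
the new label has `i + j > l`. It shows that `E` is well defined and injective, and that it commutes
with `f₀`, since it does not depend on `r` and preserves `r` and the length `j + q - 2p` of the
`0`-string.

A row in `𝒢^l` is recorded by the number `x₀` of letters missing from `l`, the numbers `x₁`, `y₁` of
letters `1`, `1̄`, and four numbers `a₂`, `a₃`, `d₃`, `d₂` describing the letters in between (`GPt`,
`coreWord`). With `u = (a₃ - a₂)/3`, `v = (d₃ - d₂)/3`, `w = (d₃ - a₃)/2` the operators `e₁` and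
`e₂` are given by `GPt.E1` and `GPt.E2`. Every point is reached from a row of letters `1` by
lowering operators and conversely, so that the points are in bijection with `𝒢^l`
(`GPt.toGSet_surjective`).

The map `psi` from points to labels is built from four maxima of linear forms in `u`, `v`, `w` and
`z = y₁ - x₁`. It turns `e₁` into the inverse of `f₁` on labels (`GPt.E1.lab_F1`) and `e₂` into `E`
(`GPt.E2.lab_eTarget`); both are finite case distinctions over the linear forms attaining the
maxima, and the second is the core of the proof. The bounds `i + k ≤ l` and `i + j ≤ l` on labels
correspond to `a₂ ≥ 0` and `d₂ ≥ 0`, which makes `E` and `F` vanish exactly where `e₂` and `f₂` do.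
Injectivity of the map follows by raising both points with `e₁` and `e₂` to highest weight elements,
surjectivity by raising a label with `e₁` and `E` as long as possible, and lowering the
corresponding point again (`GPt.lab_injective`, `GPt.lab_surjective`).

Everything else is formal. The weights are linear in the coordinates; the strings of `E` and `F` are
those of `e₂` and `f₂`; an automorphism of `𝒢^l` commuting with `e₁` and `e₂` fixes the highest
weight elements, as the `1`-strings through them have different lengths, and so is the identity
(`apply_eq_self_of_comm`). The axioms of the affine crystal hold at the nodes `1`, `2` by those of
`𝒢^l` and at the node `0` by those of `𝒜`, and the one remaining coordinate of each weight is
determined by the level being zero.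
-/

/-! ### Crystals given by local axioms, and words -/

namespace CrystalData

variable {I B : Type}

/-- The local form of the axioms of a seminormal crystal: instead of the lengths of the strings it
only asks that `e i b` (resp. `f i b`) be nonzero as soon as `ε i b` (resp. `φ i b`) is positive. -/
structure IsRegular (A : I → I → ℤ) (C : CrystalData I B) : Prop where
  diag : ∀ i, A i i = 2
  phi_eq : ∀ i b, (C.φ i b : ℤ) = C.ε i b + C.wt b i
  e_eq_iff : ∀ i b b', C.e i b = some b' ↔ C.f i b' = some b
  wt_e : ∀ i b b', C.e i b = some b' → ∀ j, C.wt b' j = C.wt b j + A j i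
  eps_e : ∀ i b b', C.e i b = some b' → C.ε i b' + 1 = C.ε i b
  e_none : ∀ i b, C.e i b = none → C.ε i b = 0
  f_none : ∀ i b, C.f i b = none → C.φ i b = 0

theorem pmap_mk_eq_some {p : B → Prop} (o : Option B) (H : ∀ a, o = some a → p a)
    (b : {b // p b}) : o.pmap Subtype.mk H = some b ↔ o = some b.1 := by
  cases o <;> simp [Subtype.ext_iff]

theorem pmap_mk_eq_none {p : B → Prop} (o : Option B) (H : ∀ a, o = some a → p a) :
    o.pmap Subtype.mk H = none ↔ o = none := by
  cases o <;> simp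

theorem opIter_succ' (g : B → Option B) (n : ℕ) (b : B) :
    opIter g (n + 1) b = (g b).bind (opIter g n) := by
  induction n generalizing b with
  | zero => cases h : g b <;> simp [opIter, h]
  | succ n ih =>
    rw [opIter, ih]
    cases h : g b <;> simp [opIter]

/-- A function which drops by one along `g`, and vanishes where `g` is undefined, is the length of
the `g`-strings. -/
theorem isGreatest_opIter {g : B → Option B} {d : B → ℕ}
    (hs : ∀ b b', g b = some b' → d b' + 1 = d b) (hn : ∀ b, g b = none → d b = 0) (b : B) :
    IsGreatest {n : ℕ | opIter g n b ≠ none} (d b) := by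
  have key : ∀ n b, opIter g n b ≠ none ↔ n ≤ d b := by
    intro n
    induction n with
    | zero => intro b; simp [opIter]
    | succ n ih =>
      intro b
      rw [opIter_succ']
      cases h : g b with
      | none => simp [hn b h]
      | some b' =>
        have := hs b b' h
        simp only [Option.bind_some]
        rw [ih b']
        omega
  refine ⟨(key _ _).2 le_rfl, fun n hn => (key _ _).1 hn⟩

namespace IsRegular

variable {A : I → I → ℤ} {C : CrystalData I B}

theorem phi_e (h : C.IsRegular A) {i b b'} (hb : C.e i b = some b') : C.φ i b' = C.φ i b + 1 := by
  have h1 := h.phi_eq i b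
  have h2 := h.phi_eq i b'
  have h3 := h.wt_e i b b' hb i
  have h4 := h.eps_e i b b' hb
  have h5 := h.diag i
  omega

theorem eps_f (h : C.IsRegular A) {i b b'} (hb : C.f i b = some b') : C.ε i b' = C.ε i b + 1 :=
  (h.eps_e i b' b ((h.e_eq_iff i b' b).2 hb)).symm

theorem phi_f (h : C.IsRegular A) {i b b'} (hb : C.f i b = some b') : C.φ i b' + 1 = C.φ i b :=
  (h.phi_e ((h.e_eq_iff i b' b).2 hb)).symm

theorem e_none_iff (h : C.IsRegular A) {i b} : C.e i b = none ↔ C.ε i b = 0 := by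
  refine ⟨h.e_none i b, fun h0 => ?_⟩
  cases hb : C.e i b with
  | none => rfl
  | some b' => have := h.eps_e i b b' hb; omega

theorem f_none_iff (h : C.IsRegular A) {i b} : C.f i b = none ↔ C.φ i b = 0 := by
  refine ⟨h.f_none i b, fun h0 => ?_⟩
  cases hb : C.f i b with
  | none => rfl
  | some b' => have := h.phi_f hb; omega

theorem isCrystal (h : C.IsRegular A) : C.IsCrystal A where
  phi_eq := h.phi_eq
  e_eq_iff := h.e_eq_iff
  wt_e := h.wt_e
  wt_f i b b' hb j := by
    have := h.wt_e i b' b ((h.e_eq_iff i b' b).2 hb) j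
    omega
  eps_e := h.eps_e
  phi_e i b b' := h.phi_e
  eps_f i b b' := h.eps_f
  phi_f i b b' := h.phi_f
  eps_max i b := isGreatest_opIter (h.eps_e i) (h.e_none i) b
  phi_max i b := isGreatest_opIter (fun _ _ hb => h.phi_f hb) (h.f_none i) b

/-- The tensor product rule preserves the axioms. -/
theorem words (h : C.IsRegular A) : C.words.IsRegular A := by
  have hphi : ∀ i w, ((C.wordEps i w).2 : ℤ)
      = (C.wordEps i w).1 + (w.map fun b => C.wt b i).sum := by
    intro i w
    induction w with
    | nil => simp [wordEps]
    | cons b w ih =>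
      have := h.phi_eq i b
      simp only [wordEps, List.map_cons, List.sum_cons]
      omega
  have hwt : ∀ i w w', C.wordE i w = some w' →
      ∀ j, (w'.map fun b => C.wt b j).sum = (w.map fun b => C.wt b j).sum + A j i := by
    intro i w
    induction w with
    | nil => simp [wordE]
    | cons b w ih =>
      intro w' hw j
      simp only [wordE] at hw
      split_ifs at hw
      · obtain ⟨v, hv, rfl⟩ := Option.map_eq_some_iff.1 hw
        simp [ih v hv j, add_assoc]
      · obtain ⟨v, hv, rfl⟩ := Option.map_eq_some_iff.1 hw
        simp [h.wt_e i b v hv j, add_right_comm]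
  have heps : ∀ i w w', C.wordE i w = some w' → (C.wordEps i w').1 + 1 = (C.wordEps i w).1 ∧
      (C.wordEps i w').2 = (C.wordEps i w).2 + 1 := by
    intro i w w' hw
    have h1 := hphi i w
    have h2 := hphi i w'
    have h3 := hwt i w w' hw i
    have h4 := h.diag i
    suffices (C.wordEps i w').1 + 1 = (C.wordEps i w).1 by omega
    clear h1 h2 h3
    induction w generalizing w' with
    | nil => simp [wordE] at hw
    | cons b w ih =>
      simp only [wordE] at hw
      split_ifs at hw
      · obtain ⟨v, hv, rfl⟩ := Option.map_eq_some_iff.1 hw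
        have h1 := hphi i w
        have h2 := hphi i v
        have h3 := hwt i w v hv i
        have := ih v hv
        simp only [wordEps]
        omega
      · obtain ⟨v, hv, rfl⟩ := Option.map_eq_some_iff.1 hw
        have := h.eps_e i b v hv
        simp only [wordEps]
        omega
  refine ⟨h.diag, hphi, ?_, hwt, fun i w w' hw => (heps i w w' hw).1, ?_, ?_⟩
  · intro i w
    change ∀ w', C.wordE i w = some w' ↔ C.wordF i w' = some w
    induction w with
    | nil =>
      intro w'
      constructor
      · simp [wordE]
      · cases w' with
        | nil => simp [wordF]
        | cons b w' => simp only [wordF]; split_ifs <;> simp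
    | cons b w ih =>
      intro w'
      constructor
      · intro hw
        simp only [wordE] at hw
        split_ifs at hw with hc
        · obtain ⟨v, hv, rfl⟩ := Option.map_eq_some_iff.1 hw
          have h1 := (heps i w v hv).2
          rw [wordF, if_pos (by omega), (ih v).1 hv]
          rfl
        · obtain ⟨v, hv, rfl⟩ := Option.map_eq_some_iff.1 hw
          have h1 := h.eps_e i b v hv
          rw [wordF, if_neg (by omega), (h.e_eq_iff i b v).1 hv]
          rfl
      · intro hw
        cases w' with
        | nil => simp [wordF] at hw
        | cons c w' =>
          simp only [wordF] at hw
          split_ifs at hw with hc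
          · obtain ⟨v, hv, hvw⟩ := Option.map_eq_some_iff.1 hw
            obtain ⟨rfl, rfl⟩ := List.cons_eq_cons.1 hvw
            have h0 := (ih w').2 hv
            have h1 := (heps i v w' h0).2
            rw [wordE, if_pos (by omega), h0]
            rfl
          · obtain ⟨v, hv, hvw⟩ := Option.map_eq_some_iff.1 hw
            obtain ⟨rfl, rfl⟩ := List.cons_eq_cons.1 hvw
            have h0 := (h.e_eq_iff i v c).2 hv
            have h1 := h.eps_e i v c h0
            rw [wordE, if_neg (by omega), h0]
            rfl
  · intro i w
    change C.wordE i w = none → (C.wordEps i w).1 = 0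
    induction w with
    | nil => simp [wordEps]
    | cons b w ih =>
      simp only [wordE, wordEps]
      split_ifs with hc <;> intro hw
      · have := ih (Option.map_eq_none_iff.1 hw)
        omega
      · have := h.e_none i b (Option.map_eq_none_iff.1 hw)
        omega
  · intro i w
    change C.wordF i w = none → (C.wordEps i w).2 = 0
    induction w with
    | nil => simp [wordEps]
    | cons b w ih =>
      simp only [wordF, wordEps]
      split_ifs with hc <;> intro hw
      · have := ih (Option.map_eq_none_iff.1 hw)
        omega
      · have := h.f_none i b (Option.map_eq_none_iff.1 hw)
        omega

theorem component_e {i} {b₀ : B} {b b' : C.Component b₀} :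
    (C.component b₀).e i b = some b' ↔ C.e i b.1 = some b'.1 :=
  pmap_mk_eq_some _ _ _

theorem component_f {i} {b₀ : B} {b b' : C.Component b₀} :
    (C.component b₀).f i b = some b' ↔ C.f i b.1 = some b'.1 :=
  pmap_mk_eq_some _ _ _

theorem component (h : C.IsRegular A) (b₀ : B) : (C.component b₀).IsRegular A where
  diag := h.diag
  phi_eq i b := h.phi_eq i b.1
  e_eq_iff i b b' := by rw [component_e, component_f]; exact h.e_eq_iff i b.1 b'.1
  wt_e i b b' hb := h.wt_e i b.1 b'.1 (component_e.1 hb)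
  eps_e i b b' hb := h.eps_e i b.1 b'.1 (component_e.1 hb)
  e_none i b hb := h.e_none i b.1 ((pmap_mk_eq_none _ _).1 hb)
  f_none i b hb := h.f_none i b.1 ((pmap_mk_eq_none _ _).1 hb)

theorem directSum {T : Type} {X : T → Type} {C : ∀ t, CrystalData I (X t)}
    (hd : ∀ i, A i i = 2) (h : ∀ t, (C t).IsRegular A) :
    (CrystalData.directSum C).IsRegular A where
  diag := hd
  phi_eq i b := (h b.1).phi_eq i b.2
  e_eq_iff i b b' := by
    obtain ⟨t, b⟩ := b
    obtain ⟨t', b'⟩ := b'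
    simp only [CrystalData.directSum, Option.map_eq_some_iff, Sigma.mk.injEq]
    constructor
    · rintro ⟨a, h1, rfl, h2⟩
      cases h2
      exact ⟨_, ((h _).e_eq_iff i _ _).1 h1, rfl, HEq.rfl⟩
    · rintro ⟨a, h1, rfl, h2⟩
      cases h2
      exact ⟨_, ((h _).e_eq_iff i _ _).2 h1, rfl, HEq.rfl⟩
  wt_e i b b' hb j := by
    obtain ⟨a, h1, rfl⟩ := Option.map_eq_some_iff.1 hb
    exact (h b.1).wt_e i b.2 a h1 j
  eps_e i b b' hb := by
    obtain ⟨a, h1, rfl⟩ := Option.map_eq_some_iff.1 hb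
    exact (h b.1).eps_e i b.2 a h1
  e_none i b hb := (h b.1).e_none i b.2 (Option.map_eq_none_iff.1 hb)
  f_none i b hb := (h b.1).f_none i b.2 (Option.map_eq_none_iff.1 hb)

end IsRegular

/-! ### Words made of blocks -/

section blocks

variable (C : CrystalData I B) (i : I)

theorem wordEps_append (u w : List B) : C.wordEps i (u ++ w) =
    ((C.wordEps i w).1 + ((C.wordEps i u).1 - (C.wordEps i w).2),
      (C.wordEps i u).2 + ((C.wordEps i w).2 - (C.wordEps i u).1)) := by
  induction u with
  | nil => simp [wordEps]
  | cons b u ih =>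
    simp only [List.cons_append, wordEps, ih, Prod.mk.injEq]
    omega

theorem wordF_append_of_lt (u w : List B) (h : (C.wordEps i u).1 < (C.wordEps i w).2) :
    C.wordF i (u ++ w) = (C.wordF i w).map (u ++ ·) := by
  induction u with
  | nil => simp
  | cons b u ih =>
    simp only [wordEps] at h
    rw [List.cons_append, wordF, wordEps_append, if_pos (by omega), ih (by omega), Option.map_map]
    rfl

theorem wordF_append_of_le {A : I → I → ℤ} (hC : C.IsRegular A) (u w : List B)
    (h : (C.wordEps i w).2 ≤ (C.wordEps i u).1) :
    C.wordF i (u ++ w) = (C.wordF i u).map (· ++ w) := by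
  induction u with
  | nil => exact (hC.words.f_none_iff (i := i) (b := w)).2 (Nat.le_zero.1 h)
  | cons b u ih =>
    simp only [wordEps] at h
    by_cases h2 : C.ε i b < (C.wordEps i u).2
    · rw [List.cons_append, wordF, wordEps_append, if_pos (by omega), ih (by omega), wordF,
        if_pos h2, Option.map_map, Option.map_map]
      rfl
    · rw [List.cons_append, wordF, wordEps_append, if_neg (by omega), wordF,
        if_neg h2, Option.map_map]
      rfl

theorem wordEps_replicate_of_eps {b : B} (hb : C.ε i b = 0) (n : ℕ) :
    C.wordEps i (List.replicate n b) = (0, n * C.φ i b) := by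
  induction n with
  | zero => simp [wordEps]
  | succ n ih => simp [List.replicate_succ, wordEps, ih, hb]; ring

theorem wordEps_replicate_of_phi {b : B} (hb : C.φ i b = 0) (n : ℕ) :
    C.wordEps i (List.replicate n b) = (n * C.ε i b, 0) := by
  induction n with
  | zero => simp [wordEps]
  | succ n ih => simp [List.replicate_succ, wordEps, ih, hb]; ring

theorem wordF_replicate_of_eps {b b' : B} (hb : C.ε i b = 0) (hφ : 0 < C.φ i b)
    (hf : C.f i b = some b') (n : ℕ) :
    C.wordF i (List.replicate (n + 1) b) = some (List.replicate n b ++ [b']) := by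
  induction n with
  | zero => simp [wordF, wordEps, hf]
  | succ n ih =>
    rw [List.replicate_succ, wordF, wordEps_replicate_of_eps C i hb, ih, if_pos]
    · rfl
    · rw [hb]; positivity

end blocks

end CrystalData

/-! ### The elements of `𝒜` as labels -/

section

open CrystalData

/-- The Cartan matrix of `A₂`. -/
def cartanA : AIdx → AIdx → ℤ
  | .zero, .zero => 2
  | .zero, .one => -1
  | .one, .zero => -1
  | .one, .one => 2

theorem aLetters_isRegular : aLetters.IsRegular cartanA where
  diag i := by cases i <;> rfl
  phi_eq i b := by simp [aLetters]
  e_eq_iff i b b' := by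
    cases i <;> cases b <;> cases b' <;> simp [aLetters, ALetter.e, ALetter.f]
  wt_e i b b' h j := by
    cases i <;> cases b <;> simp [aLetters, ALetter.e] at h <;> subst h <;> cases j <;>
      simp [aLetters, ALetter.eps, ALetter.phi, cartanA]
  eps_e i b b' h := by
    cases i <;> cases b <;> simp [aLetters, ALetter.e] at h <;> subst h <;>
      simp [aLetters, ALetter.eps]
  e_none i b h := by
    cases i <;> cases b <;> simp_all [aLetters, ALetter.e, ALetter.eps]
  f_none i b h := by
    cases i <;> cases b <;> simp_all [aLetters, ALetter.f, ALetter.phi]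

theorem aCrystal_isRegular (l : ℕ) : (aCrystal l).IsRegular cartanA :=
  IsRegular.directSum aLetters_isRegular.diag fun _ => aLetters_isRegular.words.component _

/-- The word `x₁^a x₂^b x₃^c`. -/
def xBlock (a b c : ℕ) : List ALetter :=
  List.replicate a .x1 ++ (List.replicate b .x2 ++ List.replicate c .x3)

/-- The word `y₁^a y₂^b y₃^c`. -/
def yBlock (a b c : ℕ) : List ALetter :=
  List.replicate a .y1 ++ (List.replicate b .y2 ++ List.replicate c .y3)

theorem wordEps_zero_xBlock (a b c : ℕ) : aLetters.wordEps .zero (xBlock a b c) = (c, b) := by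
  have h1 := wordEps_replicate_of_eps aLetters .zero (b := .x1) rfl a
  have h2 := wordEps_replicate_of_eps aLetters .zero (b := .x2) rfl b
  have h3 := wordEps_replicate_of_phi aLetters .zero (b := .x3) rfl c
  simp only [xBlock, wordEps_append, h1, h2, h3]
  simp [aLetters, ALetter.eps, ALetter.phi]

theorem wordEps_one_xBlock (a b c : ℕ) : aLetters.wordEps .one (xBlock a b c) = (b, a) := by
  have h1 := wordEps_replicate_of_eps aLetters .one (b := .x1) rfl a
  have h2 := wordEps_replicate_of_phi aLetters .one (b := .x2) rfl b
  have h3 := wordEps_replicate_of_phi aLetters .one (b := .x3) rfl c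
  simp only [xBlock, wordEps_append, h1, h2, h3]
  simp [aLetters, ALetter.eps, ALetter.phi]

theorem wordEps_zero_yBlock (a b c : ℕ) : aLetters.wordEps .zero (yBlock a b c) = (b, a) := by
  have h1 := wordEps_replicate_of_eps aLetters .zero (b := .y1) rfl a
  have h2 := wordEps_replicate_of_phi aLetters .zero (b := .y2) rfl b
  have h3 := wordEps_replicate_of_phi aLetters .zero (b := .y3) rfl c
  simp only [yBlock, wordEps_append, h1, h2, h3]
  simp [aLetters, ALetter.eps, ALetter.phi]

theorem wordEps_one_yBlock (a b c : ℕ) : aLetters.wordEps .one (yBlock a b c) = (c, b) := by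
  have h1 := wordEps_replicate_of_eps aLetters .one (b := .y1) rfl a
  have h2 := wordEps_replicate_of_eps aLetters .one (b := .y2) rfl b
  have h3 := wordEps_replicate_of_phi aLetters .one (b := .y3) rfl c
  simp only [yBlock, wordEps_append, h1, h2, h3]
  simp [aLetters, ALetter.eps, ALetter.phi]

theorem wordF_zero_xBlock (a b c : ℕ) :
    aLetters.wordF .zero (xBlock a (b + 1) c) = some (xBlock a b (c + 1)) := by
  have h1 := wordEps_replicate_of_eps aLetters .zero (b := .x1) rfl a
  have h2 := wordEps_replicate_of_eps aLetters .zero (b := .x2) rfl (b + 1)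
  have h3 := wordEps_replicate_of_phi aLetters .zero (b := .x3) rfl c
  have hf := wordF_replicate_of_eps aLetters .zero (b := .x2) rfl Nat.one_pos rfl b
  rw [xBlock, wordF_append_of_lt, wordF_append_of_le _ _ aLetters_isRegular, hf]
  · simp [xBlock, List.replicate_succ]
  · simp [h2, h3]
  · simp only [wordEps_append, h1, h2, h3]
    simp [aLetters, ALetter.eps, ALetter.phi]

theorem wordF_one_xBlock (a b c : ℕ) :
    aLetters.wordF .one (xBlock (a + 1) b c) = some (xBlock a (b + 1) c) := by
  have h1 := wordEps_replicate_of_eps aLetters .one (b := .x1) rfl (a + 1)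
  have h2 := wordEps_replicate_of_phi aLetters .one (b := .x2) rfl b
  have h3 := wordEps_replicate_of_phi aLetters .one (b := .x3) rfl c
  have hf := wordF_replicate_of_eps aLetters .one (b := .x1) rfl Nat.one_pos rfl a
  rw [xBlock, wordF_append_of_le _ _ aLetters_isRegular, hf]
  · simp [xBlock, List.replicate_succ]
  · simp only [wordEps_append, h1, h2, h3]
    simp [aLetters, ALetter.phi]

theorem wordF_zero_yBlock (a b c : ℕ) :
    aLetters.wordF .zero (yBlock (a + 1) b c) = some (yBlock a (b + 1) c) := by
  have h1 := wordEps_replicate_of_eps aLetters .zero (b := .y1) rfl (a + 1)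
  have h2 := wordEps_replicate_of_phi aLetters .zero (b := .y2) rfl b
  have h3 := wordEps_replicate_of_phi aLetters .zero (b := .y3) rfl c
  have hf := wordF_replicate_of_eps aLetters .zero (b := .y1) rfl Nat.one_pos rfl a
  rw [yBlock, wordF_append_of_le _ _ aLetters_isRegular, hf]
  · simp [yBlock, List.replicate_succ]
  · simp only [wordEps_append, h1, h2, h3]
    simp [aLetters, ALetter.phi]

theorem wordF_one_yBlock (a b c : ℕ) :
    aLetters.wordF .one (yBlock a (b + 1) c) = some (yBlock a b (c + 1)) := by
  have h1 := wordEps_replicate_of_eps aLetters .one (b := .y1) rfl a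
  have h2 := wordEps_replicate_of_eps aLetters .one (b := .y2) rfl (b + 1)
  have h3 := wordEps_replicate_of_phi aLetters .one (b := .y3) rfl c
  have hf := wordF_replicate_of_eps aLetters .one (b := .y2) rfl Nat.one_pos rfl b
  rw [yBlock, wordF_append_of_lt, wordF_append_of_le _ _ aLetters_isRegular, hf]
  · simp [yBlock, List.replicate_succ]
  · simp [h2, h3]
  · simp only [wordEps_append, h1, h2, h3]
    simp [aLetters, ALetter.eps, ALetter.phi]

/-- The labels of the elements of `𝒜`: `(i, k, j, p, q, r)` stands for the element
`f₀^r f₁^q f₀^p` applied to the highest weight element labelled `(i, k, j)`. -/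
@[ext] structure ALab (l : ℕ) where
  i : ℕ
  k : ℕ
  j : ℕ
  p : ℕ
  q : ℕ
  r : ℕ
  i_le_k : i ≤ k
  i_le_j : i ≤ j
  k_le : i + k ≤ l
  j_le : i + j ≤ l
  p_le_j : p ≤ j
  p_le_q : p ≤ q
  q_le : q ≤ p + k
  r_le : r + 2 * p ≤ j + q

namespace ALab

variable {l : ℕ}

/-- The word which is the element of `𝒜` with the given label. Truncated subtraction is meant: the
number of letters `x₃`, for instance, is the positive part of `r + p - j`. -/
def word (c : ALab l) : List ALetter :=
  xBlock (c.k + c.p - c.q) (c.q - c.p - (c.r + c.p - c.j)) (c.r + c.p - c.j) ++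
    yBlock (c.j - c.p - c.r) (min c.r (c.j - c.p)) c.p

/-- `f₀` sends the label `c` to `c'`. -/
def F0 (c c' : ALab l) : Prop :=
  c'.i = c.i ∧ c'.k = c.k ∧ c'.j = c.j ∧ c'.p = c.p ∧ c'.q = c.q ∧ c'.r = c.r + 1

/-- `f₁` sends the label `c` to `c'`. -/
def F1 (c c' : ALab l) : Prop :=
  c'.i = c.i ∧ c'.k = c.k ∧ c'.j = c.j ∧
    (c.q < c.p + c.r ∧ c'.p = c.p + 1 ∧ c'.q = c.q + 1 ∧ c'.r + 1 = c.r ∨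
      c.p + c.r ≤ c.q ∧ c'.p = c.p ∧ c'.q = c.q + 1 ∧ c'.r = c.r)

theorem wordEps_zero (c : ALab l) :
    aLetters.wordEps .zero c.word = (c.r, c.j + c.q - 2 * c.p - c.r) := by
  obtain ⟨i, k, j, p, q, r, h1, h2, h3, h4, h5, h6, h7, h8⟩ := c
  simp only [word, wordEps_append, wordEps_zero_xBlock, wordEps_zero_yBlock, Prod.mk.injEq]
  omega

theorem wordEps_one (c : ALab l) :
    aLetters.wordEps .one c.word =
      (max c.p (c.q - c.r), c.k + c.p - c.q + (c.r - (c.q - c.p))) := by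
  obtain ⟨i, k, j, p, q, r, h1, h2, h3, h4, h5, h6, h7, h8⟩ := c
  simp only [word, wordEps_append, wordEps_one_xBlock, wordEps_one_yBlock, Prod.mk.injEq]
  omega

theorem wordF_zero {c c' : ALab l} (h : c.F0 c') :
    aLetters.wordF .zero c.word = some c'.word := by
  obtain ⟨i, k, j, p, q, r, h1, h2, h3, h4, h5, h6, h7, h8⟩ := c
  obtain ⟨i', k', j', p', q', r', g1, g2, g3, g4, g5, g6, g7, g8⟩ := c'
  simp only [F0] at h
  obtain ⟨rfl, rfl, rfl, rfl, rfl, rfl⟩ := h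
  simp only [word]
  by_cases hr : r + p' < j'
  · rw [wordF_append_of_lt _ _ _ _
      (by rw [wordEps_zero_xBlock, wordEps_zero_yBlock]; dsimp only; omega)]
    obtain ⟨d, hd⟩ : ∃ d, j' - p' - r = d + 1 := ⟨j' - p' - r - 1, by omega⟩
    have e1 : j' - p' - (r + 1) = d := by omega
    have e2 : min (r + 1) (j' - p') = min r (j' - p') + 1 := by omega
    have e3 : r + 1 + p' - j' = r + p' - j' := by omega
    rw [hd, e1, e2, e3, wordF_zero_yBlock]
    rfl
  · rw [wordF_append_of_le _ _ aLetters_isRegular _ _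
      (by rw [wordEps_zero_xBlock, wordEps_zero_yBlock]; dsimp only; omega)]
    obtain ⟨d, hd⟩ : ∃ d, q' - p' - (r + p' - j') = d + 1 :=
      ⟨q' - p' - (r + p' - j') - 1, by omega⟩
    have e1 : q' - p' - (r + 1 + p' - j') = d := by omega
    have e2 : min (r + 1) (j' - p') = min r (j' - p') := by omega
    have e3 : r + 1 + p' - j' = r + p' - j' + 1 := by omega
    have e4 : j' - p' - (r + 1) = j' - p' - r := by omega
    rw [hd, e1, e2, e3, e4, wordF_zero_xBlock]
    rfl

theorem wordF_one {c c' : ALab l} (h : c.F1 c') :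
    aLetters.wordF .one c.word = some c'.word := by
  obtain ⟨i, k, j, p, q, r, h1, h2, h3, h4, h5, h6, h7, h8⟩ := c
  obtain ⟨i', k', j', p', q', r', g1, g2, g3, g4, g5, g6, g7, g8⟩ := c'
  simp only [F1] at h
  obtain ⟨rfl, rfl, rfl, ⟨h, rfl, rfl, rfl⟩ | ⟨h, rfl, rfl, rfl⟩⟩ := h <;> simp only [word]
  · rw [wordF_append_of_lt _ _ _ _
      (by rw [wordEps_one_xBlock, wordEps_one_yBlock]; dsimp only; omega)]
    obtain ⟨e, he⟩ : ∃ e, min (r' + 1) (j' - p) = e + 1 := ⟨min (r' + 1) (j' - p) - 1, by omega⟩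
    have e1 : min r' (j' - (p + 1)) = e := by omega
    have e2 : k' + (p + 1) - (q + 1) = k' + p - q := by omega
    have e3 : q + 1 - (p + 1) = q - p := by omega
    have e4 : r' + (p + 1) - j' = r' + 1 + p - j' := by omega
    have e5 : j' - (p + 1) - r' = j' - p - (r' + 1) := by omega
    rw [he, e1, e2, e3, e4, e5, wordF_one_yBlock]
    rfl
  · rw [wordF_append_of_le _ _ aLetters_isRegular _ _
      (by rw [wordEps_one_xBlock, wordEps_one_yBlock]; dsimp only; omega)]
    obtain ⟨d, hd⟩ : ∃ d, k' + p' - q = d + 1 := ⟨k' + p' - q - 1, by omega⟩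
    have e1 : k' + p' - (q + 1) = d := by omega
    have e2 : q + 1 - p' - (r' + p' - j') = q - p' - (r' + p' - j') + 1 := by omega
    rw [hd, e1, e2, wordF_one_xBlock]
    rfl

theorem exists_F0 (c : ALab l) (h : c.r + 2 * c.p < c.j + c.q) : ∃ c', c.F0 c' := by
  obtain ⟨i, k, j, p, q, r, h1, h2, h3, h4, h5, h6, h7, h8⟩ := c
  exact ⟨⟨i, k, j, p, q, r + 1, h1, h2, h3, h4, h5, h6, h7, by simp only at h; omega⟩,
    by simp [F0]⟩

theorem exists_F0_inv (c : ALab l) (h : 0 < c.r) : ∃ c' : ALab l, c'.F0 c := by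
  obtain ⟨i, k, j, p, q, r, h1, h2, h3, h4, h5, h6, h7, h8⟩ := c
  exact ⟨⟨i, k, j, p, q, r - 1, h1, h2, h3, h4, h5, h6, h7, by omega⟩, by simp [F0] at *; omega⟩

theorem exists_F1 (c : ALab l) (h : c.q < c.p + c.k ∨ c.q < c.p + c.r) : ∃ c', c.F1 c' := by
  obtain ⟨i, k, j, p, q, r, h1, h2, h3, h4, h5, h6, h7, h8⟩ := c
  simp only at h
  by_cases h' : q < p + r
  · exact ⟨⟨i, k, j, p + 1, q + 1, r - 1, h1, h2, h3, h4, by omega, by omega, by omega,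
      by omega⟩, by simp [F1]; omega⟩
  · exact ⟨⟨i, k, j, p, q + 1, r, h1, h2, h3, h4, by omega, by omega, by omega, by omega⟩,
      by simp [F1]; omega⟩

theorem exists_F1_inv (c : ALab l) (h : 0 < c.p ∨ c.r < c.q) : ∃ c' : ALab l, c'.F1 c := by
  obtain ⟨i, k, j, p, q, r, h1, h2, h3, h4, h5, h6, h7, h8⟩ := c
  simp only at h
  by_cases h' : q ≤ p + r
  · exact ⟨⟨i, k, j, p - 1, q - 1, r + 1, h1, h2, h3, h4, by omega, by omega, by omega,
      by omega⟩, by simp [F1]; omega⟩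
  · exact ⟨⟨i, k, j, p, q - 1, r, h1, h2, h3, h4, by omega, by omega, by omega, by omega⟩,
      by simp [F1]; omega⟩

theorem reachable (c : ALab l) :
    Relation.ReflTransGen aLetters.words.Step (aHighest c.k c.j) c.word := by
  induction hn : c.p + c.q + c.r generalizing c with
  | zero =>
    have h1 : c.p = 0 := by omega
    have h2 : c.q = 0 := by omega
    have h3 : c.r = 0 := by omega
    rw [word, h1, h2, h3]
    simp only [xBlock, yBlock]
    simp
    exact .refl
  | succ n ih =>
    by_cases hr : 0 < c.r
    · obtain ⟨c', h⟩ := c.exists_F0_inv hr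
      have hc := ih c' (by have := c'.p; obtain ⟨-, -, -, h4, h5, h6⟩ := h; omega)
      rw [h.2.1, h.2.2.1]
      exact hc.tail ⟨.zero, Or.inl (wordF_zero h)⟩
    · obtain ⟨c', h⟩ := c.exists_F1_inv (by have := c.p_le_q; omega)
      have hc := ih c' (by obtain ⟨-, -, -, h⟩ := h; omega)
      rw [h.2.1, h.2.2.1]
      exact hc.tail ⟨.one, Or.inl (wordF_one h)⟩

/-- The element of `𝒜` with the given label. -/
def toASet (c : ALab l) : ASet l :=
  ⟨⟨c.i, c.k, c.j, by have := c.i_le_k; have := c.k_le; omega, c.i_le_k,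
    by have := c.k_le; omega, c.i_le_j, by have := c.j_le; omega⟩, c.word, c.reachable⟩

theorem toASet_injective : Function.Injective (toASet (l := l)) := by
  intro c c' h
  have hi : c.i = c'.i := congrArg (fun b : ASet l => b.1.i) h
  have hk : c.k = c'.k := congrArg (fun b : ASet l => b.1.k) h
  have hj : c.j = c'.j := congrArg (fun b : ASet l => b.1.j) h
  have hw : c.word = c'.word := congrArg (fun b : ASet l => b.2.1) h
  have h0 := c.wordEps_zero
  have h1 := c.wordEps_one
  rw [hw, wordEps_zero, Prod.mk.injEq] at h0
  rw [hw, wordEps_one, Prod.mk.injEq] at h1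
  have := c.p_le_q
  have := c'.p_le_q
  have := c.r_le
  have := c'.r_le
  ext <;> omega

theorem exists_word_of_reachable {w₀ w : List ALetter}
    (h : Relation.ReflTransGen aLetters.words.Step w₀ w) (c₀ : ALab l) (h₀ : c₀.word = w₀) :
    ∃ c : ALab l, c.i = c₀.i ∧ c.k = c₀.k ∧ c.j = c₀.j ∧ c.word = w := by
  induction h with
  | refl => exact ⟨c₀, rfl, rfl, rfl, h₀⟩
  | @tail w w' _ hs ih =>
    obtain ⟨c, h1, h2, h3, rfl⟩ := ih
    have hE0 := c.wordEps_zero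
    have hE1 := c.wordEps_one
    obtain ⟨i, hf | he⟩ := hs
    · have hφ : (aLetters.wordEps i c.word).2 ≠ 0 := by
        intro h
        have h' : aLetters.words.f i c.word = none :=
          (aLetters_isRegular.words.f_none_iff).2 h
        rw [hf] at h'
        cases h'
      cases i with
      | zero =>
        rw [hE0] at hφ
        obtain ⟨c', hc⟩ := c.exists_F0 (by dsimp only at hφ; omega)
        have hw := wordF_zero hc
        rw [show aLetters.wordF .zero c.word = some w' from hf] at hw
        refine ⟨c', hc.1.trans h1, hc.2.1.trans h2, hc.2.2.1.trans h3, (Option.some.inj hw).symm⟩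
      | one =>
        rw [hE1] at hφ
        obtain ⟨c', hc⟩ := c.exists_F1 (by have := c.p_le_q; dsimp only at hφ; omega)
        have hw := wordF_one hc
        rw [show aLetters.wordF .one c.word = some w' from hf] at hw
        refine ⟨c', hc.1.trans h1, hc.2.1.trans h2, hc.2.2.1.trans h3, (Option.some.inj hw).symm⟩
    · have hε : (aLetters.wordEps i c.word).1 ≠ 0 := by
        intro h
        have h' : aLetters.words.e i c.word = none :=
          (aLetters_isRegular.words.e_none_iff).2 h
        rw [he] at h'
        cases h'
      cases i with
      | zero =>
        rw [hE0] at hε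
        obtain ⟨c', hc⟩ := c.exists_F0_inv (by dsimp only at hε; omega)
        have hw := (aLetters_isRegular.words.e_eq_iff .zero _ _).2 (wordF_zero hc)
        rw [he] at hw
        refine ⟨c', hc.1.symm.trans h1, hc.2.1.symm.trans h2, hc.2.2.1.symm.trans h3,
          (Option.some.inj hw).symm⟩
      | one =>
        rw [hE1] at hε
        obtain ⟨c', hc⟩ := c.exists_F1_inv (by have := c.p_le_q; dsimp only at hε; omega)
        have hw := (aLetters_isRegular.words.e_eq_iff .one _ _).2 (wordF_one hc)
        rw [he] at hw
        refine ⟨c', hc.1.symm.trans h1, hc.2.1.symm.trans h2, hc.2.2.1.symm.trans h3,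
          (Option.some.inj hw).symm⟩

theorem toASet_surjective : Function.Surjective (toASet (l := l)) := by
  rintro ⟨⟨i, k, j, h1, h2, h3, h4, h5⟩, w, hw⟩
  have hk : i + k ≤ l := by omega
  have hj : i + j ≤ l := by omega
  obtain ⟨c, rfl, rfl, rfl, rfl⟩ := exists_word_of_reachable hw
    ⟨i, k, j, 0, 0, 0, h2, h4, hk, hj, Nat.zero_le _, le_rfl, Nat.zero_le _, Nat.zero_le _⟩
    (by simp [word, xBlock, yBlock, aHighest])
  exact ⟨c, rfl⟩

theorem toASet_eq_mk {c c' : ALab l} (hi : c'.i = c.i) (hk : c'.k = c.k) (hj : c'.j = c.j)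
    (h : Relation.ReflTransGen aLetters.words.Step (aHighest c.k c.j) c'.word) :
    (⟨c.toASet.1, c'.word, h⟩ : ASet l) = c'.toASet := by
  obtain ⟨i, k, j, p, q, r, h1, h2, h3, h4, h5, h6, h7, h8⟩ := c
  obtain ⟨i', k', j', p', q', r', g1, g2, g3, g4, g5, g6, g7, g8⟩ := c'
  simp only at hi hk hj
  subst hi hk hj
  rfl

theorem f_zero_toASet {c c' : ALab l} (h : c.F0 c') :
    (aCrystal l).f .zero c.toASet = some c'.toASet := by
  have h1 := wordF_zero h
  have h2 : Relation.ReflTransGen aLetters.words.Step (aHighest c.k c.j) c'.word := by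
    rw [← h.2.1, ← h.2.2.1]; exact c'.reachable
  rw [← toASet_eq_mk h.1 h.2.1 h.2.2.1 h2]
  exact Option.map_eq_some_iff.2 ⟨⟨c'.word, h2⟩, IsRegular.component_f.2 h1, rfl⟩

theorem f_one_toASet {c c' : ALab l} (h : c.F1 c') :
    (aCrystal l).f .one c.toASet = some c'.toASet := by
  have h1 := wordF_one h
  have h2 : Relation.ReflTransGen aLetters.words.Step (aHighest c.k c.j) c'.word := by
    rw [← h.2.1, ← h.2.2.1]; exact c'.reachable
  rw [← toASet_eq_mk h.1 h.2.1 h.2.2.1 h2]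
  exact Option.map_eq_some_iff.2 ⟨⟨c'.word, h2⟩, IsRegular.component_f.2 h1, rfl⟩

theorem eps_zero_toASet (c : ALab l) : (aCrystal l).ε .zero c.toASet = c.r :=
  congrArg Prod.fst c.wordEps_zero

theorem phi_zero_toASet (c : ALab l) :
    (aCrystal l).φ .zero c.toASet = c.j + c.q - 2 * c.p - c.r :=
  congrArg Prod.snd c.wordEps_zero

theorem eps_one_toASet (c : ALab l) : (aCrystal l).ε .one c.toASet = max c.p (c.q - c.r) :=
  congrArg Prod.fst c.wordEps_one

theorem phi_one_toASet (c : ALab l) :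
    (aCrystal l).φ .one c.toASet = c.k + c.p - c.q + (c.r - (c.q - c.p)) :=
  congrArg Prod.snd c.wordEps_one

theorem wt_zero_toASet (c : ALab l) :
    (aCrystal l).wt c.toASet .zero = c.j + c.q - 2 * c.p - 2 * c.r := by
  have h := (aCrystal_isRegular l).phi_eq .zero c.toASet
  rw [eps_zero_toASet, phi_zero_toASet] at h
  have := c.r_le
  omega

theorem wt_one_toASet (c : ALab l) :
    (aCrystal l).wt c.toASet .one = c.k - 2 * c.q + c.p + c.r := by
  have h := (aCrystal_isRegular l).phi_eq .one c.toASet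
  rw [eps_one_toASet, phi_one_toASet] at h
  have := c.p_le_q
  have := c.q_le
  omega

theorem f_zero_eq_some_iff {c c' : ALab l} :
    (aCrystal l).f .zero c.toASet = some c'.toASet ↔ c.F0 c' := by
  refine ⟨fun h => ?_, f_zero_toASet⟩
  have h1 := (aCrystal_isRegular l).phi_f h
  rw [phi_zero_toASet, phi_zero_toASet] at h1
  obtain ⟨c'', h2⟩ := c.exists_F0 (by omega)
  rw [f_zero_toASet h2] at h
  rwa [← toASet_injective (Option.some.inj h)]

theorem f_one_eq_some_iff {c c' : ALab l} :
    (aCrystal l).f .one c.toASet = some c'.toASet ↔ c.F1 c' := by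
  refine ⟨fun h => ?_, f_one_toASet⟩
  have h1 := (aCrystal_isRegular l).phi_f h
  rw [phi_one_toASet, phi_one_toASet] at h1
  obtain ⟨c'', h2⟩ := c.exists_F1 (by have := c.p_le_q; omega)
  rw [f_one_toASet h2] at h
  rwa [← toASet_injective (Option.some.inj h)]

end ALab

end

section

open CrystalData

namespace ALab

variable {l : ℕ}

theorem opIter_f_zero (n : ℕ) {c c' : ALab l} (hi : c'.i = c.i) (hk : c'.k = c.k)
    (hj : c'.j = c.j) (hp : c'.p = c.p) (hq : c'.q = c.q) (hr : c'.r = c.r + n) :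
    opIter ((aCrystal l).f .zero) n c.toASet = some c'.toASet := by
  induction n generalizing c' with
  | zero => rw [show c' = c by ext <;> assumption]; rfl
  | succ n ih =>
    obtain ⟨d, hd⟩ := c'.exists_F0_inv (by omega)
    have hd' := hd
    obtain ⟨h1, h2, h3, h4, h5, h6⟩ := hd
    rw [opIter, ih (c' := d) (by omega) (by omega) (by omega) (by omega) (by omega) (by omega)]
    exact f_zero_toASet hd'

theorem opIter_f_one (n : ℕ) {c c' : ALab l} (hi : c'.i = c.i) (hk : c'.k = c.k)
    (hj : c'.j = c.j) (hp₀ : c.p = 0) (hq₀ : c.q = 0)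
    (hp : c'.p = min n c.r) (hq : c'.q = n) (hr : c'.r = c.r - n) :
    opIter ((aCrystal l).f .one) n c.toASet = some c'.toASet := by
  induction n generalizing c' with
  | zero => rw [show c' = c by ext <;> omega]; rfl
  | succ n ih =>
    obtain ⟨d, hd⟩ := c'.exists_F1_inv (by omega)
    have hd' := hd
    have := d.p_le_q
    obtain ⟨h1, h2, h3, h4⟩ := hd
    rw [opIter, ih (c' := d) (by omega) (by omega) (by omega) (by omega) (by omega) (by omega)]
    exact f_one_toASet hd'

theorem aElt_eq (c : ALab l) : aElt l c.i c.k c.j c.p c.q c.r = some c.toASet := by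
  obtain ⟨i, k, j, p, q, r, h1, h2, h3, h4, h5, h6, h7, h8⟩ := c
  let c0 : ALab l := ⟨i, k, j, 0, 0, 0, h1, h2, h3, h4, Nat.zero_le _, le_rfl, Nat.zero_le _,
    Nat.zero_le _⟩
  let c1 : ALab l := ⟨i, k, j, 0, 0, p, h1, h2, h3, h4, Nat.zero_le _, le_rfl, Nat.zero_le _,
    by omega⟩
  let c2 : ALab l := ⟨i, k, j, p, q, 0, h1, h2, h3, h4, h5, h6, h7, by omega⟩
  have e0 : aTop l i k j = some c0.toASet := by
    rw [aTop, dif_pos (by omega)]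
    have hw : aHighest k j = c0.word := by simp [word, c0, xBlock, yBlock, aHighest]
    exact congrArg some (Sigma.ext rfl (heq_of_eq (Subtype.ext hw)))
  have e1 := opIter_f_zero p (c := c0) (c' := c1) rfl rfl rfl rfl rfl (Nat.zero_add p).symm
  have e2 := opIter_f_one q (c := c1) (c' := c2) rfl rfl rfl rfl rfl (min_eq_right h6).symm rfl
    (Nat.sub_eq_zero_of_le h6).symm
  rw [aElt, e0, Option.bind_some, e1, Option.bind_some, e2, Option.bind_some]
  exact opIter_f_zero r rfl rfl rfl rfl rfl (Nat.zero_add r).symm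

/-- If `f₀^r f₁^q f₀^p` does not kill the highest weight element labelled `(i, k, j)`, then the six
numbers form a label. The inequality for `r` comes from the length of the `0`-string. -/
theorem exists_of_aElt {i k j p q r : ℕ} {b : ASet l} (hp : p ≤ j) (hpq : p ≤ q) (hq : q ≤ p + k)
    (hr : r + 2 * p ≤ j + q) (h : aElt l i k j p q r = some b) :
    ∃ c : ALab l, c.i = i ∧ c.k = k ∧ c.j = j ∧ c.p = p ∧ c.q = q ∧ c.r = r ∧ b = c.toASet := by
  have ht : (i ≤ l / 2 ∧ i ≤ k ∧ k ≤ l - i) ∧ i ≤ j ∧ j ≤ l - i := by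
    by_contra hc
    rw [aElt, aTop, dif_neg hc] at h
    cases h
  have hk : i + k ≤ l := by omega
  have hj : i + j ≤ l := by omega
  refine ⟨⟨i, k, j, p, q, r, ht.1.2.1, ht.2.1, hk, hj, hp, hpq, hq, hr⟩,
    rfl, rfl, rfl, rfl, rfl, rfl, ?_⟩
  have := aElt_eq ⟨i, k, j, p, q, r, ht.1.2.1, ht.2.1, hk, hj, hp, hpq, hq, hr⟩
  exact Option.some.inj (h.symm.trans this)

end ALab

end

/-! ### Halves of the rows in `𝒢^l` -/

section

open CrystalData GLetter

/-- The Cartan matrix of `G₂`. -/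
def cartanG : GIdx → GIdx → ℤ
  | .one, .one => 2
  | .one, .two => -1
  | .two, .one => -3
  | .two, .two => 2

theorem gLetters_isRegular : gLetters.IsRegular cartanG where
  diag i := by cases i <;> rfl
  phi_eq i b := by simp [gLetters]
  e_eq_iff i b b' := by
    cases i <;> cases b <;> cases b' <;> simp [gLetters, GLetter.e, GLetter.f]
  wt_e i b b' h j := by
    cases i <;> cases b <;> simp [gLetters, GLetter.e] at h <;> subst h <;> cases j <;>
      simp [gLetters, GLetter.eps, GLetter.phi, cartanG]
  eps_e i b b' h := by
    cases i <;> cases b <;> simp [gLetters, GLetter.e] at h <;> subst h <;>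
      simp [gLetters, GLetter.eps]
  e_none i b h := by
    cases i <;> cases b <;> simp_all [gLetters, GLetter.e, GLetter.eps]
  f_none i b h := by
    cases i <;> cases b <;> simp_all [gLetters, GLetter.f, GLetter.phi]

theorem gCrystal_isRegular (l : ℕ) : (gCrystal l).IsRegular cartanG :=
  IsRegular.directSum gLetters_isRegular.diag fun _ => gLetters_isRegular.words.component _

/-- The words `2^s 6^t`, `2^s 4 6^t`, `2^s 3 6^t`, of which the letters count as `2 ↦ (3, 0)`, `4 ↦
(1, 4)`, `3 ↦ (2, 2)`, `6 ↦ (0, 6)` in `(a, e)`. It is used for `a ≡ e` modulo `3` and even `e`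
only. -/
def lftWord (a e : ℕ) : List GLetter :=
  List.replicate (a / 3) b2 ++ ((if a % 3 = 1 then [b4] else if a % 3 = 2 then [b3] else []) ++
    List.replicate (e / 6) b6)

/-- The words `6̄^t 2̄^s`, `6̄^t 4̄ 2̄^s`, `6̄^t 3̄ 2̄^s`, of which the letters count as `2̄ ↦ (0,
3)`, `4̄ ↦ (4, 1)`, `3̄ ↦ (2, 2)`, `6̄ ↦ (6, 0)` in `(e, d)`. It is used for `d ≡ e` modulo `3` and
even `e` only. -/
def rgtWord (e d : ℕ) : List GLetter :=
  List.replicate (e / 6) c6 ++ ((if d % 3 = 1 then [c4] else if d % 3 = 2 then [c3] else []) ++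
    List.replicate (d / 3) c2)

theorem lftWord_cases {a e : ℕ} (h : a % 3 = e % 3) (he : e % 2 = 0) : ∃ s t,
    a = 3 * s ∧ e = 6 * t ∧ lftWord a e = List.replicate s b2 ++ List.replicate t b6 ∨
    a = 3 * s + 1 ∧ e = 6 * t + 4 ∧
      lftWord a e = List.replicate s b2 ++ ([b4] ++ List.replicate t b6) ∨
    a = 3 * s + 2 ∧ e = 6 * t + 2 ∧
      lftWord a e = List.replicate s b2 ++ ([b3] ++ List.replicate t b6) := by
  refine ⟨a / 3, e / 6, ?_⟩
  have h3 : a % 3 = 0 ∨ a % 3 = 1 ∨ a % 3 = 2 := by omega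
  rcases h3 with h3 | h3 | h3
  · exact Or.inl ⟨by omega, by omega, by simp [lftWord, h3]⟩
  · exact Or.inr (Or.inl ⟨by omega, by omega, by simp [lftWord, h3]⟩)
  · exact Or.inr (Or.inr ⟨by omega, by omega, by simp [lftWord, h3]⟩)

theorem rgtWord_cases {e d : ℕ} (h : d % 3 = e % 3) (he : e % 2 = 0) : ∃ s t,
    d = 3 * s ∧ e = 6 * t ∧ rgtWord e d = List.replicate t c6 ++ List.replicate s c2 ∨
    d = 3 * s + 1 ∧ e = 6 * t + 4 ∧
      rgtWord e d = List.replicate t c6 ++ ([c4] ++ List.replicate s c2) ∨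
    d = 3 * s + 2 ∧ e = 6 * t + 2 ∧
      rgtWord e d = List.replicate t c6 ++ ([c3] ++ List.replicate s c2) := by
  refine ⟨d / 3, e / 6, ?_⟩
  have h3 : d % 3 = 0 ∨ d % 3 = 1 ∨ d % 3 = 2 := by omega
  rcases h3 with h3 | h3 | h3
  · exact Or.inl ⟨by omega, by omega, by simp [rgtWord, h3]⟩
  · exact Or.inr (Or.inl ⟨by omega, by omega, by simp [rgtWord, h3]⟩)
  · exact Or.inr (Or.inr ⟨by omega, by omega, by simp [rgtWord, h3]⟩)

section blocks

theorem wordEps_one_b2 (n : ℕ) : gLetters.wordEps .one (List.replicate n b2) = (n, 0) := by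
  rw [wordEps_replicate_of_phi gLetters .one (b := b2) rfl]; simp [gLetters, GLetter.eps]

theorem wordEps_two_b2 (n : ℕ) : gLetters.wordEps .two (List.replicate n b2) = (0, n * 3) := by
  rw [wordEps_replicate_of_eps gLetters .two (b := b2) rfl]; simp [gLetters, GLetter.phi]

theorem wordEps_one_b6 (n : ℕ) : gLetters.wordEps .one (List.replicate n b6) = (0, n * 2) := by
  rw [wordEps_replicate_of_eps gLetters .one (b := b6) rfl]; simp [gLetters, GLetter.phi]

theorem wordEps_two_b6 (n : ℕ) : gLetters.wordEps .two (List.replicate n b6) = (n * 3, 0) := by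
  rw [wordEps_replicate_of_phi gLetters .two (b := b6) rfl]; simp [gLetters, GLetter.eps]

theorem wordEps_one_c2 (n : ℕ) : gLetters.wordEps .one (List.replicate n c2) = (0, n) := by
  rw [wordEps_replicate_of_eps gLetters .one (b := c2) rfl]; simp [gLetters, GLetter.phi]

theorem wordEps_two_c2 (n : ℕ) : gLetters.wordEps .two (List.replicate n c2) = (n * 3, 0) := by
  rw [wordEps_replicate_of_phi gLetters .two (b := c2) rfl]; simp [gLetters, GLetter.eps]

theorem wordEps_one_c6 (n : ℕ) : gLetters.wordEps .one (List.replicate n c6) = (n * 2, 0) := by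
  rw [wordEps_replicate_of_phi gLetters .one (b := c6) rfl]; simp [gLetters, GLetter.eps]

theorem wordEps_two_c6 (n : ℕ) : gLetters.wordEps .two (List.replicate n c6) = (0, n * 3) := by
  rw [wordEps_replicate_of_eps gLetters .two (b := c6) rfl]; simp [gLetters, GLetter.phi]

theorem wordEps_singleton (i : GIdx) (b : GLetter) :
    gLetters.wordEps i [b] = (GLetter.eps i b, GLetter.phi i b) := by
  simp [wordEps, gLetters]

end blocks

section halves

variable {a e d : ℕ}

theorem wordEps_one_lftWord (h : a % 3 = e % 3) (he : e % 2 = 0) :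
    gLetters.wordEps .one (lftWord a e) = ((a - e) / 3, (e - a) / 3) := by
  obtain ⟨s, t, ⟨rfl, rfl, hw⟩ | ⟨rfl, rfl, hw⟩ | ⟨rfl, rfl, hw⟩⟩ := lftWord_cases h he <;>
    simp only [hw, wordEps_append, wordEps_one_b2, wordEps_one_b6, wordEps_singleton,
      GLetter.eps, GLetter.phi, Prod.mk.injEq] <;> omega

theorem wordEps_two_lftWord (h : a % 3 = e % 3) (he : e % 2 = 0) :
    gLetters.wordEps .two (lftWord a e) = (e / 2, a) := by
  obtain ⟨s, t, ⟨rfl, rfl, hw⟩ | ⟨rfl, rfl, hw⟩ | ⟨rfl, rfl, hw⟩⟩ := lftWord_cases h he <;>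
    simp only [hw, wordEps_append, wordEps_two_b2, wordEps_two_b6, wordEps_singleton,
      GLetter.eps, GLetter.phi, Prod.mk.injEq] <;> omega

theorem wordEps_one_rgtWord (h : d % 3 = e % 3) (he : e % 2 = 0) :
    gLetters.wordEps .one (rgtWord e d) = ((e - d) / 3, (d - e) / 3) := by
  obtain ⟨s, t, ⟨rfl, rfl, hw⟩ | ⟨rfl, rfl, hw⟩ | ⟨rfl, rfl, hw⟩⟩ := rgtWord_cases h he <;>
    simp only [hw, wordEps_append, wordEps_one_c2, wordEps_one_c6, wordEps_singleton,
      GLetter.eps, GLetter.phi, Prod.mk.injEq] <;> omega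

theorem wordEps_two_rgtWord (h : d % 3 = e % 3) (he : e % 2 = 0) :
    gLetters.wordEps .two (rgtWord e d) = (d, e / 2) := by
  obtain ⟨s, t, ⟨rfl, rfl, hw⟩ | ⟨rfl, rfl, hw⟩ | ⟨rfl, rfl, hw⟩⟩ := rgtWord_cases h he <;>
    simp only [hw, wordEps_append, wordEps_two_c2, wordEps_two_c6, wordEps_singleton,
      GLetter.eps, GLetter.phi, Prod.mk.injEq] <;> omega

theorem wordF_singleton (i : GIdx) (b : GLetter) :
    gLetters.wordF i [b] = (GLetter.f i b).map fun b' => [b'] := by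
  simp [wordF, wordEps, gLetters]

theorem wordF_two_lftWord (h : (a + 1) % 3 = e % 3) (he : e % 2 = 0) :
    gLetters.wordF .two (lftWord (a + 1) e) = some (lftWord a (e + 2)) := by
  have hR := gLetters_isRegular
  obtain ⟨s, t, ⟨h1, rfl, hw⟩ | ⟨h1, rfl, hw⟩ | ⟨h1, rfl, hw⟩⟩ := lftWord_cases h he
  · obtain ⟨s', rfl⟩ : ∃ s', s = s' + 1 := ⟨s - 1, by omega⟩
    obtain rfl : a = 3 * s' + 2 := by omega
    have h6 : (6 * t + 2) / 6 = t := by omega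
    have h3 : (3 * s' + 2) / 3 = s' := by omega
    rw [hw, wordF_append_of_le _ _ hR _ _ (by rw [wordEps_two_b6]; simp),
      wordF_replicate_of_eps gLetters .two (b := b2) rfl (by decide) rfl]
    simp [lftWord, h6, h3]
  · obtain rfl : a = 3 * s := by omega
    have h6 : (6 * t + 4 + 2) / 6 = t + 1 := by omega
    rw [hw, wordF_append_of_lt, wordF_append_of_le _ _ hR _ _ (by rw [wordEps_two_b6]; simp),
      wordF_singleton]
    · simp [lftWord, h6, GLetter.f, List.replicate_succ]
    · simp only [wordEps_append, wordEps_two_b2, wordEps_two_b6, wordEps_singleton, GLetter.eps,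
        GLetter.phi]
      omega
  · obtain rfl : a = 3 * s + 1 := by omega
    have h6 : (6 * t + 2 + 2) / 6 = t := by omega
    have h3 : (3 * s + 1) / 3 = s := by omega
    rw [hw, wordF_append_of_lt, wordF_append_of_le _ _ hR _ _ (by rw [wordEps_two_b6]; simp),
      wordF_singleton]
    · simp [lftWord, h6, h3, GLetter.f]
    · simp only [wordEps_append, wordEps_two_b2, wordEps_two_b6, wordEps_singleton, GLetter.eps,
        GLetter.phi]
      omega

theorem wordF_two_rgtWord (h : d % 3 = (e + 2) % 3) (he : e % 2 = 0) :
    gLetters.wordF .two (rgtWord (e + 2) d) = some (rgtWord e (d + 1)) := by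
  have hR := gLetters_isRegular
  obtain ⟨s, t, ⟨rfl, h1, hw⟩ | ⟨rfl, h1, hw⟩ | ⟨rfl, h1, hw⟩⟩ :=
    rgtWord_cases (e := e + 2) h (by omega)
  · obtain ⟨t', rfl⟩ : ∃ s', t = s' + 1 := ⟨t - 1, by omega⟩
    obtain rfl : e = 6 * t' + 4 := by omega
    have h6 : (6 * t' + 4) / 6 = t' := by omega
    have h3 : (3 * s + 1) / 3 = s := by omega
    rw [hw, wordF_append_of_le _ _ hR _ _ (by rw [wordEps_two_c2]; simp),
      wordF_replicate_of_eps gLetters .two (b := c6) rfl (by decide) rfl]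
    simp [rgtWord, h6, h3]
  · obtain rfl : e = 6 * t + 2 := by omega
    have h6 : (6 * t + 2) / 6 = t := by omega
    have h3 : (3 * s + 1 + 1) / 3 = s := by omega
    have h2 : (3 * s + 1 + 1) % 3 = 2 := by omega
    rw [hw, wordF_append_of_lt, wordF_append_of_le _ _ hR _ _ (by rw [wordEps_two_c2]; simp),
      wordF_singleton]
    · simp [rgtWord, h6, h3, h2, GLetter.f]
    · simp only [wordEps_append, wordEps_two_c2, wordEps_two_c6, wordEps_singleton, GLetter.eps,
        GLetter.phi]
      omega
  · obtain rfl : e = 6 * t := by omega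
    have h3 : (3 * s + 2 + 1) / 3 = s + 1 := by omega
    have h2 : (3 * s + 2 + 1) % 3 = 0 := by omega
    rw [hw, wordF_append_of_lt, wordF_append_of_le _ _ hR _ _ (by rw [wordEps_two_c2]; simp),
      wordF_singleton]
    · simp [rgtWord, h3, h2, GLetter.f, List.replicate_succ]
    · simp only [wordEps_append, wordEps_two_c2, wordEps_two_c6, wordEps_singleton, GLetter.eps,
        GLetter.phi]
      omega

theorem wordF_one_lftWord (h : a % 3 = e % 3) (he : e % 2 = 0) (hlt : a < e + 6) :
    gLetters.wordF .one (lftWord a (e + 6)) = some (lftWord a e ++ [z1]) := by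
  have hf := wordF_replicate_of_eps gLetters .one (b := b6) rfl (by decide) rfl
  obtain ⟨s, t, ⟨rfl, h1, hw⟩ | ⟨rfl, h1, hw⟩ | ⟨rfl, h1, hw⟩⟩ :=
    lftWord_cases (a := a) (e := e + 6) (by omega) (by omega)
  all_goals obtain ⟨t', rfl⟩ : ∃ s', t = s' + 1 := ⟨t - 1, by omega⟩
  · obtain rfl : e = 6 * t' := by omega
    rw [hw, wordF_append_of_lt _ _ _ _ (by rw [wordEps_one_b2, wordEps_one_b6]; dsimp only; omega),
      hf]
    simp [lftWord]
  · obtain rfl : e = 6 * t' + 4 := by omega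
    have h6 : (6 * t' + 4) / 6 = t' := by omega
    have h3 : (3 * s + 1) / 3 = s := by omega
    rw [hw, ← List.append_assoc, wordF_append_of_lt, hf]
    · simp [lftWord, h6, h3]
    · simp only [wordEps_append, wordEps_one_b2, wordEps_one_b6, wordEps_singleton, GLetter.eps,
        GLetter.phi]
      omega
  · obtain rfl : e = 6 * t' + 2 := by omega
    have h6 : (6 * t' + 2) / 6 = t' := by omega
    have h3 : (3 * s + 2) / 3 = s := by omega
    rw [hw, ← List.append_assoc, wordF_append_of_lt, hf]
    · simp [lftWord, h6, h3]
    · simp only [wordEps_append, wordEps_one_b2, wordEps_one_b6, wordEps_singleton, GLetter.eps,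
        GLetter.phi]
      omega

theorem wordF_one_rgtWord (h : d % 3 = e % 3) (he : e % 2 = 0) (hlt : e < d + 3) :
    gLetters.wordF .one (rgtWord e (d + 3)) = some (rgtWord e d ++ [c1]) := by
  have hf := wordF_replicate_of_eps gLetters .one (b := c2) rfl (by decide) rfl
  obtain ⟨s, t, ⟨h1, rfl, hw⟩ | ⟨h1, rfl, hw⟩ | ⟨h1, rfl, hw⟩⟩ :=
    rgtWord_cases (e := e) (d := d + 3) (by omega) (by omega)
  all_goals obtain ⟨s', rfl⟩ : ∃ s', s = s' + 1 := ⟨s - 1, by omega⟩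
  · obtain rfl : d = 3 * s' := by omega
    rw [hw, wordF_append_of_lt _ _ _ _ (by rw [wordEps_one_c2, wordEps_one_c6]; dsimp only; omega),
      hf]
    simp [rgtWord]
  · obtain rfl : d = 3 * s' + 1 := by omega
    have h6 : (6 * t + 4) / 6 = t := by omega
    have h3 : (3 * s' + 1) / 3 = s' := by omega
    rw [hw, ← List.append_assoc, wordF_append_of_lt, hf]
    · simp [rgtWord, h6, h3]
    · simp only [wordEps_append, wordEps_one_c2, wordEps_one_c6, wordEps_singleton, GLetter.eps,
        GLetter.phi]
      omega
  · obtain rfl : d = 3 * s' + 2 := by omega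
    have h6 : (6 * t + 2) / 6 = t := by omega
    have h3 : (3 * s' + 2) / 3 = s' := by omega
    rw [hw, ← List.append_assoc, wordF_append_of_lt, hf]
    · simp [rgtWord, h6, h3]
    · simp only [wordEps_append, wordEps_one_c2, wordEps_one_c6, wordEps_singleton, GLetter.eps,
        GLetter.phi]
      omega

end halves

end

/-! ### Rows without the letters `1` and `1̄` -/

section

open CrystalData GLetter

/-- The part of a row between the letters `1` and `1̄`. The four numbers satisfy `a₂ ≡ a₃` and `d₂ ≡
d₃` modulo `3` and `a₃ ≡ d₃` modulo `2`. For odd `a₃` there is one letter in the middle, counting as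
`5 ↦ (1, 1, 3, 0)`, `0₁ ↦ (0, 3, 3, 0)`, `0₂ ↦ (1, 1, 1, 1)`, `5̄ ↦ (0, 3, 1, 1)` in `(a₂, a₃, d₃,
d₂)`. -/
def coreWord (a2 a3 d3 d2 : ℕ) : List GLetter :=
  if a3 % 2 = 0 then lftWord a2 a3 ++ rgtWord d3 d2
  else if a3 = 1 then
    if d3 = 1 then lftWord (a2 - 1) 0 ++ z2 :: rgtWord 0 (d2 - 1)
    else lftWord (a2 - 1) 0 ++ b5 :: rgtWord (d3 - 3) d2
  else if d3 = 1 then lftWord a2 (a3 - 3) ++ c5 :: rgtWord 0 (d2 - 1)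
  else lftWord a2 (a3 - 3) ++ z1 :: rgtWord (d3 - 3) d2

theorem coreWord_even {a2 a3 : ℕ} (d3 d2 : ℕ) (h : a3 % 2 = 0) :
    coreWord a2 a3 d3 d2 = lftWord a2 a3 ++ rgtWord d3 d2 := by
  simp [coreWord, h]

theorem coreWord_z2 (a d : ℕ) :
    coreWord (a + 1) 1 1 (d + 1) = lftWord a 0 ++ z2 :: rgtWord 0 d := by
  simp [coreWord]

theorem coreWord_b5 (a e d2 : ℕ) :
    coreWord (a + 1) 1 (e + 3) d2 = lftWord a 0 ++ b5 :: rgtWord e d2 := by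
  simp [coreWord]

theorem coreWord_c5 {e : ℕ} (a2 d : ℕ) (h : e % 2 = 0) :
    coreWord a2 (e + 3) 1 (d + 1) = lftWord a2 e ++ c5 :: rgtWord 0 d := by
  have h' : (e + 3) % 2 = 1 := by omega
  simp [coreWord, h']

theorem coreWord_z1 {e : ℕ} (a2 e' d2 : ℕ) (h : e % 2 = 0) :
    coreWord a2 (e + 3) (e' + 3) d2 = lftWord a2 e ++ z1 :: rgtWord e' d2 := by
  have h' : (e + 3) % 2 = 1 := by omega
  simp [coreWord, h']

theorem lftWord_add_three (a e : ℕ) : lftWord (a + 3) e = b2 :: lftWord a e := by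
  simp [lftWord, List.replicate_succ]

theorem rgtWord_add_six (e d : ℕ) : rgtWord (e + 6) d = c6 :: rgtWord e d := by
  simp [rgtWord, List.replicate_succ]

theorem coreWord_cons {a2 a3 : ℕ} (d3 d2 : ℕ) (h : a2 % 3 = a3 % 3) :
    coreWord (a2 + 3) a3 d3 d2 = b2 :: coreWord a2 a3 d3 d2 := by
  unfold coreWord
  split_ifs with h1 h2 h3 h3
  · rw [lftWord_add_three]; rfl
  · rw [show a2 + 3 - 1 = a2 - 1 + 3 by omega, lftWord_add_three]; rfl
  · rw [show a2 + 3 - 1 = a2 - 1 + 3 by omega, lftWord_add_three]; rfl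
  · rw [lftWord_add_three]; rfl
  · rw [lftWord_add_three]; rfl

/-- The cases in the definition of `coreWord`: no middle letter, or one of `0₂`, `5`, `5̄`, `0₁`. -/
theorem coreWord_shapes {a2 a3 d3 d2 : ℕ} (h : a2 % 3 = a3 % 3) (h' : d2 % 3 = d3 % 3)
    (h'' : a3 % 2 = d3 % 2) :
    (a3 % 2 = 0 ∧ d3 % 2 = 0) ∨
    (∃ a d, a % 3 = 0 ∧ d % 3 = 0 ∧ a2 = a + 1 ∧ a3 = 1 ∧ d3 = 1 ∧ d2 = d + 1) ∨
    (∃ a e, a % 3 = 0 ∧ e % 2 = 0 ∧ d2 % 3 = e % 3 ∧ a2 = a + 1 ∧ a3 = 1 ∧ d3 = e + 3) ∨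
    (∃ e d, a2 % 3 = e % 3 ∧ e % 2 = 0 ∧ d % 3 = 0 ∧ a3 = e + 3 ∧ d3 = 1 ∧ d2 = d + 1) ∨
    ∃ e e', a2 % 3 = e % 3 ∧ e % 2 = 0 ∧ d2 % 3 = e' % 3 ∧ e' % 2 = 0 ∧ a3 = e + 3 ∧
      d3 = e' + 3 := by
  by_cases h2 : a3 % 2 = 0
  · exact Or.inl ⟨h2, by omega⟩
  refine Or.inr ?_
  by_cases h3 : a3 = 1
  · by_cases h4 : d3 = 1
    · exact Or.inl ⟨a2 - 1, d2 - 1, by omega⟩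
    · exact Or.inr (Or.inl ⟨a2 - 1, d3 - 3, by omega⟩)
  · by_cases h4 : d3 = 1
    · exact Or.inr (Or.inr (Or.inl ⟨a3 - 3, d2 - 1, by omega⟩))
    · exact Or.inr (Or.inr (Or.inr ⟨a3 - 3, d3 - 3, by omega⟩))

section core

variable {a2 a3 d3 d2 : ℕ} {u v w : ℤ}

theorem wordEps_cons (i : GIdx) (b : GLetter) (s : List GLetter) :
    gLetters.wordEps i (b :: s) =
      ((gLetters.wordEps i s).1 + (GLetter.eps i b - (gLetters.wordEps i s).2),
        GLetter.phi i b + ((gLetters.wordEps i s).2 - GLetter.eps i b)) := rfl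

theorem wordEps_one_coreWord (hu : (a3 : ℤ) = a2 + 3 * u) (hv : (d3 : ℤ) = d2 + 3 * v)
    (hw : (d3 : ℤ) = a3 + 2 * w) : gLetters.wordEps .one (coreWord a2 a3 d3 d2) =
      ((v + max (-u) 0).toNat, (u + max (-v) 0).toNat) := by
  obtain ⟨h1, h2⟩ | ⟨a, d, h1, h2, rfl, rfl, rfl, rfl⟩ | ⟨a, e, h1, h2, h3, rfl, rfl, rfl⟩ |
    ⟨e, d, h1, h2, h3, rfl, rfl, rfl⟩ | ⟨e, e', h1, h2, h3, h4, rfl, rfl⟩ :=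
    coreWord_shapes (a2 := a2) (a3 := a3) (d3 := d3) (d2 := d2) (by omega) (by omega) (by omega)
  · rw [coreWord_even _ _ h1]
    simp only [wordEps_append, wordEps_one_lftWord (a := a2) (e := a3) (by omega) (by omega),
      wordEps_one_rgtWord (d := d2) (e := d3) (by omega) (by omega), Prod.mk.injEq]
    omega
  · rw [coreWord_z2]
    simp only [wordEps_append, wordEps_cons, GLetter.eps, GLetter.phi,
      wordEps_one_lftWord (a := a) (e := 0) (by omega) (by omega),
      wordEps_one_rgtWord (d := d) (e := 0) (by omega) (by omega), Prod.mk.injEq]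
    omega
  · rw [coreWord_b5]
    simp only [wordEps_append, wordEps_cons, GLetter.eps, GLetter.phi,
      wordEps_one_lftWord (a := a) (e := 0) (by omega) (by omega),
      wordEps_one_rgtWord (d := d2) (e := e) (by omega) (by omega), Prod.mk.injEq]
    omega
  · rw [coreWord_c5 _ _ h2]
    simp only [wordEps_append, wordEps_cons, GLetter.eps, GLetter.phi,
      wordEps_one_lftWord (a := a2) (e := e) (by omega) (by omega),
      wordEps_one_rgtWord (d := d) (e := 0) (by omega) (by omega), Prod.mk.injEq]
    omega
  · rw [coreWord_z1 _ _ _ h2]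
    simp only [wordEps_append, wordEps_cons, GLetter.eps, GLetter.phi,
      wordEps_one_lftWord (a := a2) (e := e) (by omega) (by omega),
      wordEps_one_rgtWord (d := d2) (e := e') (by omega) (by omega), Prod.mk.injEq]
    omega

theorem wordEps_two_coreWord (hu : (a3 : ℤ) = a2 + 3 * u) (hv : (d3 : ℤ) = d2 + 3 * v)
    (hw : (d3 : ℤ) = a3 + 2 * w) : gLetters.wordEps .two (coreWord a2 a3 d3 d2) =
      (d2 + (-w).toNat, a2 + w.toNat) := by
  obtain ⟨h1, h2⟩ | ⟨a, d, h1, h2, rfl, rfl, rfl, rfl⟩ | ⟨a, e, h1, h2, h3, rfl, rfl, rfl⟩ |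
    ⟨e, d, h1, h2, h3, rfl, rfl, rfl⟩ | ⟨e, e', h1, h2, h3, h4, rfl, rfl⟩ :=
    coreWord_shapes (a2 := a2) (a3 := a3) (d3 := d3) (d2 := d2) (by omega) (by omega) (by omega)
  · rw [coreWord_even _ _ h1]
    simp only [wordEps_append, wordEps_two_lftWord (a := a2) (e := a3) (by omega) (by omega),
      wordEps_two_rgtWord (d := d2) (e := d3) (by omega) (by omega), Prod.mk.injEq]
    omega
  · rw [coreWord_z2]
    simp only [wordEps_append, wordEps_cons, GLetter.eps, GLetter.phi,
      wordEps_two_lftWord (a := a) (e := 0) (by omega) (by omega),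
      wordEps_two_rgtWord (d := d) (e := 0) (by omega) (by omega), Prod.mk.injEq]
    omega
  · rw [coreWord_b5]
    simp only [wordEps_append, wordEps_cons, GLetter.eps, GLetter.phi,
      wordEps_two_lftWord (a := a) (e := 0) (by omega) (by omega),
      wordEps_two_rgtWord (d := d2) (e := e) (by omega) (by omega), Prod.mk.injEq]
    omega
  · rw [coreWord_c5 _ _ h2]
    simp only [wordEps_append, wordEps_cons, GLetter.eps, GLetter.phi,
      wordEps_two_lftWord (a := a2) (e := e) (by omega) (by omega),
      wordEps_two_rgtWord (d := d) (e := 0) (by omega) (by omega), Prod.mk.injEq]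
    omega
  · rw [coreWord_z1 _ _ _ h2]
    simp only [wordEps_append, wordEps_cons, GLetter.eps, GLetter.phi,
      wordEps_two_lftWord (a := a2) (e := e) (by omega) (by omega),
      wordEps_two_rgtWord (d := d2) (e := e') (by omega) (by omega), Prod.mk.injEq]
    omega

theorem wordF_cons_of_lt {i : GIdx} {b : GLetter} {s t : List GLetter}
    (h : GLetter.eps i b < (gLetters.wordEps i s).2) (hs : gLetters.wordF i s = some t) :
    gLetters.wordF i (b :: s) = some (b :: t) := by
  rw [wordF, if_pos (by exact h), hs]; rfl

theorem wordF_cons_of_le {i : GIdx} {b b' : GLetter} {s : List GLetter}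
    (h : (gLetters.wordEps i s).2 ≤ GLetter.eps i b) (hb : GLetter.f i b = some b') :
    gLetters.wordF i (b :: s) = some (b' :: s) := by
  rw [wordF, if_neg (by exact not_lt.2 h), show gLetters.f i b = some b' from hb]; rfl

theorem wordF_append_right {i : GIdx} {s t t' : List GLetter}
    (h : (gLetters.wordEps i s).1 < (gLetters.wordEps i t).2) (ht : gLetters.wordF i t = some t') :
    gLetters.wordF i (s ++ t) = some (s ++ t') := by
  rw [wordF_append_of_lt _ _ _ _ h, ht]; rfl

theorem wordF_append_left {i : GIdx} {s s' t : List GLetter}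
    (h : (gLetters.wordEps i t).2 ≤ (gLetters.wordEps i s).1) (hs : gLetters.wordF i s = some s') :
    gLetters.wordF i (s ++ t) = some (s' ++ t) := by
  rw [wordF_append_of_le _ _ gLetters_isRegular _ _ h, hs]; rfl

theorem wordF_two_coreWord_of_pos (hu : (a3 : ℤ) = a2 + 3 * u)
    (hv : ((d3 + 2 : ℕ) : ℤ) = d2 + 3 * v) (hw : ((d3 + 2 : ℕ) : ℤ) = a3 + 2 * w) (h : 0 < w) :
    gLetters.wordF .two (coreWord a2 a3 (d3 + 2) d2) = some (coreWord a2 a3 d3 (d2 + 1)) := by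
  obtain ⟨h1, h2⟩ | ⟨a, d, h1, h2, rfl, rfl, h3, rfl⟩ | ⟨a, e, h1, h2, h3, rfl, rfl, h4⟩ |
    ⟨e, d, h1, h2, h3, rfl, h4, rfl⟩ | ⟨e, e', h1, h2, h3, h4, rfl, h5⟩ :=
    coreWord_shapes (a2 := a2) (a3 := a3) (d3 := d3 + 2) (d2 := d2) (by omega) (by omega)
      (by omega)
  · rw [coreWord_even _ _ h1, coreWord_even _ _ h1]
    refine wordF_append_right ?_ (wordF_two_rgtWord (by omega) (by omega))
    rw [wordEps_two_lftWord (by omega) (by omega), wordEps_two_rgtWord (by omega) (by omega)]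
    dsimp only; omega
  · omega
  · obtain rfl | ⟨e, rfl⟩ : e = 0 ∨ ∃ e', e = e' + 2 := by
      rcases Nat.eq_zero_or_pos e with h | h
      · exact Or.inl h
      · exact Or.inr ⟨e - 2, by omega⟩
    · obtain rfl : d3 = 1 := by omega
      rw [coreWord_b5, coreWord_z2]
      have hR := wordEps_two_rgtWord (d := d2) (e := 0) (by omega) (by omega)
      refine wordF_append_right ?_ (wordF_cons_of_le ?_ rfl)
      · rw [wordEps_cons, wordEps_two_lftWord (by omega) (by omega), hR]
        simp only [GLetter.phi, GLetter.eps]; omega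
      · rw [hR]; simp only [GLetter.eps]; omega
    · obtain rfl : d3 = e + 3 := by omega
      rw [show e + 3 + 2 = e + 2 + 3 by rfl, coreWord_b5, coreWord_b5]
      have hR := wordEps_two_rgtWord (d := d2) (e := e + 2) (by omega) (by omega)
      refine wordF_append_right ?_ (wordF_cons_of_lt ?_ (wordF_two_rgtWord (by omega) (by omega)))
      · rw [wordEps_cons, wordEps_two_lftWord (by omega) (by omega), hR]
        simp [GLetter.phi]
      · rw [hR]; simp [GLetter.eps]
  · omega
  · obtain ⟨e', rfl⟩ : ∃ f, e' = f + 2 := ⟨e' - 2, by omega⟩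
    obtain rfl : d3 = e' + 3 := by omega
    rw [show e' + 3 + 2 = e' + 2 + 3 by rfl, coreWord_z1 _ _ _ h2, coreWord_z1 _ _ _ h2]
    have hR := wordEps_two_rgtWord (d := d2) (e := e' + 2) (by omega) (by omega)
    refine wordF_append_right ?_ (wordF_cons_of_lt ?_ (wordF_two_rgtWord (by omega) (by omega)))
    · rw [wordEps_cons, wordEps_two_lftWord (by omega) (by omega), hR]
      simp only [GLetter.phi, GLetter.eps]; omega
    · rw [hR]; simp [GLetter.eps]

theorem wordF_two_coreWord_of_nonpos (hu : (a3 : ℤ) = (a2 + 1 : ℕ) + 3 * u)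
    (hv : (d3 : ℤ) = d2 + 3 * v) (hw : (d3 : ℤ) = a3 + 2 * w) (h : w ≤ 0) :
    gLetters.wordF .two (coreWord (a2 + 1) a3 d3 d2) = some (coreWord a2 (a3 + 2) d3 d2) := by
  obtain ⟨h1, h2⟩ | ⟨a, d, h1, h2, h3, rfl, rfl, rfl⟩ | ⟨a, e, h1, h2, h3, h4, rfl, rfl⟩ |
    ⟨e, d, h1, h2, h3, rfl, rfl, rfl⟩ | ⟨e, e', h1, h2, h3, h4, rfl, rfl⟩ :=
    coreWord_shapes (a2 := a2 + 1) (a3 := a3) (d3 := d3) (d2 := d2) (by omega) (by omega)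
      (by omega)
  · rw [coreWord_even _ _ h1, coreWord_even _ _ (by omega)]
    refine wordF_append_left ?_ (wordF_two_lftWord (by omega) (by omega))
    rw [wordEps_two_lftWord (by omega) (by omega), wordEps_two_rgtWord (by omega) (by omega)]
    dsimp only; omega
  · obtain rfl : a2 = a := by omega
    rw [coreWord_z2, coreWord_c5 (e := 0) _ _ rfl]
    have hR := wordEps_two_rgtWord (d := d) (e := 0) (by omega) (by omega)
    refine wordF_append_right ?_ (wordF_cons_of_le ?_ rfl)
    · rw [wordEps_cons, wordEps_two_lftWord (by omega) (by omega), hR]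
      simp only [GLetter.phi, GLetter.eps]; omega
    · rw [hR]; simp only [GLetter.eps]; omega
  · omega
  · rw [show e + 3 + 2 = e + 2 + 3 by rfl, coreWord_c5 _ _ h2, coreWord_c5 _ _ (by omega)]
    have hR := wordEps_two_rgtWord (d := d) (e := 0) (by omega) (by omega)
    refine wordF_append_left ?_ (wordF_two_lftWord (by omega) (by omega))
    rw [wordEps_cons, hR]
    simp [GLetter.phi]
  · rw [show e + 3 + 2 = e + 2 + 3 by rfl, coreWord_z1 _ _ _ h2, coreWord_z1 _ _ _ (by omega)]
    have hR := wordEps_two_rgtWord (d := d2) (e := e') (by omega) (by omega)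
    refine wordF_append_left ?_ (wordF_two_lftWord (by omega) (by omega))
    rw [wordEps_cons, wordEps_two_lftWord (by omega) (by omega), hR]
    simp only [GLetter.phi, GLetter.eps]; omega

/-- The case in which `f₁` replaces the last letter `2̄` by `1̄`. -/
theorem wordF_one_coreWord_right (hu : (a3 : ℤ) = a2 + 3 * u)
    (hv : (d3 : ℤ) = (d2 + 3 : ℕ) + 3 * v) (hw : (d3 : ℤ) = a3 + 2 * w) (h : max (-u) 0 < -v) :
    gLetters.wordF .one (coreWord a2 a3 d3 (d2 + 3)) = some (coreWord a2 a3 d3 d2 ++ [c1]) := by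
  obtain ⟨h1, h2⟩ | ⟨a, d, h1, h2, rfl, rfl, rfl, h3⟩ | ⟨a, e, h1, h2, h3, rfl, rfl, rfl⟩ |
    ⟨e, d, h1, h2, h3, rfl, rfl, h4⟩ | ⟨e, e', h1, h2, h3, h4, rfl, rfl⟩ :=
    coreWord_shapes (a2 := a2) (a3 := a3) (d3 := d3) (d2 := d2 + 3) (by omega) (by omega)
      (by omega)
  · rw [coreWord_even _ _ h1, coreWord_even _ _ h1, List.append_assoc]
    refine wordF_append_right ?_ (wordF_one_rgtWord (by omega) (by omega) (by omega))
    rw [wordEps_one_lftWord (by omega) (by omega), wordEps_one_rgtWord (by omega) (by omega)]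
    dsimp only; omega
  · obtain ⟨d, rfl⟩ : ∃ f, d = f + 3 := ⟨d - 3, by omega⟩
    obtain rfl : d2 = d + 1 := by omega
    rw [show d + 1 + 3 = d + 3 + 1 by rfl, coreWord_z2, coreWord_z2, List.append_assoc,
      List.cons_append]
    have hR := wordEps_one_rgtWord (d := d + 3) (e := 0) (by omega) (by omega)
    refine wordF_append_right ?_
      (wordF_cons_of_lt ?_ (wordF_one_rgtWord (by omega) (by omega) (by omega)))
    · rw [wordEps_cons, wordEps_one_lftWord (by omega) (by omega), hR]
      simp only [GLetter.phi, GLetter.eps]; omega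
    · rw [hR]; simp only [GLetter.eps]; omega
  · rw [coreWord_b5, coreWord_b5, List.append_assoc, List.cons_append]
    have hR := wordEps_one_rgtWord (d := d2 + 3) (e := e) (by omega) (by omega)
    refine wordF_append_right ?_
      (wordF_cons_of_lt ?_ (wordF_one_rgtWord (by omega) (by omega) (by omega)))
    · rw [wordEps_cons, wordEps_one_lftWord (by omega) (by omega), hR]
      simp only [GLetter.phi, GLetter.eps]; omega
    · rw [hR]; simp only [GLetter.eps]; omega
  · obtain ⟨d, rfl⟩ : ∃ f, d = f + 3 := ⟨d - 3, by omega⟩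
    obtain rfl : d2 = d + 1 := by omega
    rw [show d + 1 + 3 = d + 3 + 1 by rfl, coreWord_c5 _ _ h2, coreWord_c5 _ _ h2,
      List.append_assoc, List.cons_append]
    have hR := wordEps_one_rgtWord (d := d + 3) (e := 0) (by omega) (by omega)
    refine wordF_append_right ?_
      (wordF_cons_of_lt ?_ (wordF_one_rgtWord (by omega) (by omega) (by omega)))
    · rw [wordEps_cons, wordEps_one_lftWord (by omega) (by omega), hR]
      simp only [GLetter.phi, GLetter.eps]; omega
    · rw [hR]; simp only [GLetter.eps]; omega
  · rw [coreWord_z1 _ _ _ h2, coreWord_z1 _ _ _ h2, List.append_assoc, List.cons_append]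
    have hR := wordEps_one_rgtWord (d := d2 + 3) (e := e') (by omega) (by omega)
    refine wordF_append_right ?_
      (wordF_cons_of_lt ?_ (wordF_one_rgtWord (by omega) (by omega) (by omega)))
    · rw [wordEps_cons, wordEps_one_lftWord (by omega) (by omega), hR]
      simp only [GLetter.phi, GLetter.eps]; omega
    · rw [hR]; simp only [GLetter.eps]; omega

/-- The case in which `f₁` acts in the middle of the row, moving three units from `a₃` to `d₃`. -/
theorem wordF_one_coreWord_mid (hu : ((a3 + 3 : ℕ) : ℤ) = a2 + 3 * u)
    (hv : (d3 : ℤ) = d2 + 3 * v) (hw : (d3 : ℤ) = (a3 + 3 : ℕ) + 2 * w) (h : 0 < u)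
    (h' : 0 ≤ v) :
    gLetters.wordF .one (coreWord a2 (a3 + 3) d3 d2) = some (coreWord a2 a3 (d3 + 3) d2) := by
  obtain ⟨h1, h2⟩ | ⟨a, d, h1, h2, rfl, h3, rfl, rfl⟩ | ⟨a, e, h1, h2, h3, rfl, h4, rfl⟩ |
    ⟨e, d, h1, h2, h3, h4, rfl, rfl⟩ | ⟨e, e', h1, h2, h3, h4, h5, rfl⟩ :=
    coreWord_shapes (a2 := a2) (a3 := a3 + 3) (d3 := d3) (d2 := d2) (by omega) (by omega)
      (by omega)
  · rw [coreWord_even _ _ h1]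
    have hR := wordEps_one_rgtWord (d := d2) (e := d3) (by omega) (by omega)
    by_cases h3 : a3 = 1
    · subst h3
      obtain rfl : a2 = 1 := by omega
      rw [coreWord_b5]
      refine wordF_append_left (s' := lftWord 0 0 ++ [b5]) ?_ rfl |>.trans ?_
      · rw [hR]; dsimp only; omega
      · rw [List.append_assoc]; rfl
    · obtain ⟨e, rfl⟩ : ∃ f, a3 = f + 3 := ⟨a3 - 3, by omega⟩
      rw [coreWord_z1 _ _ _ (by omega)]
      refine (wordF_append_left ?_
        (wordF_one_lftWord (e := e) (by omega) (by omega) (by omega))).trans ?_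
      · rw [hR]; dsimp only; omega
      · rw [List.append_assoc]; rfl
  · omega
  · omega
  · obtain rfl : a3 = e := by omega
    obtain rfl : d = 0 := by omega
    rw [coreWord_c5 _ _ h2, coreWord_even _ _ h2]
    refine wordF_append_right ?_ (wordF_cons_of_le (b' := c4) ?_ rfl)
    · rw [wordEps_one_lftWord (by omega) (by omega)]
      simp only [rgtWord]
      rw [show (a2 - a3) / 3 = 0 by omega]
      decide
    · decide
  · obtain rfl : a3 = e := by omega
    have hR := wordEps_one_rgtWord (d := d2) (e := e') (by omega) (by omega)
    rw [coreWord_z1 _ _ _ h2, coreWord_even _ _ h2, show e' + 3 + 3 = e' + 6 by rfl,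
      rgtWord_add_six]
    refine wordF_append_right ?_ (wordF_cons_of_le (b' := c6) ?_ rfl)
    · rw [wordEps_one_lftWord (by omega) (by omega), wordEps_cons, hR]
      simp only [GLetter.phi, GLetter.eps]; omega
    · rw [hR]; simp only [GLetter.eps]; omega

end core

end

/-! ### The elements of `𝒢^l` as points -/

section

open CrystalData GLetter

/-- Coordinates for the elements of `𝒢^l`: the row has `l - x₀` letters, `x₁` of them `1` and `y₁`
of them `1̄`, and the remaining ones form `coreWord a₂ a₃ d₃ d₂`. The integers `u`, `v`, `w` are
determined by these numbers, and their existence expresses the congruences between `a₂, a₃, d₃, d₂`.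
-/
@[ext] structure GPt (l : ℕ) where
  x0 : ℕ
  x1 : ℕ
  a2 : ℕ
  a3 : ℕ
  d3 : ℕ
  d2 : ℕ
  y1 : ℕ
  u : ℤ
  v : ℤ
  w : ℤ
  hu : (a3 : ℤ) = a2 + 3 * u
  hv : (d3 : ℤ) = d2 + 3 * v
  hw : (d3 : ℤ) = a3 + 2 * w
  hl : (x0 + x1 + y1 + a2 : ℤ) + 2 * u - v + w = l

namespace GPt

variable {l : ℕ}

/-- The row with the given coordinates. -/
def word (x : GPt l) : List GLetter :=
  List.replicate x.x1 b1 ++ (coreWord x.a2 x.a3 x.d3 x.d2 ++ List.replicate x.y1 c1)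

/-- `e₁` sends the point `x` to `x'`. -/
def E1 (x x' : GPt l) : Prop :=
  x'.x0 = x.x0 ∧
  ((x.v ≤ 0 ∧ x.v ≤ x.u) ∧ x'.x1 = x.x1 ∧ x'.a2 = x.a2 ∧ x'.a3 = x.a3 ∧ x'.d3 = x.d3 ∧
      x'.d2 = x.d2 + 3 ∧ x'.y1 + 1 = x.y1 ∧ x'.u = x.u ∧ x'.v = x.v - 1 ∧ x'.w = x.w ∨
    (0 < x.v ∧ 0 ≤ x.u) ∧ x'.x1 = x.x1 ∧ x'.a2 = x.a2 ∧ x'.a3 = x.a3 + 3 ∧ x'.d3 + 3 = x.d3 ∧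
      x'.d2 = x.d2 ∧ x'.y1 = x.y1 ∧ x'.u = x.u + 1 ∧ x'.v = x.v - 1 ∧ x'.w = x.w - 3 ∨
    (x.u < 0 ∧ x.u < x.v) ∧ x'.x1 = x.x1 + 1 ∧ x'.a2 + 3 = x.a2 ∧ x'.a3 = x.a3 ∧ x'.d3 = x.d3 ∧
      x'.d2 = x.d2 ∧ x'.y1 = x.y1 ∧ x'.u = x.u + 1 ∧ x'.v = x.v ∧ x'.w = x.w)

/-- `e₂` sends the point `x` to `x'`. -/
def E2 (x x' : GPt l) : Prop :=
  (x'.x0 = x.x0 ∧ x'.x1 = x.x1 ∧ x'.y1 = x.y1 ∧ x'.w = x.w + 1) ∧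
  (0 ≤ x.w ∧ x'.a2 = x.a2 ∧ x'.a3 = x.a3 ∧ x'.d3 = x.d3 + 2 ∧ x'.d2 + 1 = x.d2 ∧
      x'.u = x.u ∧ x'.v = x.v + 1 ∨
    x.w < 0 ∧ x'.a2 = x.a2 + 1 ∧ x'.a3 + 2 = x.a3 ∧ x'.d3 = x.d3 ∧ x'.d2 = x.d2 ∧
      x'.u = x.u - 1 ∧ x'.v = x.v)

theorem wordEps_one (x : GPt l) : gLetters.wordEps .one x.word =
    (x.y1 + (x.v + max (-x.u) 0).toNat, x.x1 + (x.u + max (-x.v) 0).toNat) := by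
  have h1 := wordEps_replicate_of_eps gLetters .one (b := b1) rfl x.x1
  have h2 := wordEps_replicate_of_phi gLetters .one (b := c1) rfl x.y1
  rw [word, wordEps_append, wordEps_append, h1, h2, wordEps_one_coreWord x.hu x.hv x.hw]
  simp [gLetters, GLetter.eps, GLetter.phi]

theorem wordEps_two (x : GPt l) : gLetters.wordEps .two x.word =
    (x.d2 + (-x.w).toNat, x.a2 + x.w.toNat) := by
  have h1 := wordEps_replicate_of_eps gLetters .two (b := b1) rfl x.x1
  have h2 := wordEps_replicate_of_phi gLetters .two (b := c1) rfl x.y1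
  rw [word, wordEps_append, wordEps_append, h1, h2, wordEps_two_coreWord x.hu x.hv x.hw]
  simp [gLetters, GLetter.eps, GLetter.phi]

theorem wordF_core {i : GIdx} (x1 y1 : ℕ) {s s' : List GLetter}
    (h1 : GLetter.eps i b1 = 0) (h2 : GLetter.phi i c1 = 0)
    (h : (gLetters.wordEps i s).2 ≠ 0) (hs : gLetters.wordF i s = some s') :
    gLetters.wordF i (List.replicate x1 b1 ++ (s ++ List.replicate y1 c1)) =
      some (List.replicate x1 b1 ++ (s' ++ List.replicate y1 c1)) := by
  have e1 := wordEps_replicate_of_eps gLetters i (b := b1) h1 x1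
  have e2 := wordEps_replicate_of_phi gLetters i (b := c1) h2 y1
  refine wordF_append_right ?_ (wordF_append_left ?_ hs)
  · rw [wordEps_append, e1, e2]; dsimp only; omega
  · rw [e2]; exact Nat.zero_le _

theorem wordF_one {x x' : GPt l} (h : x.E1 x') :
    gLetters.wordF .one x'.word = some x.word := by
  obtain ⟨x0, x1, a2, a3, d3, d2, y1, u, v, w, hu, hv, hw, hl⟩ := x
  obtain ⟨x0', x1', a2', a3', d3', d2', y1', u', v', w', hu', hv', hw', hl'⟩ := x'
  simp only [E1] at h
  simp only [word]
  obtain ⟨rfl, ⟨h, rfl, rfl, rfl, rfl, rfl, rfl, rfl, rfl, rfl⟩ |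
    ⟨h, rfl, rfl, rfl, rfl, rfl, rfl, rfl, rfl, rfl⟩ |
    ⟨h, rfl, rfl, rfl, rfl, rfl, rfl, rfl, rfl, rfl⟩⟩ := h
  · rw [wordF_core _ _ rfl rfl _ (wordF_one_coreWord_right hu' hv' hw' (by omega))]
    · simp [List.replicate_succ]
    · rw [wordEps_one_coreWord hu' hv' hw']; dsimp only; omega
  · rw [wordF_core _ _ rfl rfl _ (wordF_one_coreWord_mid hu' hv' hw' (by omega) (by omega))]
    rw [wordEps_one_coreWord hu' hv' hw']; dsimp only; omega
  · rw [wordF_append_left _ (wordF_replicate_of_eps gLetters .one (b := b1) rfl (by decide) rfl _),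
      coreWord_cons _ _ (by omega)]
    · simp
    · have e1 := wordEps_replicate_of_eps gLetters .one (b := b1) rfl (x1 + 1)
      have e2 := wordEps_replicate_of_phi gLetters .one (b := c1) rfl y1'
      rw [wordEps_append, e1, e2, wordEps_one_coreWord hu' hv' hw']
      dsimp only; omega

theorem wordF_two {x x' : GPt l} (h : x.E2 x') :
    gLetters.wordF .two x'.word = some x.word := by
  obtain ⟨x0, x1, a2, a3, d3, d2, y1, u, v, w, hu, hv, hw, hl⟩ := x
  obtain ⟨x0', x1', a2', a3', d3', d2', y1', u', v', w', hu', hv', hw', hl'⟩ := x'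
  simp only [E2] at h
  simp only [word]
  obtain ⟨⟨rfl, rfl, rfl, rfl⟩, ⟨h, rfl, rfl, rfl, rfl, rfl, rfl⟩ |
    ⟨h, rfl, rfl, rfl, rfl, rfl, rfl⟩⟩ := h
  · rw [wordF_core _ _ rfl rfl _ (wordF_two_coreWord_of_pos hu' hv' hw' (by omega))]
    rw [wordEps_two_coreWord hu' hv' hw']; dsimp only; omega
  · rw [wordF_core _ _ rfl rfl _ (wordF_two_coreWord_of_nonpos hu' hv' hw' (by omega))]
    rw [wordEps_two_coreWord hu' hv' hw']; dsimp only; omega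

theorem exists_E1 (x : GPt l) (h : 0 < (x.y1 : ℤ) + max (x.v + max (-x.u) 0) 0) :
    ∃ x', x.E1 x' := by
  obtain ⟨x0, x1, a2, a3, d3, d2, y1, u, v, w, hu, hv, hw, hl⟩ := x
  simp only at h
  have h3 : (v ≤ 0 ∧ v ≤ u) ∨ (0 < v ∧ 0 ≤ u) ∨ (u < 0 ∧ u < v) := by omega
  rcases h3 with h3 | h3 | h3
  · exact ⟨⟨x0, x1, a2, a3, d3, d2 + 3, y1 - 1, u, v - 1, w, hu, by omega, hw, by omega⟩,
      rfl, Or.inl ⟨h3, rfl, rfl, rfl, rfl, rfl, by dsimp only; omega, rfl, rfl, rfl⟩⟩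
  · exact ⟨⟨x0, x1, a2, a3 + 3, d3 - 3, d2, y1, u + 1, v - 1, w - 3, by omega, by omega, by omega,
      by omega⟩, rfl, Or.inr (Or.inl ⟨h3, rfl, rfl, rfl, by dsimp only; omega, rfl, rfl, rfl, rfl,
        rfl⟩)⟩
  · exact ⟨⟨x0, x1 + 1, a2 - 3, a3, d3, d2, y1, u + 1, v, w, by omega, hv, hw, by omega⟩,
      rfl, Or.inr (Or.inr ⟨h3, rfl, by dsimp only; omega, rfl, rfl, rfl, rfl, rfl, rfl, rfl⟩)⟩

theorem exists_E1_inv (x : GPt l) (h : 0 < (x.x1 : ℤ) + max (x.u + max (-x.v) 0) 0) :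
    ∃ x' : GPt l, x'.E1 x := by
  obtain ⟨x0, x1, a2, a3, d3, d2, y1, u, v, w, hu, hv, hw, hl⟩ := x
  simp only at h
  have h3 : (v < 0 ∧ v < u) ∨ (0 ≤ v ∧ 0 < u) ∨ (u ≤ 0 ∧ u ≤ v) := by omega
  rcases h3 with h3 | h3 | h3
  · exact ⟨⟨x0, x1, a2, a3, d3, d2 - 3, y1 + 1, u, v + 1, w, hu, by omega, hw, by omega⟩,
      rfl, Or.inl ⟨by dsimp only; omega, rfl, rfl, rfl, rfl, by dsimp only; omega, rfl, rfl,
        by dsimp only; omega, rfl⟩⟩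
  · exact ⟨⟨x0, x1, a2, a3 - 3, d3 + 3, d2, y1, u - 1, v + 1, w + 3, by omega, by omega, by omega,
      by omega⟩, rfl, Or.inr (Or.inl ⟨by dsimp only; omega, rfl, rfl, by dsimp only; omega, rfl,
        rfl, rfl, by dsimp only; omega, by dsimp only; omega, by dsimp only; omega⟩)⟩
  · exact ⟨⟨x0, x1 - 1, a2 + 3, a3, d3, d2, y1, u - 1, v, w, by omega, hv, hw, by omega⟩,
      rfl, Or.inr (Or.inr ⟨by dsimp only; omega, by dsimp only; omega, rfl, rfl, rfl, rfl, rfl,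
        by dsimp only; omega, rfl, rfl⟩)⟩

theorem exists_E2 (x : GPt l) (h : 0 < x.d2 ∨ x.w < 0) : ∃ x', x.E2 x' := by
  obtain ⟨x0, x1, a2, a3, d3, d2, y1, u, v, w, hu, hv, hw, hl⟩ := x
  simp only at h
  rcases le_or_gt 0 w with h3 | h3
  · exact ⟨⟨x0, x1, a2, a3, d3 + 2, d2 - 1, y1, u, v + 1, w + 1, hu, by omega, by omega, by omega⟩,
      ⟨rfl, rfl, rfl, rfl⟩, Or.inl ⟨h3, rfl, rfl, rfl, by dsimp only; omega, rfl, rfl⟩⟩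
  · exact ⟨⟨x0, x1, a2 + 1, a3 - 2, d3, d2, y1, u - 1, v, w + 1, by omega, hv, by omega, by omega⟩,
      ⟨rfl, rfl, rfl, rfl⟩, Or.inr ⟨h3, rfl, by dsimp only; omega, rfl, rfl, rfl, rfl⟩⟩

theorem exists_E2_inv (x : GPt l) (h : 0 < x.a2 ∨ 0 < x.w) : ∃ x' : GPt l, x'.E2 x := by
  obtain ⟨x0, x1, a2, a3, d3, d2, y1, u, v, w, hu, hv, hw, hl⟩ := x
  simp only at h
  rcases lt_or_ge 0 w with h3 | h3
  · exact ⟨⟨x0, x1, a2, a3, d3 - 2, d2 + 1, y1, u, v - 1, w - 1, hu, by omega, by omega, by omega⟩,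
      ⟨rfl, rfl, rfl, by dsimp only; omega⟩, Or.inl ⟨by dsimp only; omega, rfl, rfl,
        by dsimp only; omega, rfl, rfl, by dsimp only; omega⟩⟩
  · exact ⟨⟨x0, x1, a2 - 1, a3 + 2, d3, d2, y1, u + 1, v, w - 1, by omega, hv, by omega, by omega⟩,
      ⟨rfl, rfl, rfl, by dsimp only; omega⟩, Or.inr ⟨by dsimp only; omega, by dsimp only; omega,
        rfl, rfl, rfl, by dsimp only; omega, rfl⟩⟩

theorem E1.injective {x y z : GPt l} (h : x.E1 z) (h' : y.E1 z) : x = y := by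
  obtain ⟨h0, h⟩ := h
  obtain ⟨h0', h'⟩ := h'
  ext <;> omega

theorem E2.injective {x y z : GPt l} (h : x.E2 z) (h' : y.E2 z) : x = y := by
  obtain ⟨h0, h⟩ := h
  obtain ⟨h0', h'⟩ := h'
  ext <;> omega

/-- A function that decreases along `e₁` and `e₂`. -/
def depth (x : GPt l) : ℕ := (10 * x.y1 + 2 * x.a2 + 5 * x.u + 2 * x.w + 3 * x.d2).toNat

theorem E1.depth_lt {x x' : GPt l} (h : x.E1 x') : x'.depth < x.depth := by
  have := x.hu
  have := x'.hu
  have := x.hw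
  have := x'.hw
  obtain ⟨-, h⟩ := h
  unfold depth
  omega

theorem E2.depth_lt {x x' : GPt l} (h : x.E2 x') : x'.depth < x.depth := by
  have := x.hu
  have := x'.hu
  have := x.hw
  have := x'.hw
  obtain ⟨h0, h⟩ := h
  unfold depth
  omega

/-- A point at which neither `e₁` nor `e₂` is defined is the highest weight element. -/
theorem eq_top_of_not (x : GPt l) (h1 : ¬∃ x', x.E1 x') (h2 : ¬∃ x', x.E2 x') :
    x.a2 = 0 ∧ x.a3 = 0 ∧ x.d3 = 0 ∧ x.d2 = 0 ∧ x.y1 = 0 ∧ x.u = 0 ∧ x.v = 0 ∧ x.w = 0 ∧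
      x.x0 + x.x1 = l := by
  have h1' := mt x.exists_E1 h1
  have h2' := mt x.exists_E2 h2
  have := x.hu
  have := x.hv
  have := x.hw
  have := x.hl
  omega

/-- Induction along the operators `e₁`, `e₂`. -/
theorem raise_induction {P : GPt l → Prop}
    (top : ∀ x : GPt l, (¬∃ x', x.E1 x') → (¬∃ x', x.E2 x') → P x)
    (e1 : ∀ x x' : GPt l, x.E1 x' → P x' → P x) (e2 : ∀ x x' : GPt l, x.E2 x' → P x' → P x)
    (x : GPt l) : P x := by
  induction hn : x.depth using Nat.strong_induction_on generalizing x with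
  | _ n ih =>
    subst hn
    by_cases h1 : ∃ x', x.E1 x'
    · obtain ⟨x', h⟩ := h1
      exact e1 x x' h (ih _ h.depth_lt x' rfl)
    by_cases h2 : ∃ x', x.E2 x'
    · obtain ⟨x', h⟩ := h2
      exact e2 x x' h (ih _ h.depth_lt x' rfl)
    exact top x h1 h2

theorem word_eq_of_top {x : GPt l} (h1 : ¬∃ x', x.E1 x') (h2 : ¬∃ x', x.E2 x') :
    x.word = List.replicate (l - x.x0) b1 := by
  obtain ⟨h1, h2, h3, h4, h5, h6, h7, h8, h9⟩ := x.eq_top_of_not h1 h2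
  rw [word, h1, h2, h3, h4, h5, show x.x1 = l - x.x0 by omega]
  simp [coreWord, lftWord, rgtWord]

theorem reachable (x : GPt l) :
    Relation.ReflTransGen gLetters.words.Step (List.replicate (l - x.x0) b1) x.word := by
  induction x using raise_induction with
  | top x h1 h2 => rw [word_eq_of_top h1 h2]
  | e1 x x' h ih =>
    rw [h.1] at ih
    exact ih.tail ⟨.one, Or.inl (wordF_one h)⟩
  | e2 x x' h ih =>
    rw [h.1.1] at ih
    exact ih.tail ⟨.two, Or.inl (wordF_two h)⟩

theorem word_injective {x y : GPt l} (h0 : x.x0 = y.x0) (h : x.word = y.word) : x = y := by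
  induction x using raise_induction generalizing y with
  | top x h1 h2 =>
    have e1 := y.wordEps_one
    have e2 := y.wordEps_two
    rw [← h, wordEps_one, Prod.mk.injEq] at e1
    rw [← h, wordEps_two, Prod.mk.injEq] at e2
    have t := x.eq_top_of_not h1 h2
    have := y.hu
    have := y.hv
    have := y.hw
    have := y.hl
    ext <;> omega
  | e1 x x' hx ih =>
    have h1 := (gLetters_isRegular.words.e_eq_iff .one _ _).2 (wordF_one hx)
    have h2 := gLetters_isRegular.words.eps_e _ _ _ h1
    have h3 : gLetters.words.ε .one x.word = (gLetters.wordEps .one y.word).1 := by rw [h]; rfl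
    rw [wordEps_one] at h3
    obtain ⟨y', hy⟩ := y.exists_E1 (by dsimp only at h3; omega)
    have h4 := (gLetters_isRegular.words.e_eq_iff .one _ _).2 (wordF_one hy)
    rw [h, h4] at h1
    obtain rfl := ih (by rw [hx.1, hy.1, h0]) (Option.some.inj h1).symm
    exact hx.injective hy
  | e2 x x' hx ih =>
    have h1 := (gLetters_isRegular.words.e_eq_iff .two _ _).2 (wordF_two hx)
    have h2 := gLetters_isRegular.words.eps_e _ _ _ h1
    have h3 : gLetters.words.ε .two x.word = (gLetters.wordEps .two y.word).1 := by rw [h]; rfl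
    rw [wordEps_two] at h3
    obtain ⟨y', hy⟩ := y.exists_E2 (by dsimp only at h3; omega)
    have h4 := (gLetters_isRegular.words.e_eq_iff .two _ _).2 (wordF_two hy)
    rw [h, h4] at h1
    obtain rfl := ih (by rw [hx.1.1, hy.1.1, h0]) (Option.some.inj h1).symm
    exact hx.injective hy

theorem exists_word_of_reachable {w₀ w : List GLetter}
    (h : Relation.ReflTransGen gLetters.words.Step w₀ w) (x₀ : GPt l) (h₀ : x₀.word = w₀) :
    ∃ x : GPt l, x.x0 = x₀.x0 ∧ x.word = w := by
  induction h with
  | refl => exact ⟨x₀, rfl, h₀⟩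
  | @tail w w' _ hs ih =>
    obtain ⟨x, hx, rfl⟩ := ih
    have hR := gLetters_isRegular.words
    have hE1 := x.wordEps_one
    have hE2 := x.wordEps_two
    obtain ⟨i, hf | he⟩ := hs
    · have hφ : 0 < (gLetters.wordEps i x.word).2 := by
        have := hR.phi_f hf
        exact lt_of_lt_of_eq (Nat.succ_pos _) this
      cases i with
      | one =>
        rw [hE1] at hφ
        obtain ⟨x', h⟩ := x.exists_E1_inv (by dsimp only at hφ; omega)
        exact ⟨x', h.1.symm.trans hx, Option.some.inj ((wordF_one h).symm.trans hf)⟩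
      | two =>
        rw [hE2] at hφ
        obtain ⟨x', h⟩ := x.exists_E2_inv (by dsimp only at hφ; omega)
        exact ⟨x', h.1.1.symm.trans hx, Option.some.inj ((wordF_two h).symm.trans hf)⟩
    · have hε : 0 < (gLetters.wordEps i x.word).1 := by
        have := hR.eps_e _ _ _ he
        exact lt_of_lt_of_eq (Nat.succ_pos _) this
      cases i with
      | one =>
        rw [hE1] at hε
        obtain ⟨x', h⟩ := x.exists_E1 (by dsimp only at hε; omega)
        exact ⟨x', h.1.trans hx,
          Option.some.inj (((hR.e_eq_iff .one _ _).2 (wordF_one h)).symm.trans he)⟩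
      | two =>
        rw [hE2] at hε
        obtain ⟨x', h⟩ := x.exists_E2 (by dsimp only at hε; omega)
        exact ⟨x', h.1.1.trans hx,
          Option.some.inj (((hR.e_eq_iff .two _ _).2 (wordF_two h)).symm.trans he)⟩

/-- The element of `𝒢^l` with the given coordinates. -/
def toGSet (x : GPt l) : GSet l := ⟨⟨l - x.x0, by omega⟩, x.word, x.reachable⟩

theorem x0_le (x : GPt l) : x.x0 ≤ l := by
  have := x.hu
  have := x.hv
  have := x.hw
  have := x.hl
  omega

theorem toGSet_injective : Function.Injective (toGSet (l := l)) := by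
  intro x y h
  have h0 : l - x.x0 = l - y.x0 := congrArg (fun b : GSet l => (b.1 : ℕ)) h
  have := x.x0_le
  have := y.x0_le
  exact word_injective (by omega) (congrArg (fun b : GSet l => b.2.1) h)

theorem toGSet_eq_mk {n : Fin (l + 1)} {w : List GLetter} (x : GPt l) (hn : (n : ℕ) = l - x.x0)
    (hw : x.word = w)
    (h : Relation.ReflTransGen gLetters.words.Step (List.replicate (n : ℕ) b1) w) :
    (⟨n, w, h⟩ : GSet l) = x.toGSet := by
  obtain ⟨n, hn'⟩ := n
  subst hw hn
  rfl

theorem toGSet_surjective : Function.Surjective (toGSet (l := l)) := by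
  rintro ⟨n, w, h⟩
  have hn := n.2
  let x₀ : GPt l := ⟨l - n, n, 0, 0, 0, 0, 0, 0, 0, 0, rfl, rfl, rfl, by omega⟩
  obtain ⟨x, hx, hw⟩ := exists_word_of_reachable h x₀ (by
    simp [word, x₀, coreWord, lftWord, rgtWord])
  exact ⟨x, (toGSet_eq_mk x (by rw [hx]; simp only [x₀]; omega) hw h).symm⟩

theorem f_toGSet {i : GIdx} {x x' : GPt l} (h0 : x'.x0 = x.x0)
    (h : gLetters.wordF i x.word = some x'.word) :
    (gCrystal l).f i x.toGSet = some x'.toGSet := by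
  have h1 : Relation.ReflTransGen gLetters.words.Step (List.replicate (l - x.x0) b1) x'.word := by
    rw [← h0]; exact x'.reachable
  rw [← toGSet_eq_mk (n := x.toGSet.1) x' (by rw [h0]; rfl) rfl h1]
  exact Option.map_eq_some_iff.2 ⟨⟨x'.word, h1⟩, IsRegular.component_f.2 h, rfl⟩

theorem eps_one_toGSet (x : GPt l) :
    (gCrystal l).ε .one x.toGSet = x.y1 + (x.v + max (-x.u) 0).toNat :=
  congrArg Prod.fst x.wordEps_one

theorem phi_one_toGSet (x : GPt l) :
    (gCrystal l).φ .one x.toGSet = x.x1 + (x.u + max (-x.v) 0).toNat :=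
  congrArg Prod.snd x.wordEps_one

theorem eps_two_toGSet (x : GPt l) : (gCrystal l).ε .two x.toGSet = x.d2 + (-x.w).toNat :=
  congrArg Prod.fst x.wordEps_two

theorem phi_two_toGSet (x : GPt l) : (gCrystal l).φ .two x.toGSet = x.a2 + x.w.toNat :=
  congrArg Prod.snd x.wordEps_two

theorem wt_one_toGSet (x : GPt l) :
    (gCrystal l).wt x.toGSet .one = x.x1 - x.y1 + x.u - x.v := by
  have h := (gCrystal_isRegular l).phi_eq .one x.toGSet
  rw [eps_one_toGSet, phi_one_toGSet] at h
  omega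

theorem wt_two_toGSet (x : GPt l) :
    (gCrystal l).wt x.toGSet .two = x.a2 - x.d2 + x.w := by
  have h := (gCrystal_isRegular l).phi_eq .two x.toGSet
  rw [eps_two_toGSet, phi_two_toGSet] at h
  omega

theorem e_one_toGSet {x x' : GPt l} (h : x.E1 x') :
    (gCrystal l).e .one x.toGSet = some x'.toGSet :=
  ((gCrystal_isRegular l).e_eq_iff _ _ _).2 (f_toGSet h.1.symm (wordF_one h))

theorem e_two_toGSet {x x' : GPt l} (h : x.E2 x') :
    (gCrystal l).e .two x.toGSet = some x'.toGSet :=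
  ((gCrystal_isRegular l).e_eq_iff _ _ _).2 (f_toGSet h.1.1.symm (wordF_two h))

theorem e_one_eq_some_iff {x x' : GPt l} :
    (gCrystal l).e .one x.toGSet = some x'.toGSet ↔ x.E1 x' := by
  refine ⟨fun h => ?_, e_one_toGSet⟩
  have h1 := (gCrystal_isRegular l).eps_e _ _ _ h
  rw [eps_one_toGSet, eps_one_toGSet] at h1
  obtain ⟨y, hy⟩ := x.exists_E1 (by omega)
  rw [e_one_toGSet hy] at h
  rwa [← toGSet_injective (Option.some.inj h)]

theorem e_two_eq_some_iff {x x' : GPt l} :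
    (gCrystal l).e .two x.toGSet = some x'.toGSet ↔ x.E2 x' := by
  refine ⟨fun h => ?_, e_two_toGSet⟩
  have h1 := (gCrystal_isRegular l).eps_e _ _ _ h
  rw [eps_two_toGSet, eps_two_toGSet] at h1
  obtain ⟨y, hy⟩ := x.exists_E2 (by omega)
  rw [e_two_toGSet hy] at h
  rwa [← toGSet_injective (Option.some.inj h)]

end GPt

end

/-! ### The piecewise linear map between points and labels -/

/-- The first of four piecewise linear functions from which the map `psi` is built. -/
def tropM (z u v w : ℤ) : ℤ :=
  max 0 (max z (max (z - v) (max (z - v + w) (max (z - v + u + w) (2 * z - v + u + w)))))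
/-- The second of the piecewise linear functions from which `psi` is built. -/
def tropP (z u v w : ℤ) : ℤ :=
  max 0 (max v (max (v - u) (max (z + v) (max (z - v) (max (z - v + w) (z - v + u + w))))))
/-- The third of the piecewise linear functions from which `psi` is built. -/
def tropQ (z u v w : ℤ) : ℤ :=
  max 0 (max v (max (v - u) (max (v - z) (max (v - z - 2 * u) (max (v - z - 2 * u - w)
    (2 * v - z - 2 * u - w))))))
/-- The fourth of the piecewise linear functions from which `psi` is built. -/
def tropN (z u v w : ℤ) : ℤ :=
  max (2 * v - z) (max (2 * v - z - 3 * u) (max (2 * v - z - 3 * u - w)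
    (max (2 * z - v) (max (2 * z - v + w) (2 * z + 2 * v)))))

variable {z u v w : ℤ}

theorem tropM_spec (z u v w : ℤ) : (0 ≤ tropM z u v w ∧ z ≤ tropM z u v w ∧ z - v ≤ tropM z u v w ∧
    z - v + w ≤ tropM z u v w ∧ z - v + u + w ≤ tropM z u v w ∧
    2 * z - v + u + w ≤ tropM z u v w) ∧
    (tropM z u v w = 0 ∨ tropM z u v w = z ∨ tropM z u v w = z - v ∨ tropM z u v w = z - v + w ∨
    tropM z u v w = z - v + u + w ∨ tropM z u v w = 2 * z - v + u + w) := by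
  unfold tropM
  omega

theorem tropP_spec (z u v w : ℤ) : (0 ≤ tropP z u v w ∧ v ≤ tropP z u v w ∧ v - u ≤ tropP z u v w ∧
    z + v ≤ tropP z u v w ∧ z - v ≤ tropP z u v w ∧ z - v + w ≤ tropP z u v w ∧
    z - v + u + w ≤ tropP z u v w) ∧
    (tropP z u v w = 0 ∨ tropP z u v w = v ∨ tropP z u v w = v - u ∨ tropP z u v w = z + v ∨
    tropP z u v w = z - v ∨ tropP z u v w = z - v + w ∨ tropP z u v w = z - v + u + w) := by
  unfold tropP
  omega

theorem tropQ_spec (z u v w : ℤ) : (0 ≤ tropQ z u v w ∧ v ≤ tropQ z u v w ∧ v - u ≤ tropQ z u v w ∧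
    v - z ≤ tropQ z u v w ∧ v - z - 2 * u ≤ tropQ z u v w ∧ v - z - 2 * u - w ≤ tropQ z u v w ∧
    2 * v - z - 2 * u - w ≤ tropQ z u v w) ∧
    (tropQ z u v w = 0 ∨ tropQ z u v w = v ∨ tropQ z u v w = v - u ∨ tropQ z u v w = v - z ∨
    tropQ z u v w = v - z - 2 * u ∨ tropQ z u v w = v - z - 2 * u - w ∨
    tropQ z u v w = 2 * v - z - 2 * u - w) := by
  unfold tropQ
  omega

theorem tropN_spec (z u v w : ℤ) : (2 * v - z ≤ tropN z u v w ∧ 2 * v - z - 3 * u ≤ tropN z u v w ∧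
    2 * v - z - 3 * u - w ≤ tropN z u v w ∧ 2 * z - v ≤ tropN z u v w ∧
    2 * z - v + w ≤ tropN z u v w ∧ 2 * z + 2 * v ≤ tropN z u v w) ∧
    (tropN z u v w = 2 * v - z ∨ tropN z u v w = 2 * v - z - 3 * u ∨
    tropN z u v w = 2 * v - z - 3 * u - w ∨ tropN z u v w = 2 * z - v ∨
    tropN z u v w = 2 * z - v + w ∨ tropN z u v w = 2 * z + 2 * v) := by
  unfold tropN
  omega

/-! The four functions change by constants under `e₁`, in each of the three cases of `GPt.E1`: where
`f₁` turns the last `2̄` into `1̄`, where it acts in the middle of the row, and where it turns the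
first `1` into `2`. The function `tropM` is constant or drops by one according to the case of the
tensor product rule that describes `f₁` on labels. -/

theorem tropP_last (h1 : v ≤ 0) (h2 : v ≤ u) : tropP (z - 1) u (v - 1) w = tropP z u v w := by
  unfold tropP; omega

theorem tropQ_last (h1 : v ≤ 0) (h2 : v ≤ u) : tropQ (z - 1) u (v - 1) w = tropQ z u v w := by
  unfold tropQ; omega

theorem tropN_last (h1 : v ≤ 0) (h2 : v ≤ u) : tropN (z - 1) u (v - 1) w = tropN z u v w - 1 := by
  unfold tropN; omega

theorem tropP_mid (h1 : 0 < v) (h2 : 0 ≤ u) :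
    tropP z (u + 1) (v - 1) (w - 3) = tropP z u v w - 1 := by
  unfold tropP; omega

theorem tropQ_mid (h1 : 0 < v) (h2 : 0 ≤ u) :
    tropQ z (u + 1) (v - 1) (w - 3) = tropQ z u v w - 1 := by
  unfold tropQ; omega

theorem tropN_mid (h1 : 0 < v) (h2 : 0 ≤ u) :
    tropN z (u + 1) (v - 1) (w - 3) = tropN z u v w - 2 := by
  unfold tropN; omega

theorem tropP_first (h1 : u < 0) (h2 : u < v) : tropP (z - 1) (u + 1) v w = tropP z u v w - 1 := by
  unfold tropP; omega

theorem tropQ_first (h1 : u < 0) (h2 : u < v) : tropQ (z - 1) (u + 1) v w = tropQ z u v w - 1 := by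
  unfold tropQ; omega

theorem tropN_first (h1 : u < 0) (h2 : u < v) : tropN (z - 1) (u + 1) v w = tropN z u v w - 2 := by
  unfold tropN; omega

theorem tropM_last_of_le (h1 : v ≤ 0)
    (h : tropQ z u v w + (2 * z - v + u + w) ≤ tropP z u v w) :
    tropM (z - 1) u (v - 1) w = tropM z u v w := by
  have hQ := (tropQ_spec z u v w).1
  have hP := (tropP_spec z u v w).2
  obtain ⟨hM, cM⟩ := tropM_spec z u v w
  obtain ⟨hM', cM'⟩ := tropM_spec (z - 1) u (v - 1) w
  apply le_antisymm
  · clear hP cM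
    rcases cM' with h | h | h | h | h | h <;> omega
  · rcases cM with h | h | h | h | h | h <;> omega

theorem tropM_last_of_lt (h1 : v ≤ 0) (h2 : v ≤ u)
    (h : tropP z u v w < tropQ z u v w + (2 * z - v + u + w)) :
    tropM (z - 1) u (v - 1) w = tropM z u v w - 1 := by
  have hP := (tropP_spec z u v w).1
  have hQ := (tropQ_spec z u v w).2
  obtain ⟨hM, cM⟩ := tropM_spec z u v w
  obtain ⟨hM', cM'⟩ := tropM_spec (z - 1) u (v - 1) w
  apply le_antisymm
  · rcases cM' with h | h | h | h | h | h <;> omega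
  · clear hQ cM'
    rcases cM with h | h | h | h | h | h <;> omega

theorem tropM_mid_of_le (h1 : 0 < v) (h2 : 0 ≤ u)
    (h : tropQ z u v w + (2 * z - v + u + w) ≤ tropP z u v w) :
    tropM z (u + 1) (v - 1) (w - 3) = tropM z u v w := by
  have hQ := (tropQ_spec z u v w).1
  have hP := (tropP_spec z u v w).2
  obtain ⟨hM, cM⟩ := tropM_spec z u v w
  obtain ⟨hM', cM'⟩ := tropM_spec z (u + 1) (v - 1) (w - 3)
  apply le_antisymm
  · clear hP cM
    rcases cM' with h | h | h | h | h | h <;> omega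
  · rcases cM with h | h | h | h | h | h <;> omega

theorem tropM_mid_of_lt (h1 : 0 < v) (h2 : 0 ≤ u)
    (h : tropP z u v w < tropQ z u v w + (2 * z - v + u + w)) :
    tropM z (u + 1) (v - 1) (w - 3) = tropM z u v w - 1 := by
  have hP := (tropP_spec z u v w).1
  have hQ := (tropQ_spec z u v w).2
  obtain ⟨hM, cM⟩ := tropM_spec z u v w
  obtain ⟨hM', cM'⟩ := tropM_spec z (u + 1) (v - 1) (w - 3)
  apply le_antisymm
  · rcases cM' with h | h | h | h | h | h <;> omega
  · clear hQ cM'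
    rcases cM with h | h | h | h | h | h <;> omega

theorem tropM_first_of_le (h1 : u < 0) (h2 : u < v)
    (h : tropQ z u v w + (2 * z - v + u + w) ≤ tropP z u v w) :
    tropM (z - 1) (u + 1) v w = tropM z u v w := by
  have hQ := (tropQ_spec z u v w).1
  have hP := (tropP_spec z u v w).2
  obtain ⟨hM, cM⟩ := tropM_spec z u v w
  obtain ⟨hM', cM'⟩ := tropM_spec (z - 1) (u + 1) v w
  apply le_antisymm
  · clear hP cM
    rcases cM' with h | h | h | h | h | h <;> omega
  · rcases cM with h | h | h | h | h | h <;> omega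

theorem tropM_first_of_lt (h1 : u < 0)
    (h : tropP z u v w < tropQ z u v w + (2 * z - v + u + w)) :
    tropM (z - 1) (u + 1) v w = tropM z u v w - 1 := by
  have hP := (tropP_spec z u v w).1
  have hQ := (tropQ_spec z u v w).2
  obtain ⟨hM, cM⟩ := tropM_spec z u v w
  obtain ⟨hM', cM'⟩ := tropM_spec (z - 1) (u + 1) v w
  apply le_antisymm
  · rcases cM' with h | h | h | h | h | h <;> omega
  · clear hQ cM'
    rcases cM with h | h | h | h | h | h <;> omega

/-- Labels `(i, k, j, p, q, r)` with integral entries. -/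
@[ext] structure ZLabel where
  i : ℤ
  k : ℤ
  j : ℤ
  p : ℤ
  q : ℤ
  r : ℤ

/-- The inequalities between the entries of a label that do not involve `l`. -/
structure ZLabel.InCone (a : ZLabel) : Prop where
  i_nonneg : 0 ≤ a.i
  i_le_k : a.i ≤ a.k
  i_le_j : a.i ≤ a.j
  p_nonneg : 0 ≤ a.p
  p_le_j : a.p ≤ a.j
  p_le_q : a.p ≤ a.q
  q_le : a.q ≤ a.p + a.k
  r_nonneg : 0 ≤ a.r
  r_le : a.r + 2 * a.p ≤ a.j + a.q

/-- The inverse of `Φ` in coordinates: it sends the point of `𝒢^l` with the coordinates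
`x₀, x₁, y₁, u, v, w` to the label with these entries, where `z = y₁ - x₁`. -/
def psi (x0 y1 z u v w : ℤ) : ZLabel where
  i := y1 + tropP z u v w + tropQ z u v w - tropN z u v w
  k := x0 + y1 + 2 * tropQ z u v w - tropP z u v w + (z - 2 * v + 2 * u + w)
  j := x0 + y1 + 2 * tropP z u v w - tropQ z u v w - (2 * z - v + u + w)
  p := y1 + tropP z u v w - tropM z u v w
  q := x0 + y1 + tropQ z u v w
  r := x0 + tropM z u v w - (2 * z - v + u + w)

theorem psi_i_nonneg {x0 y1 : ℤ} (h : z ≤ y1) (h1 : 0 ≤ y1) : 0 ≤ (psi x0 y1 z u v w).i := by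
  have := (tropP_spec z u v w).1
  have := (tropQ_spec z u v w).1
  have hN := (tropN_spec z u v w).2
  simp only [psi]
  rcases hN with h | h | h | h | h | h <;> omega

theorem psi_i_le_k {x0 y1 : ℤ} (h0 : 0 ≤ x0) :
    (psi x0 y1 z u v w).i ≤ (psi x0 y1 z u v w).k := by
  have := (tropN_spec z u v w).1
  have := (tropQ_spec z u v w).1
  have hN := (tropP_spec z u v w).2
  simp only [psi]
  rcases hN with h | h | h | h | h | h | h <;> omega

theorem psi_i_le_j {x0 y1 : ℤ} (h0 : 0 ≤ x0) :
    (psi x0 y1 z u v w).i ≤ (psi x0 y1 z u v w).j := by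
  have := (tropN_spec z u v w).1
  have := (tropP_spec z u v w).1
  have hN := (tropQ_spec z u v w).2
  simp only [psi]
  rcases hN with h | h | h | h | h | h | h <;> omega

theorem psi_p_nonneg {x0 y1 : ℤ} (h : z ≤ y1) (h1 : 0 ≤ y1) :
    0 ≤ (psi x0 y1 z u v w).p := by
  have := (tropP_spec z u v w).1
  have hN := (tropM_spec z u v w).2
  simp only [psi]
  rcases hN with h | h | h | h | h | h <;> omega

theorem psi_p_le_j {x0 y1 : ℤ} (h0 : 0 ≤ x0) :
    (psi x0 y1 z u v w).p ≤ (psi x0 y1 z u v w).j := by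
  have := (tropM_spec z u v w).1
  have := (tropP_spec z u v w).1
  have hN := (tropQ_spec z u v w).2
  simp only [psi]
  rcases hN with h | h | h | h | h | h | h <;> omega

theorem psi_p_le_q {x0 y1 : ℤ} (h0 : 0 ≤ x0) :
    (psi x0 y1 z u v w).p ≤ (psi x0 y1 z u v w).q := by
  have := (tropM_spec z u v w).1
  have := (tropQ_spec z u v w).1
  have hN := (tropP_spec z u v w).2
  simp only [psi]
  rcases hN with h | h | h | h | h | h | h <;> omega

theorem psi_q_le {x0 y1 : ℤ} (h : z ≤ y1) (h1 : 0 ≤ y1) :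
    (psi x0 y1 z u v w).q ≤ (psi x0 y1 z u v w).p + (psi x0 y1 z u v w).k := by
  have := (tropQ_spec z u v w).1
  have hN := (tropM_spec z u v w).2
  simp only [psi]
  rcases hN with h | h | h | h | h | h <;> omega

theorem psi_r_nonneg {x0 y1 : ℤ} (h0 : 0 ≤ x0) : 0 ≤ (psi x0 y1 z u v w).r := by
  have := (tropM_spec z u v w).1
  simp only [psi]
  omega

theorem psi_r_le {x0 y1 : ℤ} (h0 : 0 ≤ x0) :
    (psi x0 y1 z u v w).r + 2 * (psi x0 y1 z u v w).p ≤
      (psi x0 y1 z u v w).j + (psi x0 y1 z u v w).q := by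
  have := (tropM_spec z u v w).1
  simp only [psi]
  omega

/-- For a point with `a₂ = A`, the left sides of the conditions are `a₂`, `a₃`, `d₂`, `d₃`, and the
right side of the bound is `l`. -/
theorem psi_k_le {x0 y1 A : ℤ} (hA : 0 ≤ A) (hu : 0 ≤ A + 3 * u)
    (hD : 0 ≤ A + 3 * u - 3 * v + 2 * w) (hv : 0 ≤ A + 3 * u + 2 * w) :
    (psi x0 y1 z u v w).i + (psi x0 y1 z u v w).k ≤
      x0 + 2 * y1 - z + A + 2 * u - v + w := by
  have := (tropN_spec z u v w).1
  have hN := (tropQ_spec z u v w).2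
  simp only [psi]
  rcases hN with h | h | h | h | h | h | h <;> omega

theorem psi_j_le {x0 y1 A : ℤ} (hA : 0 ≤ A) (hu : 0 ≤ A + 3 * u)
    (hD : 0 ≤ A + 3 * u - 3 * v + 2 * w) (hv : 0 ≤ A + 3 * u + 2 * w) :
    (psi x0 y1 z u v w).i + (psi x0 y1 z u v w).j ≤
      x0 + 2 * y1 - z + A + 2 * u - v + w := by
  have := (tropN_spec z u v w).1
  have hN := (tropP_spec z u v w).2
  simp only [psi]
  rcases hN with h | h | h | h | h | h | h <;> omega

/-- A point outside of the range because of a negative `a₂ = A` has a label outside of the range. -/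
theorem psi_k_gt {x0 y1 A : ℤ} (hA : A < 0) (hw : w < 0)
    (hv : 0 ≤ A + 3 * u + 2 * w) :
    x0 + 2 * y1 - z + A + 2 * u - v + w <
      (psi x0 y1 z u v w).i + (psi x0 y1 z u v w).k := by
  have := (tropQ_spec z u v w).1
  have hN := (tropN_spec z u v w).2
  simp only [psi]
  rcases hN with h | h | h | h | h | h <;> omega

/-- A point outside of the range because of a negative `d₂` has a label outside of the range. -/
theorem psi_j_gt {x0 y1 A : ℤ} (hw : 0 < w)
    (hD : A + 3 * u - 3 * v + 2 * w < 0) (hv : 0 ≤ A + 3 * u + 2 * w) :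
    x0 + 2 * y1 - z + A + 2 * u - v + w <
      (psi x0 y1 z u v w).i + (psi x0 y1 z u v w).j := by
  have := (tropP_spec z u v w).1
  have hN := (tropN_spec z u v w).2
  simp only [psi]
  rcases hN with h | h | h | h | h | h <;> omega

/-! ### The operator `E` in closed form -/

/-- The labels for which the recursion in the definition of `E` stops because `p = min q j`. With
`s = min (k - i) (j - i) (min q j - p)` this is the case `s < min (k - i) (j - i)`. -/
def EFree (i k j p q : ℤ) : Prop :=
  (q < p + k - i ∨ j < p + k - i) ∧ (q < p + j - i ∨ j < p + j - i)

/-- The labels for which the recursion in the definition of `E` stops because `k = i` or `j = i`: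
the negation of `EFree`. -/
def EStuck (i k j p q : ℤ) : Prop :=
  (p + k - i ≤ q ∧ p + k - i ≤ j) ∨ (p + j - i ≤ q ∧ p + j - i ≤ j)

/-- The labels that `E` sends to `(i, k - 1, j, p, q)`. -/
def ELowersK (i k j p q : ℤ) : Prop :=
  (EFree i k j p q → 3 * q < 2 * j + k) ∧
  (EStuck i k j p q → j < k ∧ 3 * q < 3 * p + 2 * j + k - 3 * i)

/-- The labels that `E` sends to `(i, k, j + 1, p + 1, q + 1)`. -/
def ERaisesJ (i k j p q : ℤ) : Prop :=
  (EFree i k j p q → 2 * j + k ≤ 3 * q) ∧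
  (EStuck i k j p q → (k + 2 ≤ j → 2 * (j - k) + 3 * i ≤ 3 * p) ∧ (k + 1 = j → i < p) ∧
    (k = j → i ≤ p) ∧ (j < k → 3 * p + 2 * j + k - 3 * i ≤ 3 * q ∧ i ≤ p))

/-- The labels that `E` sends to `(i + 1, k + 1, j - 1, p, q + 1)`. -/
def ERaisesI (i k j p q : ℤ) : Prop :=
  EStuck i k j p q ∧ k + 2 ≤ j ∧ 3 * p < 2 * (j - k) + 3 * i

/-- The labels that `E` sends to `(i, k + 1, j - 1, p, q + 1)`. -/
def EFixesI (i k j p q : ℤ) : Prop :=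
  EStuck i k j p q ∧ k + 1 = j ∧ p ≤ i

/-- The labels that `E` sends to `(i - 1, k + 1, j - 1, p, q + 1)`. -/
def ELowersI (i k j p q : ℤ) : Prop :=
  EStuck i k j p q ∧ p < i ∧ j ≤ k ∧ (j < k → 3 * p + 2 * j + k - 3 * i ≤ 3 * q)

/-- The graph of `E` in closed form, for all `l` at once, up to the convention that `E` vanishes
where the second label has `i + j > l`. The recursion subtracts the same number from `k`, `j` and
`q`; the conditions are expressed here by the original label. -/
def ETarget (a b : ZLabel) : Prop :=
  b.r = a.r ∧
  (ELowersK a.i a.k a.j a.p a.q ∧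
      b.i = a.i ∧ b.k = a.k - 1 ∧ b.j = a.j ∧ b.p = a.p ∧ b.q = a.q ∨
    ERaisesJ a.i a.k a.j a.p a.q ∧
      b.i = a.i ∧ b.k = a.k ∧ b.j = a.j + 1 ∧ b.p = a.p + 1 ∧ b.q = a.q + 1 ∨
    ERaisesI a.i a.k a.j a.p a.q ∧
      b.i = a.i + 1 ∧ b.k = a.k + 1 ∧ b.j = a.j - 1 ∧ b.p = a.p ∧ b.q = a.q + 1 ∨
    EFixesI a.i a.k a.j a.p a.q ∧
      b.i = a.i ∧ b.k = a.k + 1 ∧ b.j = a.j - 1 ∧ b.p = a.p ∧ b.q = a.q + 1 ∨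
    ELowersI a.i a.k a.j a.p a.q ∧
      b.i = a.i - 1 ∧ b.k = a.k + 1 ∧ b.j = a.j - 1 ∧ b.p = a.p ∧ b.q = a.q + 1)

set_option maxHeartbeats 2000000 in
theorem ETarget.functional {a b b' : ZLabel} (ha : a.InCone) (h : ETarget a b)
    (h' : ETarget a b') : b = b' := by
  obtain ⟨h1, h2, h3, h4, h5, h6, h7, h8, h9⟩ := ha
  obtain ⟨hr, h⟩ := h
  obtain ⟨hr', h'⟩ := h'
  unfold ELowersK ERaisesJ ERaisesI EFixesI ELowersI EFree EStuck at h h'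
  rcases h with h | h | h | h | h <;> rcases h' with h' | h' | h' | h' | h' <;>
    obtain ⟨hc, hi, hk, hj, hp, hq⟩ := h <;> obtain ⟨hc', hi', hk', hj', hp', hq'⟩ := h' <;>
    (ext <;> omega)

set_option maxHeartbeats 2000000 in
theorem ETarget.injective {a a' b : ZLabel} (ha : a.InCone) (ha' : a'.InCone)
    (h : ETarget a b) (h' : ETarget a' b) : a = a' := by
  obtain ⟨h1, h2, h3, h4, h5, h6, h7, h8, h9⟩ := ha
  obtain ⟨g1, g2, g3, g4, g5, g6, g7, g8, g9⟩ := ha'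
  obtain ⟨hr, h⟩ := h
  obtain ⟨hr', h'⟩ := h'
  obtain ⟨i, k, j, p, q, r⟩ := a
  obtain ⟨i', k', j', p', q', r'⟩ := a'
  simp only at *
  unfold ELowersK ERaisesJ ERaisesI EFixesI ELowersI EFree EStuck at h h'
  rcases h with h | h | h | h | h <;> rcases h' with h' | h' | h' | h' | h' <;>
    obtain ⟨hc, hi, hk, hj, hp, hq⟩ := h <;> obtain ⟨hc', hi', hk', hj', hp', hq'⟩ := h' <;>
    -- two different cases exclude each other, while in one and the same case the entries agree
    first
    | (exfalso; clear h4 h8 h9 g4 g8 g9 hr hr'; omega)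
    | (ext <;> simp only <;> omega)

/-! ### The image of `e₂` under the piecewise linear map -/

section

set_option maxHeartbeats 4000000

variable {z u v w : ℤ}

/-! The letters `M`, `P`, `Q`, `N` stand for the values of `tropM`, `tropP`, `tropQ`, `tropN`; the
forms that are redundant for the given sign of `w` are left out of the maxima. The hypotheses `eP`,
`eQ`, `eN` say which forms attain the maxima; each of the resulting cases is linear. -/

theorem eLowersK_of_nonneg (hw : 0 ≤ w) (x0 y1 : ℤ) {M P Q N : ℤ}
    (hM : 0 ≤ M ∧ z ≤ M ∧ z - v + w ≤ M ∧ z - v + u + w ≤ M ∧ 2 * z - v + u + w ≤ M)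
    (cM : M = 0 ∨ M = z ∨ M = z - v + w ∨ M = z - v + u + w ∨ M = 2 * z - v + u + w)
    (eQ : Q = 0 ∧ v < 0 ∧ v - u < 0 ∧ v - z < 0 ∧ v - z - 2 * u < 0 ∧ 2 * v - z - 2 * u - w < 0)
    (eP : P = z - v + w ∨ P = z - v + u + w)
    (hP : 0 ≤ P ∧ v ≤ P ∧ v - u ≤ P ∧ z + v ≤ P ∧ z - v + w ≤ P ∧ z - v + u + w ≤ P)
    (eN : N = 2 * z - v + w) :
    ELowersK (y1 + P + Q - N) (x0 + y1 + 2 * Q - P + z - 2 * v + 2 * u + w)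
      (x0 + y1 + 2 * P - Q - (2 * z - v + u + w)) (y1 + P - M) (x0 + y1 + Q) := by
  subst eN
  obtain ⟨rfl, hQ⟩ := eQ
  unfold ELowersK EFree EStuck
  rcases eP with rfl | rfl <;>
  (rcases cM with rfl | rfl | rfl | rfl | rfl <;> try (exfalso; omega)) <;>
  refine ⟨?_, ?_⟩
  all_goals first
    | rintro ⟨h1 | h1, h2 | h2⟩ <;> omega
    | rintro (h | h) <;> omega

theorem eRaisesJ_of_nonneg (hw : 0 ≤ w) (x0 y1 : ℤ) {M P Q N : ℤ}
    (hM : 0 ≤ M ∧ z ≤ M ∧ z - v + w ≤ M ∧ z - v + u + w ≤ M ∧ 2 * z - v + u + w ≤ M)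
    (cM : M = 0 ∨ M = z ∨ M = z - v + w ∨ M = z - v + u + w ∨ M = 2 * z - v + u + w)
    (hP : 0 ≤ P ∧ v ≤ P ∧ v - u ≤ P ∧ z + v ≤ P ∧ z - v + w ≤ P ∧ z - v + u + w ≤ P)
    (hQ : 0 ≤ Q ∧ v ≤ Q ∧ v - u ≤ Q ∧ v - z ≤ Q ∧ v - z - 2 * u ≤ Q ∧ 2 * v - z - 2 * u - w ≤ Q)
    (hN : 2 * v - z ≤ N ∧ 2 * v - z - 3 * u ≤ N ∧ 2 * z - v + w ≤ N ∧ 2 * z + 2 * v ≤ N)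
    (eQ : Q = v ∨ Q = v - u ∨ Q = v - z ∨ Q = v - z - 2 * u ∨ Q = 2 * v - z - 2 * u - w)
    (eP : P = v ∨ P = v - u ∨ P = z + v)
    (eN : N = 2 * v - z ∨ N = 2 * v - z - 3 * u ∨ N = 2 * z + 2 * v) :
    ERaisesJ (y1 + P + Q - N) (x0 + y1 + 2 * Q - P + z - 2 * v + 2 * u + w)
      (x0 + y1 + 2 * P - Q - (2 * z - v + u + w)) (y1 + P - M) (x0 + y1 + Q) := by
  unfold ERaisesJ EFree EStuck
  rcases eP with eP | eP | eP
  · have hN' : N = 2 * v - z := by omega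
    have hQ' : Q = v - z ∨ Q = 2 * v - z - 2 * u - w := by omega
    have hM' : M = 0 ∨ M = z - v + u + w := by omega
    clear eQ eN cM
    subst eP hN'
    rcases hQ' with rfl | rfl <;> rcases hM' with rfl | rfl <;> refine ⟨?_, ?_⟩
    all_goals first
      | rintro ⟨h1 | h1, h2 | h2⟩ <;> omega
      | rintro (h | h) <;> refine ⟨?_, ?_, ?_, ?_⟩ <;> intro h3 <;> omega
  · have hN' : N = 2 * v - z - 3 * u := by omega
    have hQ' : Q = v - z - 2 * u ∨ Q = 2 * v - z - 2 * u - w := by omega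
    have hM' : M = 0 ∨ M = z ∨ M = z - v + w := by omega
    clear eQ eN cM
    subst eP hN'
    rcases hQ' with rfl | rfl <;> rcases hM' with rfl | rfl | rfl <;> refine ⟨?_, ?_⟩
    all_goals first
      | rintro ⟨h1 | h1, h2 | h2⟩ <;> omega
      | rintro (h | h) <;> refine ⟨?_, ?_, ?_, ?_⟩ <;> intro h3 <;> omega
  · have hN' : N = 2 * z + 2 * v := by omega
    have hQ' : Q = v ∨ Q = v - u ∨ Q = 2 * v - z - 2 * u - w := by omega
    have hM' : M = z ∨ M = 2 * z - v + u + w := by omega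
    clear eQ eN cM
    subst eP hN'
    rcases hQ' with rfl | rfl | rfl <;> rcases hM' with rfl | rfl <;> refine ⟨?_, ?_⟩
    all_goals first
      | rintro ⟨h1 | h1, h2 | h2⟩ <;> omega
      | rintro (h | h) <;> refine ⟨?_, ?_, ?_, ?_⟩ <;> intro h3 <;> omega

theorem eRaisesI_of_nonneg (hw : 0 ≤ w) (x0 y1 : ℤ) {M P Q N : ℤ}
    (hM : 0 ≤ M ∧ z ≤ M ∧ z - v + w ≤ M ∧ z - v + u + w ≤ M ∧ 2 * z - v + u + w ≤ M)
    (cM : M = 0 ∨ M = z ∨ M = z - v + w ∨ M = z - v + u + w ∨ M = 2 * z - v + u + w)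
    (hP : 0 ≤ P ∧ v ≤ P ∧ v - u ≤ P ∧ z + v ≤ P ∧ z - v + w ≤ P ∧ z - v + u + w ≤ P)
    (hQ : 0 ≤ Q ∧ v ≤ Q ∧ v - u ≤ Q ∧ v - z ≤ Q ∧ v - z - 2 * u ≤ Q ∧ 2 * v - z - 2 * u - w ≤ Q)
    (hN : 2 * v - z ≤ N ∧ 2 * v - z - 3 * u ≤ N ∧ 2 * z - v + w ≤ N ∧ 2 * z + 2 * v ≤ N)
    (eQ : Q = v ∨ Q = v - u ∨ Q = v - z ∨ Q = v - z - 2 * u ∨ Q = 2 * v - z - 2 * u - w)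
    (eP : (P = 0 ∨ P = z - v + w ∨ P = z - v + u + w) ∧ v < P ∧ v - u < P ∧ z + v < P)
    (eN : N = 2 * z - v + w ∧ 2 * v - z + 1 < N ∧ 2 * v - z - 3 * u + 1 < N ∧
      2 * z + 2 * v + 1 < N) :
    ERaisesI (y1 + P + Q - N) (x0 + y1 + 2 * Q - P + z - 2 * v + 2 * u + w)
      (x0 + y1 + 2 * P - Q - (2 * z - v + u + w)) (y1 + P - M) (x0 + y1 + Q) := by
  obtain ⟨eP, hP'⟩ := eP
  unfold ERaisesI EStuck
  rcases eP with eP | eP | eP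
  · exfalso; omega
  · have hu : u ≤ 0 := by omega
    have hM' : M = z ∨ M = z - v + w ∨ M = 2 * z - v + u + w := by omega
    have hQ' : Q = v - u ∨ Q = v - z - 2 * u ∨ Q = 2 * v - z - 2 * u - w := by omega
    have hN' : N = 2 * z - v + w := by omega
    clear cM eQ
    subst eP
    (rcases hQ' with rfl | rfl | rfl) <;>
    (obtain rfl := hN') <;>
    (rcases hM' with rfl | rfl | rfl <;> try (exfalso; omega)) <;>
    (refine ⟨?_, by omega, by omega⟩; omega)
  · have hu : 0 ≤ u := by omega
    have hM' : M = z ∨ M = z - v + u + w ∨ M = 2 * z - v + u + w := by omega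
    have hQ' : Q = v ∨ Q = v - z ∨ Q = 2 * v - z - 2 * u - w := by omega
    have hN' : N = 2 * z - v + w := by omega
    clear cM eQ
    subst eP
    (rcases hQ' with rfl | rfl | rfl) <;>
    (obtain rfl := hN') <;>
    (rcases hM' with rfl | rfl | rfl <;> try (exfalso; omega)) <;>
    (refine ⟨?_, by omega, by omega⟩; omega)

theorem eFixesI_of_nonneg (hw : 0 ≤ w) (x0 y1 : ℤ) {M P Q N : ℤ}
    (hM : 0 ≤ M ∧ z ≤ M ∧ z - v + w ≤ M ∧ z - v + u + w ≤ M ∧ 2 * z - v + u + w ≤ M)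
    (cM : M = 0 ∨ M = z ∨ M = z - v + w ∨ M = z - v + u + w ∨ M = 2 * z - v + u + w)
    (hP : 0 ≤ P ∧ v ≤ P ∧ v - u ≤ P ∧ z + v ≤ P ∧ z - v + w ≤ P ∧ z - v + u + w ≤ P)
    (hQ : 0 ≤ Q ∧ v ≤ Q ∧ v - u ≤ Q ∧ v - z ≤ Q ∧ v - z - 2 * u ≤ Q ∧ 2 * v - z - 2 * u - w ≤ Q)
    (hN : 2 * v - z ≤ N ∧ 2 * v - z - 3 * u ≤ N ∧ 2 * z - v + w ≤ N ∧ 2 * z + 2 * v ≤ N)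
    (eQ : Q = v ∨ Q = v - u ∨ Q = v - z ∨ Q = v - z - 2 * u ∨ Q = 2 * v - z - 2 * u - w)
    (eP : (P = 0 ∨ P = z - v + w ∨ P = z - v + u + w) ∧ v < P ∧ v - u < P ∧ z + v < P)
    (eN : N = 2 * z - v + w ∧
      (N = 2 * v - z + 1 ∨ N = 2 * v - z - 3 * u + 1 ∨ N = 2 * z + 2 * v + 1)) :
    EFixesI (y1 + P + Q - N) (x0 + y1 + 2 * Q - P + z - 2 * v + 2 * u + w)
      (x0 + y1 + 2 * P - Q - (2 * z - v + u + w)) (y1 + P - M) (x0 + y1 + Q) := by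
  obtain ⟨eP, hP'⟩ := eP
  unfold EFixesI EStuck
  rcases eP with eP | eP | eP
  · exfalso; omega
  · have hu : u ≤ 0 := by omega
    have hM' : M = z ∨ M = z - v + w ∨ M = 2 * z - v + u + w := by omega
    have hQ' : Q = v - u ∨ Q = v - z - 2 * u ∨ Q = 2 * v - z - 2 * u - w := by omega
    have hN' : N = 2 * z - v + w ∧ (N = 2 * v - z - 3 * u + 1 ∨ N = 2 * z + 2 * v + 1) := by omega
    clear cM eQ eN
    subst eP
    (rcases hQ' with rfl | rfl | rfl) <;>
    (rcases hN' with ⟨rfl, hN' | hN'⟩ <;> try (exfalso; omega)) <;>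
    (rcases hM' with rfl | rfl | rfl <;> try (exfalso; omega)) <;>
    (refine ⟨?_, by omega, by omega⟩; omega)
  · have hu : 0 ≤ u := by omega
    have hM' : M = z ∨ M = z - v + u + w ∨ M = 2 * z - v + u + w := by omega
    have hQ' : Q = v ∨ Q = v - z ∨ Q = 2 * v - z - 2 * u - w := by omega
    have hN' : N = 2 * z - v + w ∧ (N = 2 * v - z + 1 ∨ N = 2 * z + 2 * v + 1) := by omega
    clear cM eQ eN
    subst eP
    (rcases hQ' with rfl | rfl | rfl) <;>
    (rcases hN' with ⟨rfl, hN' | hN'⟩ <;> try (exfalso; omega)) <;>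
    (rcases hM' with rfl | rfl | rfl <;> try (exfalso; omega)) <;>
    (refine ⟨?_, by omega, by omega⟩; omega)

theorem eLowersI_of_nonneg (hw : 0 ≤ w) (x0 y1 : ℤ) {M P Q N : ℤ}
    (hM : 0 ≤ M ∧ z ≤ M ∧ z - v + w ≤ M ∧ z - v + u + w ≤ M ∧ 2 * z - v + u + w ≤ M)
    (cM : M = 0 ∨ M = z ∨ M = z - v + w ∨ M = z - v + u + w ∨ M = 2 * z - v + u + w)
    (hP : 0 ≤ P ∧ v ≤ P ∧ v - u ≤ P ∧ z + v ≤ P ∧ z - v + w ≤ P ∧ z - v + u + w ≤ P)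
    (hQ : 0 ≤ Q ∧ v ≤ Q ∧ v - u ≤ Q ∧ v - z ≤ Q ∧ v - z - 2 * u ≤ Q ∧ 2 * v - z - 2 * u - w ≤ Q)
    (hN : 2 * v - z ≤ N ∧ 2 * v - z - 3 * u ≤ N ∧ 2 * z - v + w ≤ N ∧ 2 * z + 2 * v ≤ N)
    (eQ : Q = v ∨ Q = v - u ∨ Q = v - z ∨ Q = v - z - 2 * u ∨ Q = 2 * v - z - 2 * u - w)
    (eP : (P = 0 ∨ P = z - v + w ∨ P = z - v + u + w) ∧ v < P ∧ v - u < P ∧ z + v < P)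
    (eN : N = 2 * v - z ∨ N = 2 * v - z - 3 * u ∨ N = 2 * z + 2 * v) :
    ELowersI (y1 + P + Q - N) (x0 + y1 + 2 * Q - P + z - 2 * v + 2 * u + w)
      (x0 + y1 + 2 * P - Q - (2 * z - v + u + w)) (y1 + P - M) (x0 + y1 + Q) := by
  obtain ⟨eP, hP'⟩ := eP
  unfold ELowersI EStuck
  rcases eP with eP | eP | eP
  · have hM' : M = 0 := by omega
    have hQ' : Q = v - z ∨ Q = v - z - 2 * u ∨ Q = 2 * v - z - 2 * u - w := by omega
    have hN' : N = 2 * v - z ∨ N = 2 * v - z - 3 * u := by omega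
    clear cM eQ eN
    subst eP hM'
    (rcases hQ' with rfl | rfl | rfl) <;>
    (rcases hN' with rfl | rfl <;> try (exfalso; omega)) <;>
    (refine ⟨?_, by omega, by omega, by omega⟩; omega)
  · have hu : u ≤ 0 := by omega
    have hM' : M = z ∨ M = z - v + w ∨ M = 2 * z - v + u + w := by omega
    have hQ' : Q = v - u ∨ Q = v - z - 2 * u ∨ Q = 2 * v - z - 2 * u - w := by omega
    have hN' : N = 2 * v - z - 3 * u ∨ N = 2 * z + 2 * v := by omega
    clear cM eQ eN
    subst eP
    (rcases hQ' with rfl | rfl | rfl) <;>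
    (rcases hN' with rfl | rfl <;> try (exfalso; omega)) <;>
    (rcases hM' with rfl | rfl | rfl <;> try (exfalso; omega)) <;>
    (refine ⟨?_, by omega, by omega, by omega⟩; omega)
  · have hu : 0 ≤ u := by omega
    have hM' : M = z ∨ M = z - v + u + w ∨ M = 2 * z - v + u + w := by omega
    have hQ' : Q = v ∨ Q = v - z ∨ Q = 2 * v - z - 2 * u - w := by omega
    have hN' : N = 2 * v - z ∨ N = 2 * z + 2 * v := by omega
    clear cM eQ eN
    subst eP
    (rcases hQ' with rfl | rfl | rfl) <;>
    (rcases hN' with rfl | rfl <;> try (exfalso; omega)) <;>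
    (rcases hM' with rfl | rfl | rfl <;> try (exfalso; omega)) <;>
    (refine ⟨?_, by omega, by omega, by omega⟩; omega)

theorem eLowersK_of_neg (hw : w < 0) (x0 y1 : ℤ) {M P Q N : ℤ}
    (hM : 0 ≤ M ∧ z ≤ M ∧ z - v ≤ M ∧ z - v + u + w ≤ M ∧ 2 * z - v + u + w ≤ M)
    (cM : M = 0 ∨ M = z ∨ M = z - v ∨ M = z - v + u + w ∨ M = 2 * z - v + u + w)
    (hP : 0 ≤ P ∧ v ≤ P ∧ v - u ≤ P ∧ z + v ≤ P ∧ z - v ≤ P ∧ z - v + u + w ≤ P)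
    (hQ : 0 ≤ Q ∧ v ≤ Q ∧ v - u ≤ Q ∧ v - z ≤ Q ∧ v - z - 2 * u - w ≤ Q ∧
      2 * v - z - 2 * u - w ≤ Q)
    (hN : 2 * v - z ≤ N ∧ 2 * v - z - 3 * u - w ≤ N ∧ 2 * z - v ≤ N ∧ 2 * z + 2 * v ≤ N)
    (eQ : (Q = 0 ∨ Q = v ∨ Q = v - z) ∧ v - u < Q ∧ v - z - 2 * u - w < Q ∧
      2 * v - z - 2 * u - w < Q)
    (eP : (P = 0 ∨ P = v ∨ P = z + v ∨ P = z - v ∨ P = z - v + u + w) ∧ v - u < P)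
    (eN : (N = 2 * v - z ∨ N = 2 * z - v ∨ N = 2 * z + 2 * v) ∧
      2 * v - z - 3 * u - w + 1 < N) :
    ELowersK (y1 + P + Q - N) (x0 + y1 + 2 * Q - P + z - 2 * v + 2 * u + w)
      (x0 + y1 + 2 * P - Q - (2 * z - v + u + w)) (y1 + P - M) (x0 + y1 + Q) := by
  obtain ⟨eQ, hQ0⟩ := eQ
  obtain ⟨eP, hP0⟩ := eP
  obtain ⟨eN, hN0⟩ := eN
  unfold ELowersK EFree EStuck
  rcases eQ with eQ | eQ | eQ
  · have hP1 : P = z - v ∨ P = z - v + u + w := by omega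
    have hM1 : M = z - v ∨ M = z - v + u + w ∨ M = 2 * z - v + u + w := by omega
    have hN1 : N = 2 * z - v := by omega
    clear cM eP eN
    subst hN1 eQ
    (rcases hP1 with rfl | rfl) <;>
    (rcases hM1 with rfl | rfl | rfl) <;>
    refine ⟨?_, ?_⟩
    all_goals first
      | rintro ⟨h1 | h1, h2 | h2⟩ <;> omega
      | rintro (h | h) <;> omega
  · have hP1 : P = z + v ∨ P = z - v + u + w := by omega
    have hM1 : M = z ∨ M = 2 * z - v + u + w := by omega
    have hN1 : N = 2 * z + 2 * v := by omega
    clear cM eP eN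
    subst hN1 eQ
    (rcases hP1 with rfl | rfl) <;>
    (rcases hM1 with rfl | rfl) <;>
    refine ⟨?_, ?_⟩
    all_goals first
      | rintro ⟨h1 | h1, h2 | h2⟩ <;> omega
      | rintro (h | h) <;> omega
  · have hP1 : P = 0 ∨ P = v ∨ P = z - v + u + w := by omega
    have hM1 : M = 0 ∨ M = z - v + u + w := by omega
    have hN1 : N = 2 * v - z := by omega
    clear cM eP eN
    subst hN1 eQ
    (rcases hP1 with rfl | rfl | rfl) <;>
    (rcases hM1 with rfl | rfl) <;>
    refine ⟨?_, ?_⟩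
    all_goals first
      | rintro ⟨h1 | h1, h2 | h2⟩ <;> omega
      | rintro (h | h) <;> omega

theorem eRaisesJ_of_neg (hw : w < 0) (x0 y1 : ℤ) {M P Q N : ℤ}
    (hM : 0 ≤ M ∧ z ≤ M ∧ z - v ≤ M ∧ z - v + u + w ≤ M ∧ 2 * z - v + u + w ≤ M)
    (cM : M = 0 ∨ M = z ∨ M = z - v ∨ M = z - v + u + w ∨ M = 2 * z - v + u + w)
    (hP : 0 ≤ P ∧ v ≤ P ∧ v - u ≤ P ∧ z + v ≤ P ∧ z - v ≤ P ∧ z - v + u + w ≤ P)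
    (hQ : 0 ≤ Q ∧ v ≤ Q ∧ v - u ≤ Q ∧ v - z ≤ Q ∧ v - z - 2 * u - w ≤ Q ∧
      2 * v - z - 2 * u - w ≤ Q)
    (hN : 2 * v - z ≤ N ∧ 2 * v - z - 3 * u - w ≤ N ∧ 2 * z - v ≤ N ∧ 2 * z + 2 * v ≤ N)
    (eQ : Q = v - u ∨ Q = v - z - 2 * u - w ∨ Q = 2 * v - z - 2 * u - w)
    (eP : P = v - u) (eN : N = 2 * v - z - 3 * u - w) :
    ERaisesJ (y1 + P + Q - N) (x0 + y1 + 2 * Q - P + z - 2 * v + 2 * u + w)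
      (x0 + y1 + 2 * P - Q - (2 * z - v + u + w)) (y1 + P - M) (x0 + y1 + Q) := by
  subst eP eN
  unfold ERaisesJ EFree EStuck
  rcases eQ with rfl | rfl | rfl
  · exfalso; omega
  · have hM1 : M = 0 ∨ M = z - v := by omega
    clear cM
    rcases hM1 with rfl | rfl <;> refine ⟨?_, ?_⟩
    all_goals first
      | rintro ⟨h1 | h1, h2 | h2⟩ <;> omega
      | rintro (h | h) <;> refine ⟨?_, ?_, ?_, ?_⟩ <;> intro h3 <;> omega
  · have hM1 : M = 0 ∨ M = z := by omega
    clear cM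
    rcases hM1 with rfl | rfl <;> refine ⟨?_, ?_⟩
    all_goals first
      | rintro ⟨h1 | h1, h2 | h2⟩ <;> omega
      | rintro (h | h) <;> refine ⟨?_, ?_, ?_, ?_⟩ <;> intro h3 <;> omega

theorem eRaisesI_of_neg (hw : w < 0) (x0 y1 : ℤ) {M P Q N : ℤ}
    (hM : 0 ≤ M ∧ z ≤ M ∧ z - v ≤ M ∧ z - v + u + w ≤ M ∧ 2 * z - v + u + w ≤ M)
    (cM : M = 0 ∨ M = z ∨ M = z - v ∨ M = z - v + u + w ∨ M = 2 * z - v + u + w)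
    (hP : 0 ≤ P ∧ v ≤ P ∧ v - u ≤ P ∧ z + v ≤ P ∧ z - v ≤ P ∧ z - v + u + w ≤ P)
    (hQ : 0 ≤ Q ∧ v ≤ Q ∧ v - u ≤ Q ∧ v - z ≤ Q ∧ v - z - 2 * u - w ≤ Q ∧
      2 * v - z - 2 * u - w ≤ Q)
    (hN : 2 * v - z ≤ N ∧ 2 * v - z - 3 * u - w ≤ N ∧ 2 * z - v ≤ N ∧ 2 * z + 2 * v ≤ N)
    (eQ : Q = v - u ∨ Q = v - z - 2 * u - w ∨ Q = 2 * v - z - 2 * u - w)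
    (eP : (P = 0 ∨ P = v ∨ P = z + v ∨ P = z - v ∨ P = z - v + u + w) ∧ v - u < P)
    (eN : (N = 2 * v - z ∨ N = 2 * z - v ∨ N = 2 * z + 2 * v) ∧
      2 * v - z - 3 * u - w + 1 < N) :
    ERaisesI (y1 + P + Q - N) (x0 + y1 + 2 * Q - P + z - 2 * v + 2 * u + w)
      (x0 + y1 + 2 * P - Q - (2 * z - v + u + w)) (y1 + P - M) (x0 + y1 + Q) := by
  obtain ⟨eP, hP0⟩ := eP
  obtain ⟨eN, hN0⟩ := eN
  unfold ERaisesI EStuck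
  rcases eQ with rfl | rfl | rfl
  · have hP1 : P = z + v ∨ P = z - v := by omega
    have hM1 : M = 2 * z - v + u + w := by omega
    have hN1 : N = 2 * z - v ∨ N = 2 * z + 2 * v := by omega
    clear cM eP eN
    (rcases hP1 with rfl | rfl) <;>
    (obtain rfl := hM1) <;>
    (rcases hN1 with rfl | rfl) <;>
    (exact ⟨by omega, by omega, by omega⟩)
  · have hP1 : P = 0 ∨ P = z - v := by omega
    have hM1 : M = 0 ∨ M = z - v := by omega
    have hN1 : N = 2 * v - z ∨ N = 2 * z - v := by omega
    clear cM eP eN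
    (rcases hP1 with rfl | rfl) <;>
    (rcases hM1 with rfl | rfl) <;>
    (rcases hN1 with rfl | rfl) <;>
    (exact ⟨by omega, by omega, by omega⟩)
  · have hP1 : P = v ∨ P = z + v := by omega
    have hM1 : M = 0 ∨ M = z := by omega
    have hN1 : N = 2 * v - z ∨ N = 2 * z + 2 * v := by omega
    clear cM eP eN
    (rcases hP1 with rfl | rfl) <;>
    (rcases hM1 with rfl | rfl) <;>
    (rcases hN1 with rfl | rfl) <;>
    (exact ⟨by omega, by omega, by omega⟩)

theorem eFixesI_of_neg (hw : w < 0) (x0 y1 : ℤ) {M P Q N : ℤ}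
    (hM : 0 ≤ M ∧ z ≤ M ∧ z - v ≤ M ∧ z - v + u + w ≤ M ∧ 2 * z - v + u + w ≤ M)
    (cM : M = 0 ∨ M = z ∨ M = z - v ∨ M = z - v + u + w ∨ M = 2 * z - v + u + w)
    (hP : 0 ≤ P ∧ v ≤ P ∧ v - u ≤ P ∧ z + v ≤ P ∧ z - v ≤ P ∧ z - v + u + w ≤ P)
    (hQ : 0 ≤ Q ∧ v ≤ Q ∧ v - u ≤ Q ∧ v - z ≤ Q ∧ v - z - 2 * u - w ≤ Q ∧
      2 * v - z - 2 * u - w ≤ Q)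
    (hN : 2 * v - z ≤ N ∧ 2 * v - z - 3 * u - w ≤ N ∧ 2 * z - v ≤ N ∧ 2 * z + 2 * v ≤ N)
    (eQ : Q = v - u ∨ Q = v - z - 2 * u - w ∨ Q = 2 * v - z - 2 * u - w)
    (eP : (P = 0 ∨ P = v ∨ P = z + v ∨ P = z - v ∨ P = z - v + u + w) ∧ v - u < P)
    (eN : (N = 2 * v - z ∨ N = 2 * z - v ∨ N = 2 * z + 2 * v) ∧
      N = 2 * v - z - 3 * u - w + 1) :
    EFixesI (y1 + P + Q - N) (x0 + y1 + 2 * Q - P + z - 2 * v + 2 * u + w)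
      (x0 + y1 + 2 * P - Q - (2 * z - v + u + w)) (y1 + P - M) (x0 + y1 + Q) := by
  obtain ⟨eP, hP0⟩ := eP
  obtain ⟨eN, hN0⟩ := eN
  unfold EFixesI EStuck
  rcases eQ with rfl | rfl | rfl
  · exfalso; omega
  · have hP1 : P = 0 ∨ P = z - v := by omega
    have hM1 : M = 0 ∨ M = z - v := by omega
    have hN1 : N = 2 * v - z ∨ N = 2 * z - v := by omega
    clear cM eP eN
    (rcases hP1 with rfl | rfl) <;>
    (rcases hM1 with rfl | rfl) <;>
    (rcases hN1 with rfl | rfl) <;>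
    (exact ⟨by omega, by omega, by omega⟩)
  · have hP1 : P = v ∨ P = z + v := by omega
    have hM1 : M = 0 ∨ M = z := by omega
    have hN1 : N = 2 * v - z ∨ N = 2 * z + 2 * v := by omega
    clear cM eP eN
    (rcases hP1 with rfl | rfl) <;>
    (rcases hM1 with rfl | rfl) <;>
    (rcases hN1 with rfl | rfl) <;>
    (exact ⟨by omega, by omega, by omega⟩)

theorem eLowersI_of_neg (hw : w < 0) (x0 y1 : ℤ) {M P Q N : ℤ}
    (hM : 0 ≤ M ∧ z ≤ M ∧ z - v ≤ M ∧ z - v + u + w ≤ M ∧ 2 * z - v + u + w ≤ M)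
    (cM : M = 0 ∨ M = z ∨ M = z - v ∨ M = z - v + u + w ∨ M = 2 * z - v + u + w)
    (hP : 0 ≤ P ∧ v ≤ P ∧ v - u ≤ P ∧ z + v ≤ P ∧ z - v ≤ P ∧ z - v + u + w ≤ P)
    (hQ : 0 ≤ Q ∧ v ≤ Q ∧ v - u ≤ Q ∧ v - z ≤ Q ∧ v - z - 2 * u - w ≤ Q ∧
      2 * v - z - 2 * u - w ≤ Q)
    (hN : 2 * v - z ≤ N ∧ 2 * v - z - 3 * u - w ≤ N ∧ 2 * z - v ≤ N ∧ 2 * z + 2 * v ≤ N)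
    (eQ : Q = v - u ∨ Q = v - z - 2 * u - w ∨ Q = 2 * v - z - 2 * u - w)
    (eP : (P = 0 ∨ P = v ∨ P = z + v ∨ P = z - v ∨ P = z - v + u + w) ∧ v - u < P)
    (eN : N = 2 * v - z - 3 * u - w) :
    ELowersI (y1 + P + Q - N) (x0 + y1 + 2 * Q - P + z - 2 * v + 2 * u + w)
      (x0 + y1 + 2 * P - Q - (2 * z - v + u + w)) (y1 + P - M) (x0 + y1 + Q) := by
  obtain ⟨eP, hP0⟩ := eP
  unfold ELowersI EStuck
  rcases eQ with rfl | rfl | rfl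
  · exfalso; omega
  · have hP1 : P = 0 ∨ P = z - v := by omega
    have hM1 : M = 0 ∨ M = z - v := by omega
    clear cM eP
    subst eN
    (rcases hP1 with rfl | rfl) <;>
    (rcases hM1 with rfl | rfl) <;>
    (exact ⟨by omega, by omega, by omega, by omega⟩)
  · have hP1 : P = v ∨ P = z + v := by omega
    have hM1 : M = 0 ∨ M = z := by omega
    clear cM eP
    subst eN
    (rcases hP1 with rfl | rfl) <;>
    (rcases hM1 with rfl | rfl) <;>
    (exact ⟨by omega, by omega, by omega, by omega⟩)

end

section

variable {z u v w : ℤ}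

theorem tropM_spec_of_nonneg (hw : 0 ≤ w) (z u v : ℤ) :
    (0 ≤ tropM z u v w ∧
      z ≤ tropM z u v w ∧
      z - v + w ≤ tropM z u v w ∧
      z - v + u + w ≤ tropM z u v w ∧
      2 * z - v + u + w ≤ tropM z u v w) ∧
      (tropM z u v w = 0 ∨
      tropM z u v w = z ∨
      tropM z u v w = z - v + w ∨
      tropM z u v w = z - v + u + w ∨
      tropM z u v w = 2 * z - v + u + w) := by
  obtain ⟨h, c⟩ := tropM_spec z u v w
  refine ⟨by clear c; omega, ?_⟩
  rcases c with c | c | c | c | c | c <;> rw [c] at h ⊢ <;> omega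

theorem tropM_spec_of_neg (hw : w < 0) (z u v : ℤ) :
    (0 ≤ tropM z u v w ∧
      z ≤ tropM z u v w ∧
      z - v ≤ tropM z u v w ∧
      z - v + u + w ≤ tropM z u v w ∧
      2 * z - v + u + w ≤ tropM z u v w) ∧
      (tropM z u v w = 0 ∨
      tropM z u v w = z ∨
      tropM z u v w = z - v ∨
      tropM z u v w = z - v + u + w ∨
      tropM z u v w = 2 * z - v + u + w) := by
  obtain ⟨h, c⟩ := tropM_spec z u v w
  refine ⟨by clear c; omega, ?_⟩
  rcases c with c | c | c | c | c | c <;> rw [c] at h ⊢ <;> omega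

theorem tropP_spec_of_nonneg (hw : 0 ≤ w) (z u v : ℤ) :
    (0 ≤ tropP z u v w ∧
      v ≤ tropP z u v w ∧
      v - u ≤ tropP z u v w ∧
      z + v ≤ tropP z u v w ∧
      z - v + w ≤ tropP z u v w ∧
      z - v + u + w ≤ tropP z u v w) ∧
      (tropP z u v w = 0 ∨
      tropP z u v w = v ∨
      tropP z u v w = v - u ∨
      tropP z u v w = z + v ∨
      tropP z u v w = z - v + w ∨
      tropP z u v w = z - v + u + w) := by
  obtain ⟨h, c⟩ := tropP_spec z u v w
  refine ⟨by clear c; omega, ?_⟩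
  rcases c with c | c | c | c | c | c | c <;> rw [c] at h ⊢ <;> omega

theorem tropP_spec_of_neg (hw : w < 0) (z u v : ℤ) :
    (0 ≤ tropP z u v w ∧
      v ≤ tropP z u v w ∧
      v - u ≤ tropP z u v w ∧
      z + v ≤ tropP z u v w ∧
      z - v ≤ tropP z u v w ∧
      z - v + u + w ≤ tropP z u v w) ∧
      (tropP z u v w = 0 ∨
      tropP z u v w = v ∨
      tropP z u v w = v - u ∨
      tropP z u v w = z + v ∨
      tropP z u v w = z - v ∨
      tropP z u v w = z - v + u + w) := by
  obtain ⟨h, c⟩ := tropP_spec z u v w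
  refine ⟨by clear c; omega, ?_⟩
  rcases c with c | c | c | c | c | c | c <;> rw [c] at h ⊢ <;> omega

theorem tropQ_spec_of_nonneg (hw : 0 ≤ w) (z u v : ℤ) :
    (0 ≤ tropQ z u v w ∧
      v ≤ tropQ z u v w ∧
      v - u ≤ tropQ z u v w ∧
      v - z ≤ tropQ z u v w ∧
      v - z - 2 * u ≤ tropQ z u v w ∧
      2 * v - z - 2 * u - w ≤ tropQ z u v w) ∧
      (tropQ z u v w = 0 ∨
      tropQ z u v w = v ∨
      tropQ z u v w = v - u ∨
      tropQ z u v w = v - z ∨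
      tropQ z u v w = v - z - 2 * u ∨
      tropQ z u v w = 2 * v - z - 2 * u - w) := by
  obtain ⟨h, c⟩ := tropQ_spec z u v w
  refine ⟨by clear c; omega, ?_⟩
  rcases c with c | c | c | c | c | c | c <;> rw [c] at h ⊢ <;> omega

theorem tropQ_spec_of_neg (hw : w < 0) (z u v : ℤ) :
    (0 ≤ tropQ z u v w ∧
      v ≤ tropQ z u v w ∧
      v - u ≤ tropQ z u v w ∧
      v - z ≤ tropQ z u v w ∧
      v - z - 2 * u - w ≤ tropQ z u v w ∧
      2 * v - z - 2 * u - w ≤ tropQ z u v w) ∧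
      (tropQ z u v w = 0 ∨
      tropQ z u v w = v ∨
      tropQ z u v w = v - u ∨
      tropQ z u v w = v - z ∨
      tropQ z u v w = v - z - 2 * u - w ∨
      tropQ z u v w = 2 * v - z - 2 * u - w) := by
  obtain ⟨h, c⟩ := tropQ_spec z u v w
  refine ⟨by clear c; omega, ?_⟩
  rcases c with c | c | c | c | c | c | c <;> rw [c] at h ⊢ <;> omega

theorem tropN_spec_of_nonneg (hw : 0 ≤ w) (z u v : ℤ) :
    (2 * v - z ≤ tropN z u v w ∧
      2 * v - z - 3 * u ≤ tropN z u v w ∧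
      2 * z - v + w ≤ tropN z u v w ∧
      2 * z + 2 * v ≤ tropN z u v w) ∧
      (tropN z u v w = 2 * v - z ∨
      tropN z u v w = 2 * v - z - 3 * u ∨
      tropN z u v w = 2 * z - v + w ∨
      tropN z u v w = 2 * z + 2 * v) := by
  obtain ⟨h, c⟩ := tropN_spec z u v w
  refine ⟨by clear c; omega, ?_⟩
  rcases c with c | c | c | c | c | c <;> rw [c] at h ⊢ <;> omega

theorem tropN_spec_of_neg (hw : w < 0) (z u v : ℤ) :
    (2 * v - z ≤ tropN z u v w ∧
      2 * v - z - 3 * u - w ≤ tropN z u v w ∧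
      2 * z - v ≤ tropN z u v w ∧
      2 * z + 2 * v ≤ tropN z u v w) ∧
      (tropN z u v w = 2 * v - z ∨
      tropN z u v w = 2 * v - z - 3 * u - w ∨
      tropN z u v w = 2 * z - v ∨
      tropN z u v w = 2 * z + 2 * v) := by
  obtain ⟨h, c⟩ := tropN_spec z u v w
  refine ⟨by clear c; omega, ?_⟩
  rcases c with c | c | c | c | c | c <;> rw [c] at h ⊢ <;> omega

end

section

variable {z u v w : ℤ}

set_option maxHeartbeats 2000000

/-- The first case of `e₂`, in which it moves a unit from `d₂` to `d₃`. The kind of `E` is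
determined by which of the functions `tropP`, `tropQ`, `tropN` change. -/
theorem eTarget_psi_of_nonneg (hw : 0 ≤ w) (x0 y1 : ℤ) :
    ETarget (psi x0 y1 z u v w) (psi x0 y1 z u (v + 1) (w + 1)) := by
  obtain ⟨hM1, cM1⟩ := tropM_spec_of_nonneg hw z u v
  obtain ⟨hP1, cP1⟩ := tropP_spec_of_nonneg hw z u v
  obtain ⟨hQ1, cQ1⟩ := tropQ_spec_of_nonneg hw z u v
  obtain ⟨hN1, cN1⟩ := tropN_spec_of_nonneg hw z u v
  have eM : tropM z u (v + 1) (w + 1) = tropM z u v w := by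
    clear hM1 cM1 hP1 cP1 hQ1 cQ1 hN1 cN1
    unfold tropM; omega
  have eP : ((tropP z u v w = v ∨ tropP z u v w = v - u ∨ tropP z u v w = z + v) ∧
      tropP z u (v + 1) (w + 1) = tropP z u v w + 1) ∨
      (((tropP z u v w = 0 ∨ tropP z u v w = z - v + w ∨ tropP z u v w = z - v + u + w) ∧
        v < tropP z u v w ∧ v - u < tropP z u v w ∧ z + v < tropP z u v w) ∧
      tropP z u (v + 1) (w + 1) = tropP z u v w) := by
    have h2 := tropP_spec_of_nonneg (w := w + 1) (by omega) z u (v + 1)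
    clear hM1 cM1 hQ1 cQ1 hN1 cN1 eM
    omega
  have eQ : ((tropQ z u v w = v ∨ tropQ z u v w = v - u ∨ tropQ z u v w = v - z ∨
        tropQ z u v w = v - z - 2 * u ∨ tropQ z u v w = 2 * v - z - 2 * u - w) ∧
      tropQ z u (v + 1) (w + 1) = tropQ z u v w + 1) ∨
      ((tropQ z u v w = 0 ∧ v < 0 ∧ v - u < 0 ∧ v - z < 0 ∧ v - z - 2 * u < 0 ∧
        2 * v - z - 2 * u - w < 0) ∧
      tropQ z u (v + 1) (w + 1) = tropQ z u v w) := by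
    have h2 := tropQ_spec_of_nonneg (w := w + 1) (by omega) z u (v + 1)
    clear hM1 cM1 hP1 cP1 hN1 cN1 eM eP
    omega
  have hN' : (2 * v - z + 2 ≤ tropN z u (v + 1) (w + 1) ∧
      2 * v - z - 3 * u + 2 ≤ tropN z u (v + 1) (w + 1) ∧
      2 * z - v + w ≤ tropN z u (v + 1) (w + 1) ∧
      2 * z + 2 * v + 2 ≤ tropN z u (v + 1) (w + 1)) ∧
      (tropN z u (v + 1) (w + 1) = 2 * v - z + 2 ∨
      tropN z u (v + 1) (w + 1) = 2 * v - z - 3 * u + 2 ∨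
      tropN z u (v + 1) (w + 1) = 2 * z - v + w ∨
      tropN z u (v + 1) (w + 1) = 2 * z + 2 * v + 2) := by
    have h2 := tropN_spec_of_nonneg (w := w + 1) (by omega) z u (v + 1)
    clear hM1 cM1 hP1 cP1 hQ1 cQ1 hN1 cN1 eM eP eQ
    omega
  refine ⟨by simp only [psi, eM]; ring, ?_⟩
  have assoc : x0 + y1 + 2 * tropQ z u v w - tropP z u v w + (z - 2 * v + 2 * u + w) =
    x0 + y1 + 2 * tropQ z u v w - tropP z u v w + z - 2 * v + 2 * u + w := by ring
  simp only [psi, eM, assoc]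
  rcases eQ with ⟨eQ, eQ'⟩ | ⟨eQ, eQ'⟩
  · rcases eP with ⟨eP, eP'⟩ | ⟨eP, eP'⟩
    · refine Or.inr (Or.inl ⟨eRaisesJ_of_nonneg hw x0 y1 hM1 cM1 hP1 hQ1 hN1 eQ eP ?_, ?_⟩)
      · clear cM1; omega
      · rw [eP', eQ']
        have : tropN z u (v + 1) (w + 1) = tropN z u v w + 2 := by clear cM1; omega
        omega
    · rw [eP', eQ']
      have hc : tropN z u (v + 1) (w + 1) = tropN z u v w ∨
        tropN z u (v + 1) (w + 1) = tropN z u v w + 1 ∨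
        tropN z u (v + 1) (w + 1) = tropN z u v w + 2 := by clear cM1 eQ eP; omega
      rcases hc with hc | hc | hc
      · refine Or.inr (Or.inr (Or.inl
          ⟨eRaisesI_of_nonneg hw x0 y1 hM1 cM1 hP1 hQ1 hN1 eQ eP ?_, ?_⟩))
        · clear cM1 eQ eP; omega
        · clear cM1 eQ eP hN' cN1; omega
      · refine Or.inr (Or.inr (Or.inr (Or.inl
          ⟨eFixesI_of_nonneg hw x0 y1 hM1 cM1 hP1 hQ1 hN1 eQ eP ?_, ?_⟩)))
        · clear cM1 eQ eP; omega
        · clear cM1 eQ eP hN' cN1; omega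
      · refine Or.inr (Or.inr (Or.inr (Or.inr
          ⟨eLowersI_of_nonneg hw x0 y1 hM1 cM1 hP1 hQ1 hN1 eQ eP ?_, ?_⟩)))
        · clear cM1 eQ eP; omega
        · clear cM1 eQ eP hN' cN1; omega
  · have hN2 : tropN z u v w = 2 * z - v + w ∧
      tropN z u (v + 1) (w + 1) = tropN z u v w := by clear cM1 eP; omega
    have hP2 : tropP z u v w = z - v + w ∨ tropP z u v w = z - v + u + w := by
      clear cM1 hN' cN1 hN2; omega
    have hP3 : tropP z u (v + 1) (w + 1) = tropP z u v w := by
      clear cM1 hN' cN1 hN2; omega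
    refine Or.inl ⟨eLowersK_of_nonneg hw x0 y1 hM1 cM1 eQ hP2 hP1 hN2.1, ?_⟩
    rw [eQ', hP3, hN2.2]
    omega

/-- The second case of `e₂`, in which it moves a unit from `a₃` to `a₂`. -/
theorem eTarget_psi_of_neg (hw : w < 0) (x0 y1 : ℤ) :
    ETarget (psi x0 y1 z u v w) (psi x0 y1 z (u - 1) v (w + 1)) := by
  obtain ⟨hM1, cM1⟩ := tropM_spec_of_neg hw z u v
  obtain ⟨hP1, cP1⟩ := tropP_spec_of_neg hw z u v
  obtain ⟨hQ1, cQ1⟩ := tropQ_spec_of_neg hw z u v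
  obtain ⟨hN1, cN1⟩ := tropN_spec_of_neg hw z u v
  have eM : tropM z (u - 1) v (w + 1) = tropM z u v w := by
    clear hM1 cM1 hP1 cP1 hQ1 cQ1 hN1 cN1
    unfold tropM; omega
  have eP : (tropP z u v w = v - u ∧
      tropP z (u - 1) v (w + 1) = tropP z u v w + 1) ∨
      (((tropP z u v w = 0 ∨ tropP z u v w = v ∨ tropP z u v w = z + v ∨
        tropP z u v w = z - v ∨ tropP z u v w = z - v + u + w) ∧ v - u < tropP z u v w) ∧
      tropP z (u - 1) v (w + 1) = tropP z u v w) := by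
    have h2 := tropP_spec z (u - 1) v (w + 1)
    clear hM1 cM1 hQ1 cQ1 hN1 cN1 eM
    omega
  have eQ : ((tropQ z u v w = v - u ∨ tropQ z u v w = v - z - 2 * u - w ∨
        tropQ z u v w = 2 * v - z - 2 * u - w) ∧
      tropQ z (u - 1) v (w + 1) = tropQ z u v w + 1) ∨
      (((tropQ z u v w = 0 ∨ tropQ z u v w = v ∨ tropQ z u v w = v - z) ∧
        v - u < tropQ z u v w ∧ v - z - 2 * u - w < tropQ z u v w ∧
        2 * v - z - 2 * u - w < tropQ z u v w) ∧
      tropQ z (u - 1) v (w + 1) = tropQ z u v w) := by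
    have h2 := tropQ_spec z (u - 1) v (w + 1)
    clear hM1 cM1 hP1 cP1 hN1 cN1 eM eP
    omega
  have hN' : (2 * v - z ≤ tropN z (u - 1) v (w + 1) ∧
      2 * v - z - 3 * u - w + 2 ≤ tropN z (u - 1) v (w + 1) ∧
      2 * z - v ≤ tropN z (u - 1) v (w + 1) ∧
      2 * z + 2 * v ≤ tropN z (u - 1) v (w + 1)) ∧
      (tropN z (u - 1) v (w + 1) = 2 * v - z ∨
      tropN z (u - 1) v (w + 1) = 2 * v - z - 3 * u - w + 2 ∨
      tropN z (u - 1) v (w + 1) = 2 * z - v ∨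
      tropN z (u - 1) v (w + 1) = 2 * z + 2 * v) := by
    have h2 := tropN_spec z (u - 1) v (w + 1)
    clear hM1 cM1 hP1 cP1 hQ1 cQ1 hN1 cN1 eM eP eQ
    omega
  refine ⟨by simp only [psi, eM]; ring, ?_⟩
  have assoc : x0 + y1 + 2 * tropQ z u v w - tropP z u v w + (z - 2 * v + 2 * u + w) =
    x0 + y1 + 2 * tropQ z u v w - tropP z u v w + z - 2 * v + 2 * u + w := by ring
  simp only [psi, eM, assoc]
  rcases eQ with ⟨eQ, eQ'⟩ | ⟨eQ, eQ'⟩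
  · rcases eP with ⟨eP, eP'⟩ | ⟨eP, eP'⟩
    · have hN2 : tropN z u v w = 2 * v - z - 3 * u - w ∧
        tropN z (u - 1) v (w + 1) = tropN z u v w + 2 := by clear cM1; omega
      refine Or.inr (Or.inl ⟨eRaisesJ_of_neg hw x0 y1 hM1 cM1 hP1 hQ1 hN1 eQ eP hN2.1, ?_⟩)
      rw [eP', eQ']
      clear cM1; omega
    · rw [eP', eQ']
      have hc : tropN z (u - 1) v (w + 1) = tropN z u v w ∨
        tropN z (u - 1) v (w + 1) = tropN z u v w + 1 ∨
        tropN z (u - 1) v (w + 1) = tropN z u v w + 2 := by clear cM1 eQ eP; omega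
      rcases hc with hc | hc | hc
      · refine Or.inr (Or.inr (Or.inl
          ⟨eRaisesI_of_neg hw x0 y1 hM1 cM1 hP1 hQ1 hN1 eQ eP ?_, ?_⟩))
        · clear cM1 eQ eP; omega
        · clear cM1 eQ eP hN' cN1; omega
      · refine Or.inr (Or.inr (Or.inr (Or.inl
          ⟨eFixesI_of_neg hw x0 y1 hM1 cM1 hP1 hQ1 hN1 eQ eP ?_, ?_⟩)))
        · clear cM1 eQ eP; omega
        · clear cM1 eQ eP hN' cN1; omega
      · refine Or.inr (Or.inr (Or.inr (Or.inr
          ⟨eLowersI_of_neg hw x0 y1 hM1 cM1 hP1 hQ1 hN1 eQ eP ?_, ?_⟩)))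
        · clear cM1 eQ eP; omega
        · clear cM1 eQ eP hN' cN1; omega
  · have hP3 : ((tropP z u v w = 0 ∨ tropP z u v w = v ∨ tropP z u v w = z + v ∨
        tropP z u v w = z - v ∨ tropP z u v w = z - v + u + w) ∧ v - u < tropP z u v w) ∧
      tropP z (u - 1) v (w + 1) = tropP z u v w := by
      refine eP.resolve_left ?_
      clear cM1 hN' cN1; omega
    have hN2 : ((tropN z u v w = 2 * v - z ∨ tropN z u v w = 2 * z - v ∨
        tropN z u v w = 2 * z + 2 * v) ∧ 2 * v - z - 3 * u - w + 1 < tropN z u v w) ∧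
      tropN z (u - 1) v (w + 1) = tropN z u v w := by clear cM1 eP; omega
    refine Or.inl ⟨eLowersK_of_neg hw x0 y1 hM1 cM1 hP1 hQ1 hN1 eQ hP3.1 hN2.1, ?_⟩
    rw [eQ', hP3.2, hN2.2]
    clear cM1 cN1 hN' eP
    omega

end

/-! ### The recursion for `E` and its closed form -/

namespace ETarget

set_option maxHeartbeats 1000000 in
theorem inCone {a b : ZLabel} (ha : a.InCone) (h : ETarget a b) : b.InCone := by
  obtain ⟨h1, h2, h3, h4, h5, h6, h7, h8, h9⟩ := ha
  obtain ⟨hr, h⟩ := h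
  obtain ⟨i, k, j, p, q, r⟩ := a
  obtain ⟨i', k', j', p', q', r'⟩ := b
  simp only at *
  unfold ELowersK ERaisesJ ERaisesI EFixesI ELowersI EFree EStuck at h
  rcases h with ⟨h, rfl, rfl, rfl, rfl, rfl⟩ | ⟨h, rfl, rfl, rfl, rfl, rfl⟩ |
    ⟨h, rfl, rfl, rfl, rfl, rfl⟩ | ⟨h, rfl, rfl, rfl, rfl, rfl⟩ | ⟨h, rfl, rfl, rfl, rfl, rfl⟩
  · have h10 : i' ≤ k - 1 := by omega
    have h11 : q' ≤ p' + (k - 1) := by omega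
    clear h
    constructor <;> dsimp only <;> omega
  · have h10 : q + 1 ≤ p + 1 + k' := by omega
    clear h
    constructor <;> dsimp only <;> omega
  · constructor <;> dsimp only <;> omega
  · constructor <;> dsimp only <;> omega
  · constructor <;> dsimp only <;> omega

end ETarget

section shift

variable (i k j p q : ℤ)

theorem eFree_sub_one : EFree i (k - 1) (j - 1) p (q - 1) ↔ EFree i k j p q := by
  unfold EFree; omega

theorem eStuck_sub_one : EStuck i (k - 1) (j - 1) p (q - 1) ↔ EStuck i k j p q := by
  unfold EStuck; omega

theorem eLowersK_sub_one : ELowersK i (k - 1) (j - 1) p (q - 1) ↔ ELowersK i k j p q := by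
  unfold ELowersK
  rw [eFree_sub_one, eStuck_sub_one]
  refine and_congr (imp_congr_right fun _ => ?_) (imp_congr_right fun _ => ?_) <;> omega

theorem eRaisesJ_sub_one : ERaisesJ i (k - 1) (j - 1) p (q - 1) ↔ ERaisesJ i k j p q := by
  unfold ERaisesJ
  rw [eFree_sub_one, eStuck_sub_one]
  refine and_congr (imp_congr_right fun _ => ?_) (imp_congr_right fun _ => ?_) <;> omega

theorem eRaisesI_sub_one : ERaisesI i (k - 1) (j - 1) p (q - 1) ↔ ERaisesI i k j p q := by
  unfold ERaisesI
  rw [eStuck_sub_one]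
  refine and_congr_right fun _ => ?_
  omega

theorem eFixesI_sub_one : EFixesI i (k - 1) (j - 1) p (q - 1) ↔ EFixesI i k j p q := by
  unfold EFixesI
  rw [eStuck_sub_one]
  refine and_congr_right fun _ => ?_
  omega

theorem eLowersI_sub_one : ELowersI i (k - 1) (j - 1) p (q - 1) ↔ ELowersI i k j p q := by
  unfold ELowersI
  rw [eStuck_sub_one]
  refine and_congr_right fun _ => ?_
  omega

end shift

/-- The label of `f₀^r b`, where `b` has the label `a`. -/
def ALabel.toZ (a : ALabel) (r : ℤ) : ZLabel := ⟨a.i, a.k, a.j, a.p, a.q, r⟩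

/-- The recursive definition of `E` agrees with the closed form. -/
theorem eTop_spec (l : ℕ) (a : ALabel) (r : ℤ) (hik : a.i ≤ a.k) (hij : a.i ≤ a.j)
    (hk : a.i + a.k ≤ l) (hj : a.i + a.j ≤ l) (hp : a.p ≤ a.j) (hpq : a.p ≤ a.q)
    (hq : a.q ≤ a.p + a.k) :
    (∃ t, eTop l a = some t ∧ ETarget (a.toZ r) (t.toZ r)) ∨
      (eTop l a = none ∧ ERaisesJ a.i a.k a.j a.p a.q ∧ l ≤ a.i + a.j) := by
  induction l generalizing a with
  | zero =>
    obtain ⟨i, k, j, p, q⟩ := a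
    simp only at hik hij hk hj hp hpq hq
    obtain rfl : i = 0 := by omega
    obtain rfl : k = 0 := by omega
    obtain rfl : j = 0 := by omega
    obtain rfl : p = 0 := by omega
    obtain rfl : q = 0 := by omega
    refine Or.inl ⟨⟨0, 0, 1, 1, 1⟩, by simp [eTop], rfl, Or.inr (Or.inl ?_)⟩
    simp [ALabel.toZ, ERaisesJ, EFree]
  | succ l ih =>
    obtain ⟨i, k, j, p, q⟩ := a
    simp only at hik hij hk hj hp hpq hq ⊢
    rw [eTop, if_pos (by omega)]
    have L1 (h : ELowersK i k j p q) (h0 : 0 < k) :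
        ETarget (ALabel.toZ ⟨i, k, j, p, q⟩ r) (ALabel.toZ ⟨i, k - 1, j, p, q⟩ r) :=
      ⟨rfl, Or.inl ⟨h, by simp only [ALabel.toZ, true_and, and_true]; omega⟩⟩
    have L2 (h : ERaisesJ i k j p q) :
        ETarget (ALabel.toZ ⟨i, k, j, p, q⟩ r) (ALabel.toZ ⟨i, k, j + 1, p + 1, q + 1⟩ r) :=
      ⟨rfl, Or.inr (Or.inl ⟨h, by simp only [ALabel.toZ, true_and]; omega⟩)⟩
    have L5 (h : ELowersI i k j p q) (h0 : 0 < i) (h1 : 0 < j) :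
        ETarget (ALabel.toZ ⟨i, k, j, p, q⟩ r)
          (ALabel.toZ ⟨i - 1, k + 1, j - 1, p, q + 1⟩ r) :=
      ⟨rfl, Or.inr (Or.inr (Or.inr (Or.inr ⟨h, by simp only [ALabel.toZ, true_and]; omega⟩)))⟩
    split_ifs with h1 h2 h3 h4 h5 h6 h7 h8 h9 h10 h11 h12 h13 h14
    · refine Or.inl ⟨_, rfl, L1 ?_ (by omega)⟩
      unfold ELowersK EFree EStuck; omega
    · refine Or.inl ⟨_, rfl, L2 ?_⟩
      unfold ERaisesJ EFree EStuck; omega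
    · refine Or.inr ⟨rfl, ?_, by omega⟩
      unfold ERaisesJ EFree EStuck; omega
    · have hc : ((⟨i, k - 1, j - 1, p, q - 1⟩ : ALabel).k : ℤ) = k - 1 ∧
          ((⟨i, k - 1, j - 1, p, q - 1⟩ : ALabel).j : ℤ) = j - 1 ∧
          ((⟨i, k - 1, j - 1, p, q - 1⟩ : ALabel).q : ℤ) = q - 1 := by
        dsimp only; omega
      obtain ⟨ck, cj, cq⟩ := hc
      rcases ih ⟨i, k - 1, j - 1, p, q - 1⟩ (by dsimp only; omega) (by dsimp only; omega)
        (by dsimp only; omega) (by dsimp only; omega) (by dsimp only; omega)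
        (by dsimp only; omega) (by dsimp only; omega) with ⟨t, ht, ht'⟩ | ⟨ht, ht', hl⟩
      · refine Or.inl ⟨⟨t.i, t.k + 1, t.j + 1, t.p, t.q + 1⟩, by rw [ht]; rfl, rfl, ?_⟩
        have h := ht'.2
        simp only [ALabel.toZ, ck, cj, cq, eLowersK_sub_one, eRaisesJ_sub_one,
          eRaisesI_sub_one, eFixesI_sub_one, eLowersI_sub_one] at h ⊢
        push_cast
        refine Or.imp (And.imp_right fun h => ?_) (Or.imp (And.imp_right fun h => ?_)
          (Or.imp (And.imp_right fun h => ?_) (Or.imp (And.imp_right fun h => ?_)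
          (And.imp_right fun h => ?_)))) h <;> omega
      · refine Or.inr ⟨by rw [ht]; rfl, ?_, by dsimp only at hl; omega⟩
        rwa [ck, cj, cq, eRaisesJ_sub_one] at ht'
    · refine Or.inl ⟨_, rfl, rfl, Or.inr (Or.inr (Or.inl ⟨?_, ?_⟩))⟩
      · unfold ERaisesI EStuck; simp only [ALabel.toZ]; omega
      · simp only [ALabel.toZ, true_and]; omega
    · refine Or.inl ⟨_, rfl, L2 ?_⟩
      unfold ERaisesJ EFree EStuck; omega
    · refine Or.inr ⟨rfl, ?_, by omega⟩
      unfold ERaisesJ EFree EStuck; omega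
    · refine Or.inl ⟨_, rfl, rfl, Or.inr (Or.inr (Or.inr (Or.inl ⟨?_, ?_⟩)))⟩
      · unfold EFixesI EStuck; simp only [ALabel.toZ]; omega
      · simp only [ALabel.toZ, true_and]; omega
    · refine Or.inl ⟨_, rfl, L2 ?_⟩
      unfold ERaisesJ EFree EStuck; omega
    · refine Or.inl ⟨_, rfl, L5 ?_ (by omega) (by omega)⟩
      unfold ELowersI EStuck; omega
    · refine Or.inl ⟨_, rfl, L2 ?_⟩
      unfold ERaisesJ EFree EStuck; omega
    · refine Or.inl ⟨_, rfl, L1 ?_ (by omega)⟩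
      unfold ELowersK EFree EStuck; omega
    · refine Or.inl ⟨_, rfl, L2 ?_⟩
      unfold ERaisesJ EFree EStuck; omega
    · refine Or.inl ⟨_, rfl, L5 ?_ (by omega) (by omega)⟩
      unfold ELowersI EStuck; omega
    · omega

/-! ### The piecewise linear map intertwines the operators -/

section

open CrystalData

namespace ALab

variable {l : ℕ}

/-- The label with integral entries. -/
def toZ (c : ALab l) : ZLabel := ⟨c.i, c.k, c.j, c.p, c.q, c.r⟩

theorem toZ_injective : Function.Injective (toZ (l := l)) := by
  intro c c' h
  simp only [toZ, ZLabel.mk.injEq] at h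
  ext <;> omega

theorem inCone (c : ALab l) : c.toZ.InCone := by
  obtain ⟨i, k, j, p, q, r, h1, h2, h3, h4, h5, h6, h7, h8⟩ := c
  constructor <;> simp only [toZ] <;> omega

theorem exists_toZ_eq {b : ZLabel} (h : b.InCone) (hk : b.i + b.k ≤ l) (hj : b.i + b.j ≤ l) :
    ∃ c : ALab l, c.toZ = b := by
  obtain ⟨i, k, j, p, q, r⟩ := b
  obtain ⟨h1, h2, h3, h4, h5, h6, h7, h8, h9⟩ := h
  simp only at *
  refine ⟨⟨i.toNat, k.toNat, j.toNat, p.toNat, q.toNat, r.toNat, by omega, by omega, by omega,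
    by omega, by omega, by omega, by omega, by omega⟩, ?_⟩
  simp only [toZ, ZLabel.mk.injEq]
  omega

/-- The graph of `E` in terms of labels. -/
theorem eRel_iff {c c' : ALab l} : ERel l c.toASet c'.toASet ↔ ETarget c.toZ c'.toZ := by
  constructor
  · rintro ⟨i, k, j, p, q, r, t, hp, hpq, hq, hr, ht, hb, hb'⟩
    obtain ⟨d, rfl, rfl, rfl, rfl, rfl, rfl, hd⟩ := exists_of_aElt hp hpq hq hr hb
    obtain rfl := toASet_injective hd
    rcases eTop_spec l ⟨c.i, c.k, c.j, c.p, c.q⟩ c.r c.i_le_k c.i_le_j c.k_le c.j_le c.p_le_j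
      c.p_le_q c.q_le with ⟨t', ht', hE⟩ | ⟨ht', -⟩
    · obtain rfl : t' = t := Option.some.inj (ht'.symm.trans ht)
      have hc := ETarget.inCone c.inCone hE
      obtain ⟨h1, h2, h3, h4, h5, h6, h7, h8, h9⟩ := hc
      simp only [ALabel.toZ] at *
      obtain ⟨d, hd1, hd2, hd3, hd4, hd5, hd6, hd⟩ := exists_of_aElt (l := l) (by omega)
        (by omega) (by omega) (by omega) hb'
      obtain rfl := toASet_injective hd
      rw [← hd1, ← hd2, ← hd3, ← hd4, ← hd5] at hE
      simp only [toZ, hd6]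
      exact hE
    · rw [ht] at ht'; cases ht'
  · intro h
    rcases eTop_spec l ⟨c.i, c.k, c.j, c.p, c.q⟩ c.r c.i_le_k c.i_le_j c.k_le c.j_le c.p_le_j
      c.p_le_q c.q_le with ⟨t, ht, hE⟩ | ⟨ht, hE, hl⟩
    · refine ⟨c.i, c.k, c.j, c.p, c.q, c.r, t, c.p_le_j, c.p_le_q, c.q_le, c.r_le, ht,
        c.aElt_eq, ?_⟩
      have h1 := ETarget.functional c.inCone h hE
      simp only [toZ, ALabel.toZ, ZLabel.mk.injEq, Nat.cast_inj] at h1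
      obtain ⟨e1, e2, e3, e4, e5, e6⟩ := h1
      rw [← e1, ← e2, ← e3, ← e4, ← e5, ← e6]
      exact c'.aElt_eq
    · have hE' : ETarget c.toZ ⟨c.i, c.k, c.j + 1, c.p + 1, c.q + 1, c.r⟩ :=
        ⟨rfl, Or.inr (Or.inl ⟨hE, rfl, rfl, rfl, rfl, rfl⟩)⟩
      have h1 := ETarget.functional c.inCone h hE'
      simp only [toZ, ZLabel.mk.injEq] at h1
      have := c'.j_le
      dsimp only at hl
      omega

end ALab

theorem psi_inCone {x0 y1 z u v w : ℤ} (h0 : 0 ≤ x0) (h1 : 0 ≤ y1) (h : z ≤ y1) :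
    (psi x0 y1 z u v w).InCone where
  i_nonneg := psi_i_nonneg h h1
  i_le_k := psi_i_le_k h0
  i_le_j := psi_i_le_j h0
  p_nonneg := psi_p_nonneg h h1
  p_le_j := psi_p_le_j h0
  p_le_q := psi_p_le_q h0
  q_le := psi_q_le h h1
  r_nonneg := psi_r_nonneg h0
  r_le := psi_r_le h0

/-- The action of `f₁` on labels with integral entries. -/
def ZLabel.F1 (c c' : ZLabel) : Prop :=
  c'.i = c.i ∧ c'.k = c.k ∧ c'.j = c.j ∧
    (c.q < c.p + c.r ∧ c'.p = c.p + 1 ∧ c'.q = c.q + 1 ∧ c'.r = c.r - 1 ∨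
      c.p + c.r ≤ c.q ∧ c'.p = c.p ∧ c'.q = c.q + 1 ∧ c'.r = c.r)

theorem ALab.f1_toZ_iff {l : ℕ} {c c' : ALab l} : c.toZ.F1 c'.toZ ↔ c.F1 c' := by
  unfold ALab.F1 ZLabel.F1 ALab.toZ
  dsimp only
  omega

section psi

variable {z u v w : ℤ}

theorem psi_f1_last (x0 y1 : ℤ) (h1 : v ≤ 0) (h2 : v ≤ u) :
    ZLabel.F1 (psi x0 (y1 - 1) (z - 1) u (v - 1) w) (psi x0 y1 z u v w) := by
  have e1 := tropP_last (z := z) (w := w) h1 h2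
  have e2 := tropQ_last (z := z) (w := w) h1 h2
  have e3 := tropN_last (z := z) (w := w) h1 h2
  unfold ZLabel.F1 psi
  simp only [e1, e2, e3]
  rcases lt_or_ge (tropP z u v w) (tropQ z u v w + (2 * z - v + u + w)) with hc | hc
  · rw [tropM_last_of_lt h1 h2 hc]
    exact ⟨by ring, by ring, by ring, Or.inr ⟨by linarith, by ring, by ring, by ring⟩⟩
  · rw [tropM_last_of_le h1 hc]
    exact ⟨by ring, by ring, by ring, Or.inl ⟨by linarith, by ring, by ring, by ring⟩⟩

theorem psi_f1_mid (x0 y1 : ℤ) (h1 : 0 < v) (h2 : 0 ≤ u) :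
    ZLabel.F1 (psi x0 y1 z (u + 1) (v - 1) (w - 3)) (psi x0 y1 z u v w) := by
  have e1 := tropP_mid (z := z) (w := w) h1 h2
  have e2 := tropQ_mid (z := z) (w := w) h1 h2
  have e3 := tropN_mid (z := z) (w := w) h1 h2
  unfold ZLabel.F1 psi
  simp only [e1, e2, e3]
  rcases lt_or_ge (tropP z u v w) (tropQ z u v w + (2 * z - v + u + w)) with hc | hc
  · rw [tropM_mid_of_lt h1 h2 hc]
    exact ⟨by ring, by ring, by ring, Or.inr ⟨by linarith, by ring, by ring, by ring⟩⟩
  · rw [tropM_mid_of_le h1 h2 hc]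
    exact ⟨by ring, by ring, by ring, Or.inl ⟨by linarith, by ring, by ring, by ring⟩⟩

theorem psi_f1_first (x0 y1 : ℤ) (h1 : u < 0) (h2 : u < v) :
    ZLabel.F1 (psi x0 y1 (z - 1) (u + 1) v w) (psi x0 y1 z u v w) := by
  have e1 := tropP_first (z := z) (w := w) h1 h2
  have e2 := tropQ_first (z := z) (w := w) h1 h2
  have e3 := tropN_first (z := z) (w := w) h1 h2
  unfold ZLabel.F1 psi
  simp only [e1, e2, e3]
  rcases lt_or_ge (tropP z u v w) (tropQ z u v w + (2 * z - v + u + w)) with hc | hc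
  · rw [tropM_first_of_lt h1 hc]
    exact ⟨by ring, by ring, by ring, Or.inr ⟨by linarith, by ring, by ring, by ring⟩⟩
  · rw [tropM_first_of_le h1 h2 hc]
    exact ⟨by ring, by ring, by ring, Or.inl ⟨by linarith, by ring, by ring, by ring⟩⟩

end psi

/-- The lengths of the `1`-strings match: the left side is `max p (q - r) + tropM z u v w - y₁`
for the label `(i, k, j, p, q, r)` that is the image of the point under `psi`. -/
theorem trop_factor (z u v w : ℤ) :
    max (tropP z u v w) (tropQ z u v w + (2 * z - v + u + w)) =
      tropM z u v w + max (v + max (-u) 0) 0 := by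
  obtain ⟨hM, cM⟩ := tropM_spec z u v w
  obtain ⟨hP, cP⟩ := tropP_spec z u v w
  obtain ⟨hQ, cQ⟩ := tropQ_spec z u v w
  apply le_antisymm
  · clear cM
    apply max_le
    · clear cQ hQ hP
      rcases cP with h | h | h | h | h | h | h <;> omega
    · clear cP hP hQ
      rcases cQ with h | h | h | h | h | h | h <;> omega
  · clear cP cQ
    have hX : max (v + max (-u) 0) 0 = 0 ∨ max (v + max (-u) 0) 0 = v ∨
      max (v + max (-u) 0) 0 = v - u := by omega
    rcases hX with hX | hX | hX <;> rw [hX] <;>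
      rcases cM with h | h | h | h | h | h <;> omega

namespace GPt

variable {l : ℕ}

/-- The image of a point under `psi`. -/
def psiZ (x : GPt l) : ZLabel := psi x.x0 x.y1 (x.y1 - x.x1) x.u x.v x.w

theorem exists_toZ_eq_psiZ (x : GPt l) : ∃ c : ALab l, c.toZ = x.psiZ := by
  have := x.hu
  have := x.hv
  have := x.hw
  have hl := x.hl
  have h1 := psi_k_le (x0 := x.x0) (y1 := x.y1) (z := x.y1 - x.x1) (u := x.u) (v := x.v) (w := x.w)
    (A := x.a2) (by omega) (by omega) (by omega) (by omega)
  have h2 := psi_j_le (x0 := x.x0) (y1 := x.y1) (z := x.y1 - x.x1) (u := x.u) (v := x.v) (w := x.w)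
    (A := x.a2) (by omega) (by omega) (by omega) (by omega)
  refine ALab.exists_toZ_eq (psi_inCone (by omega) (by omega) (by omega)) ?_ ?_
  · exact h1.trans (by omega)
  · exact h2.trans (by omega)

/-- The label of the element of `𝒜` that corresponds to the element of `𝒢^l` with coordinates `x`.
-/
noncomputable def lab (x : GPt l) : ALab l := x.exists_toZ_eq_psiZ.choose

theorem toZ_lab (x : GPt l) : x.lab.toZ = x.psiZ := x.exists_toZ_eq_psiZ.choose_spec

theorem lab_cast (x : GPt l) : (x.lab.i : ℤ) = x.psiZ.i ∧ (x.lab.k : ℤ) = x.psiZ.k ∧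
    (x.lab.j : ℤ) = x.psiZ.j ∧ (x.lab.p : ℤ) = x.psiZ.p ∧ (x.lab.q : ℤ) = x.psiZ.q ∧
    (x.lab.r : ℤ) = x.psiZ.r := by
  rw [← toZ_lab]
  exact ⟨rfl, rfl, rfl, rfl, rfl, rfl⟩

theorem E1.lab_F1 {x x' : GPt l} (h : x.E1 x') : x'.lab.F1 x.lab := by
  rw [← ALab.f1_toZ_iff, toZ_lab, toZ_lab, psiZ, psiZ, h.1]
  rcases h.2 with ⟨g, hx, -, -, -, -, hy, hu, hv, hw⟩ | ⟨g, hx, -, -, -, -, hy, hu, hv, hw⟩ |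
    ⟨g, hx, -, -, -, -, hy, hu, hv, hw⟩
  · rw [hu, hv, hw, show (x'.y1 : ℤ) - x'.x1 = x.y1 - x.x1 - 1 by omega,
      show (x'.y1 : ℤ) = x.y1 - 1 by omega]
    exact psi_f1_last _ _ g.1 g.2
  · rw [hu, hv, hw, hx, hy]
    exact psi_f1_mid _ _ g.1 g.2
  · rw [hu, hv, hw, show (x'.y1 : ℤ) - x'.x1 = x.y1 - x.x1 - 1 by omega, hy]
    exact psi_f1_first _ _ g.1 g.2

theorem E2.lab_eTarget {x x' : GPt l} (h : x.E2 x') : ETarget x.lab.toZ x'.lab.toZ := by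
  rw [toZ_lab, toZ_lab, psiZ, psiZ]
  obtain ⟨⟨h0, h1, h2, hw⟩, ⟨g, -, -, -, -, hu, hv⟩ | ⟨g, -, -, -, -, hu, hv⟩⟩ := h
  · rw [h0, h1, h2, hu, hv, hw]
    exact eTarget_psi_of_nonneg g _ _
  · rw [h0, h1, h2, hu, hv, hw]
    exact eTarget_psi_of_neg g _ _

theorem eps_one_lab (x : GPt l) :
    max x.lab.p (x.lab.q - x.lab.r) = x.y1 + (x.v + max (-x.u) 0).toNat := by
  have h1 := x.lab_cast
  have h2 := trop_factor (x.y1 - x.x1) x.u x.v x.w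
  simp only [psiZ, psi] at h1
  omega

theorem wt_one_lab (x : GPt l) : (x.lab.k : ℤ) - 2 * x.lab.q + x.lab.p + x.lab.r =
    x.x1 - x.y1 + x.u - x.v := by
  have h1 := x.lab_cast
  simp only [psiZ, psi] at h1
  omega

theorem wt_zero_lab (x : GPt l) : (x.lab.j : ℤ) + x.lab.q - 2 * x.lab.p - 2 * x.lab.r =
    - 2 * (x.x1 - x.y1 + x.u - x.v) - (x.a2 - x.d2 + x.w) := by
  have h1 := x.lab_cast
  have := x.hu
  have := x.hv
  have := x.hw
  simp only [psiZ, psi] at h1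
  omega

end GPt

end

/-! ### Bijectivity of the piecewise linear map -/

namespace ALab

variable {l : ℕ}

theorem F1.injective {c c' d : ALab l} (h : c.F1 d) (h' : c'.F1 d) : c = c' := by
  unfold F1 at h h'
  ext <;> omega

/-- `E` leads out of the cone of labels only by raising `j` beyond `l - i`. -/
theorem exists_eTarget (c : ALab l) : (∃ c' : ALab l, ETarget c.toZ c'.toZ) ∨
    ERaisesJ c.i c.k c.j c.p c.q ∧ l ≤ c.i + c.j := by
  have key : (∃ b, ETarget c.toZ b ∧ b.i + b.k ≤ l ∧ b.i + b.j ≤ l) ∨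
      ERaisesJ c.i c.k c.j c.p c.q ∧ l ≤ c.i + c.j := by
    have h1 := c.k_le
    have h2 := c.j_le
    by_cases hJ : ERaisesJ c.i c.k c.j c.p c.q ∧ l ≤ c.i + c.j
    · exact Or.inr hJ
    refine Or.inl ?_
    have hE : ∃ b, ETarget c.toZ b := by
      rcases eTop_spec l ⟨c.i, c.k, c.j, c.p, c.q⟩ c.r c.i_le_k c.i_le_j c.k_le c.j_le c.p_le_j
        c.p_le_q c.q_le with ⟨t, -, hE⟩ | ⟨-, h⟩
      · exact ⟨_, hE⟩
      · exact absurd h hJ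
    obtain ⟨b, hb⟩ := hE
    refine ⟨b, hb, ?_⟩
    rcases hb.2 with ⟨g, e1, e2, e3, -⟩ | ⟨g, e1, e2, e3, -⟩ | ⟨g, e1, e2, e3, -⟩ |
      ⟨g, e1, e2, e3, -⟩ | ⟨g, e1, e2, e3, -⟩ <;>
      simp only [toZ] at e1 e2 e3 g
    · omega
    · have : ¬ l ≤ c.i + c.j := fun h => hJ ⟨g, h⟩
      omega
    · have := g.2.1
      omega
    · have := g.2.1
      omega
    · have := g.2.2.1
      omega
  refine key.imp_left ?_
  rintro ⟨b, hb, h1, h2⟩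
  obtain ⟨c', rfl⟩ := exists_toZ_eq (ETarget.inCone c.inCone hb) h1 h2
  exact ⟨c', hb⟩

/-- A function that decreases along `e₁` and `E`. -/
def depth (c : ALab l) : ℕ := (5 * l + c.k + c.q + 3 * c.j - 5 * c.p - 5 * c.r : ℤ).toNat

theorem F1.depth_lt {c c' : ALab l} (h : c'.F1 c) : c'.depth < c.depth := by
  obtain ⟨i, k, j, p, q, r, h1, h2, h3, h4, h5, h6, h7, h8⟩ := c'
  unfold F1 at h
  unfold depth
  dsimp only at *
  omega

theorem depth_lt_of_eTarget {c c' : ALab l} (h : ETarget c.toZ c'.toZ) : c'.depth < c.depth := by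
  obtain ⟨i, k, j, p, q, r, h1, h2, h3, h4, h5, h6, h7, h8⟩ := c'
  obtain ⟨hr, h⟩ := h
  unfold depth
  rcases h with ⟨-, h⟩ | ⟨-, h⟩ | ⟨-, h⟩ | ⟨-, h⟩ | ⟨-, h⟩ <;>
    simp only [toZ] at h hr ⊢ <;> omega

/-- A label on which neither `e₁` nor `E` is defined. -/
theorem eq_top_of_not (c : ALab l) (h1 : ¬∃ c', F1 c' c)
    (h2 : ¬∃ c' : ALab l, ETarget c.toZ c'.toZ) :
    c.i = 0 ∧ c.k = l ∧ c.j = l ∧ c.p = 0 ∧ c.q = l ∧ l ≤ c.r ∧ c.r ≤ 2 * l := by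
  have h1' := mt c.exists_F1_inv h1
  obtain ⟨h3, h4⟩ := c.exists_eTarget.resolve_left h2
  obtain ⟨i, k, j, p, q, r, a1, a2, a3, a4, a5, a6, a7, a8⟩ := c
  unfold ERaisesJ EFree EStuck at h3
  dsimp only at *
  omega

end ALab

namespace GPt

variable {l : ℕ}

/-- `e₂` is defined wherever `E` is. -/
theorem exists_E2_of_eTarget (x : GPt l) {c : ALab l} (h : ETarget x.lab.toZ c.toZ) :
    ∃ x', x.E2 x' ∧ x'.lab = c := by
  have hE : ∃ x', x.E2 x' := by
    by_contra hn
    have h0 := mt x.exists_E2 hn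
    have h1 := eTarget_psi_of_nonneg (z := x.y1 - x.x1) (u := x.u) (v := x.v) (w := x.w)
      (by omega) x.x0 x.y1
    rw [toZ_lab, psiZ] at h
    have hc : (psi x.x0 x.y1 (x.y1 - x.x1) x.u x.v x.w).InCone :=
      psi_inCone (by omega) (by omega) (by omega)
    have h2 := ETarget.functional hc h h1
    have := x.hu
    have := x.hv
    have := x.hw
    have := x.hl
    -- the image would have `d₂ = -1`, hence lie outside of the range of `j`
    have h3 := psi_j_gt (x0 := x.x0) (y1 := x.y1) (z := x.y1 - x.x1) (u := x.u) (v := x.v + 1)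
      (w := x.w + 1) (A := x.a2) (by omega) (by omega) (by omega)
    rw [← h2] at h3
    have := c.j_le
    simp only [ALab.toZ] at h3
    omega
  obtain ⟨x', hx⟩ := hE
  exact ⟨x', hx, ALab.toZ_injective (ETarget.functional x.lab.inCone hx.lab_eTarget h)⟩

/-- `f₂` is defined wherever `F` is. -/
theorem exists_E2_inv_of_eTarget (x : GPt l) {c : ALab l} (h : ETarget c.toZ x.lab.toZ) :
    ∃ y : GPt l, y.E2 x ∧ y.lab = c := by
  have hE : ∃ y : GPt l, y.E2 x := by
    by_contra hn
    have h0 := mt x.exists_E2_inv hn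
    have h1 := eTarget_psi_of_neg (z := x.y1 - x.x1) (u := x.u + 1) (v := x.v) (w := x.w - 1)
      (by omega) x.x0 x.y1
    rw [add_sub_cancel_right, sub_add_cancel] at h1
    rw [toZ_lab, psiZ] at h
    have hc : (psi x.x0 x.y1 (x.y1 - x.x1) (x.u + 1) x.v (x.w - 1)).InCone :=
      psi_inCone (by omega) (by omega) (by omega)
    have h2 := ETarget.injective c.inCone hc h h1
    have := x.hu
    have := x.hv
    have := x.hw
    have := x.hl
    -- the preimage would have `a₂ = -1`, hence lie outside of the range of `k`
    have h3 := psi_k_gt (x0 := x.x0) (y1 := x.y1) (z := x.y1 - x.x1) (u := x.u + 1) (v := x.v)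
      (w := x.w - 1) (A := -1) (by omega) (by omega) (by omega)
    rw [← h2] at h3
    have := c.k_le
    simp only [ALab.toZ] at h3
    omega
  obtain ⟨y, hy⟩ := hE
  exact ⟨y, hy, ALab.toZ_injective (ETarget.injective y.lab.inCone c.inCone hy.lab_eTarget h)⟩

theorem exists_E1_of_F1 (x : GPt l) {c : ALab l} (h : c.F1 x.lab) :
    ∃ x', x.E1 x' ∧ x'.lab = c := by
  have h1 := x.eps_one_lab
  have h2 : 0 < max x.lab.p (x.lab.q - x.lab.r) := by
    have h3 := c.p_le_q
    unfold ALab.F1 at h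
    omega
  obtain ⟨x', hx⟩ := x.exists_E1 (by omega)
  exact ⟨x', hx, hx.lab_F1.injective h⟩

theorem exists_E1_inv_of_F1 (x : GPt l) {c : ALab l} (h : x.lab.F1 c) :
    ∃ y : GPt l, y.E1 x ∧ y.lab = c := by
  have h1 := x.eps_one_lab
  have h2 := x.wt_one_lab
  have h3 : 0 < (max x.lab.p (x.lab.q - x.lab.r) : ℤ) +
      (x.lab.k - 2 * x.lab.q + x.lab.p + x.lab.r) := by
    have h3 := c.q_le
    unfold ALab.F1 at h
    omega
  obtain ⟨y, hy⟩ := x.exists_E1_inv (by omega)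
  refine ⟨y, hy, ?_⟩
  have := hy.lab_F1
  unfold ALab.F1 at h this
  ext <;> omega

theorem lab_of_eq_zero {x : GPt l} (hy : x.y1 = 0) (hu : x.u = 0) (hv : x.v = 0) (hw : x.w = 0)
    (h : x.x0 + x.x1 = l) :
    x.lab.i = 0 ∧ x.lab.k = l ∧ x.lab.j = l ∧ x.lab.p = 0 ∧ x.lab.q = l ∧
      x.lab.r = l + x.x1 := by
  have h3 := x.lab_cast
  have hM : tropM (-x.x1) 0 0 0 = 0 := by unfold tropM; omega
  have hP : tropP (-x.x1) 0 0 0 = 0 := by unfold tropP; omega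
  have hQ : tropQ (-x.x1) 0 0 0 = x.x1 := by unfold tropQ; omega
  have hN : tropN (-x.x1) 0 0 0 = x.x1 := by unfold tropN; omega
  simp only [psiZ, psi, hy, hu, hv, hw, Nat.cast_zero, zero_sub, hM, hP, hQ, hN] at h3
  omega

theorem lab_top {x : GPt l} (h1 : ¬∃ x', x.E1 x') (h2 : ¬∃ x', x.E2 x') :
    x.lab.i = 0 ∧ x.lab.k = l ∧ x.lab.j = l ∧ x.lab.p = 0 ∧ x.lab.q = l ∧
      x.lab.r = l + x.x1 := by
  obtain ⟨e1, e2, e3, e4, e5, e6, e7, e8, e9⟩ := x.eq_top_of_not h1 h2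
  exact lab_of_eq_zero e5 e6 e7 e8 e9

theorem lab_injective : Function.Injective (lab (l := l)) := by
  intro x
  induction x using raise_induction with
  | top x h1 h2 =>
    intro y h
    have h1' : ¬∃ y', y.E1 y' := by
      rintro ⟨y', hy⟩
      have hy := hy.lab_F1
      rw [← h] at hy
      obtain ⟨x', hx, -⟩ := x.exists_E1_of_F1 hy
      exact h1 ⟨x', hx⟩
    have h2' : ¬∃ y', y.E2 y' := by
      rintro ⟨y', hy⟩
      have hy := hy.lab_eTarget
      rw [← h] at hy
      obtain ⟨x', hx, -⟩ := x.exists_E2_of_eTarget hy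
      exact h2 ⟨x', hx⟩
    have e1 := lab_top h1 h2
    have e2 := lab_top h1' h2'
    have e3 := x.eq_top_of_not h1 h2
    have e4 := y.eq_top_of_not h1' h2'
    rw [h] at e1
    ext <;> omega
  | e1 x x' hx ih =>
    intro y h
    have hx' := hx.lab_F1
    rw [h] at hx'
    obtain ⟨y', hy, hl⟩ := y.exists_E1_of_F1 hx'
    obtain rfl := ih hl.symm
    exact hx.injective hy
  | e2 x x' hx ih =>
    intro y h
    have hx' := hx.lab_eTarget
    rw [h] at hx'
    obtain ⟨y', hy, hl⟩ := y.exists_E2_of_eTarget hx'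
    obtain rfl := ih hl.symm
    exact hx.injective hy

theorem lab_surjective : Function.Surjective (lab (l := l)) := by
  intro c
  induction hn : c.depth using Nat.strong_induction_on generalizing c with
  | _ n ih =>
    subst hn
    by_cases h1 : ∃ c' : ALab l, c'.F1 c
    · obtain ⟨c', h⟩ := h1
      obtain ⟨x, rfl⟩ := ih _ h.depth_lt c' rfl
      obtain ⟨y, -, hy⟩ := x.exists_E1_inv_of_F1 h
      exact ⟨y, hy⟩
    by_cases h2 : ∃ c' : ALab l, ETarget c.toZ c'.toZ
    · obtain ⟨c', h⟩ := h2
      obtain ⟨x, rfl⟩ := ih _ (ALab.depth_lt_of_eTarget h) c' rfl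
      obtain ⟨y, -, hy⟩ := x.exists_E2_inv_of_eTarget h
      exact ⟨y, hy⟩
    have h3 := c.eq_top_of_not h1 h2
    let x : GPt l := ⟨2 * l - c.r, c.r - l, 0, 0, 0, 0, 0, 0, 0, 0, by simp, by simp, by simp,
      by push_cast; omega⟩
    refine ⟨x, ?_⟩
    have h4 := lab_of_eq_zero (x := x) rfl rfl rfl rfl (by dsimp only [x]; omega)
    have h5 : x.x1 = c.r - l := rfl
    ext <;> omega

theorem f1_lab_iff {x x' : GPt l} : x'.lab.F1 x.lab ↔ x.E1 x' := by
  refine ⟨fun h => ?_, fun h => h.lab_F1⟩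
  obtain ⟨y, hy, e⟩ := x.exists_E1_of_F1 h
  rwa [lab_injective e] at hy

theorem eTarget_lab_iff {x x' : GPt l} : ETarget x.lab.toZ x'.lab.toZ ↔ x.E2 x' := by
  refine ⟨fun h => ?_, fun h => h.lab_eTarget⟩
  obtain ⟨y, hy, e⟩ := x.exists_E2_of_eTarget h
  rwa [lab_injective e] at hy

end GPt

/-! ### The rows of the elements killed by `F` and `e₁` -/

section

open CrystalData GLetter

section rows

theorem rgtWord_add_of_lt (c : ℕ) {s : ℕ} (hs : s < 6) (d : ℕ) :
    rgtWord (6 * c + s) d = List.replicate c c6 ++ rgtWord s d := by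
  rw [rgtWord, rgtWord, show (6 * c + s) / 6 = c by omega, show s / 6 = 0 by omega]
  simp

theorem lftWord_zero_left (t : ℕ) : lftWord 0 (6 * t) = List.replicate t b6 := by
  rw [lftWord, show 6 * t / 6 = t by omega]
  simp

theorem replicate_append_rowC_even (y c : ℕ) : List.replicate y b6 ++ rowC (2 * c) =
    List.replicate (y + c) b6 ++ List.replicate c c6 := by
  rw [rowC, show 2 * c / 2 = c by omega, show 2 * c % 2 = 0 by omega,
    ← List.replicate_append_replicate]
  simp only [List.replicate_zero, List.append_nil, List.append_assoc]

theorem replicate_append_rowC_odd (y c : ℕ) : List.replicate y b6 ++ rowC (2 * c + 1) =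
    List.replicate (y + c) b6 ++ z1 :: List.replicate c c6 := by
  rw [rowC, show (2 * c + 1) / 2 = c by omega, show (2 * c + 1) % 2 = 1 by omega,
    ← List.replicate_append_replicate]
  simp only [List.replicate_one, List.append_assoc, List.singleton_append]

/-- The core of a row without the letters `2, 3, 4` and `1̄`. -/
theorem coreWord_eq_rowC (y m : ℕ) {s : ℕ} (hs : s < 6) (_ : s % 2 = 0) (d : ℕ) :
    coreWord 0 (6 * y + 3 * m) (3 * m + s) d = List.replicate y b6 ++ rowC m ++ rgtWord s d := by
  obtain ⟨c, rfl | rfl⟩ : ∃ c, m = 2 * c ∨ m = 2 * c + 1 := ⟨m / 2, by omega⟩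
  · rw [replicate_append_rowC_even, show 6 * y + 3 * (2 * c) = 6 * (y + c) by ring,
      show 3 * (2 * c) + s = 6 * c + s by ring, coreWord_even _ _ (by omega), lftWord_zero_left,
      rgtWord_add_of_lt c hs, List.append_assoc]
  · rw [replicate_append_rowC_odd, show 6 * y + 3 * (2 * c + 1) = 6 * (y + c) + 3 by ring,
      show 3 * (2 * c + 1) + s = 6 * c + s + 3 by ring, coreWord_z1 _ _ _ (by omega),
      lftWord_zero_left, rgtWord_add_of_lt c hs, List.append_assoc, List.cons_append]

theorem rgtWord_zero (t : ℕ) : rgtWord 0 (3 * t) = List.replicate t c2 := by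
  rw [rgtWord, show 3 * t / 3 = t by omega, show 3 * t % 3 = 0 by omega]
  simp

theorem rgtWord_four (t : ℕ) : rgtWord 4 (3 * t + 1) = c4 :: List.replicate t c2 := by
  rw [rgtWord, show (3 * t + 1) / 3 = t by omega, show (3 * t + 1) % 3 = 1 by omega]
  simp

theorem rgtWord_two (t : ℕ) : rgtWord 2 (3 * t + 2) = c3 :: List.replicate t c2 := by
  rw [rgtWord, show (3 * t + 2) / 3 = t by omega, show (3 * t + 2) % 3 = 2 by omega]
  simp

theorem coreWord_rowC_zero (y m t : ℕ) : coreWord 0 (6 * y + 3 * m) (3 * m) (3 * t) =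
    List.replicate y b6 ++ rowC m ++ List.replicate t c2 := by
  rw [← rgtWord_zero, ← coreWord_eq_rowC y m (by omega) (by omega), add_zero]

theorem coreWord_rowC_four (y m t : ℕ) : coreWord 0 (6 * y + 3 * m) (3 * m + 4) (3 * t + 1) =
    List.replicate y b6 ++ rowC m ++ c4 :: List.replicate t c2 := by
  rw [← rgtWord_four, ← coreWord_eq_rowC y m (by omega) (by omega)]

theorem coreWord_rowC_two (y m t : ℕ) : coreWord 0 (6 * y + 3 * m) (3 * m + 2) (3 * t + 2) =
    List.replicate y b6 ++ rowC m ++ c3 :: List.replicate t c2 := by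
  rw [← rgtWord_two, ← coreWord_eq_rowC y m (by omega) (by omega)]

theorem coreWord_c5_of_zero (s t : ℕ) : coreWord 0 (6 * s + 3) 1 (3 * t + 1) =
    List.replicate s b6 ++ c5 :: List.replicate t c2 := by
  rw [coreWord_c5 _ _ (by omega), lftWord_zero_left, rgtWord_zero]

end rows

namespace GPt

variable {l : ℕ}

/-- The row of the element `f₀^p b` for `p ≤ i`, where `b` is labelled `(i, l - i, j)`. -/
theorem exists_row_of_le {i j p : ℕ} (hij : i ≤ j) (hl : i + j ≤ l) (hp : p ≤ i) :
    ∃ x : GPt l, x.word = phiRow l i j p ∧ x.lab.i = i ∧ x.lab.k = l - i ∧ x.lab.j = j ∧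
      x.lab.p = 0 ∧ x.lab.q = 0 ∧ x.lab.r = p := by
  obtain ⟨n, hn⟩ : ∃ n, l - i - j = n := ⟨_, rfl⟩
  let x : GPt l := ⟨0, p, 0, 3 * (n + (i - p)), n + 3 * (i - p), n + 3 * j, 0, n + i - p,
    i - p - j, -n, by push_cast; omega, by push_cast; omega, by push_cast; omega,
    by push_cast; omega⟩
  refine ⟨x, ?_, ?_⟩
  · rw [phiRow, if_pos hp, hn]
    change List.replicate p b1 ++ (coreWord 0 (3 * (n + (i - p))) (n + 3 * (i - p)) (n + 3 * j) ++
      List.replicate 0 c1) = _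
    rw [List.replicate_zero, List.append_nil]
    obtain ⟨y, hy⟩ : ∃ y, n / 3 = y := ⟨_, rfl⟩
    simp only [hy]
    split_ifs with h0 h1 h2
    · rw [show 3 * (n + (i - p)) = 6 * y + 3 * (y + i - p) by omega,
        show n + 3 * (i - p) = 3 * (y + i - p) by omega, show n + 3 * j = 3 * (y + j) by omega,
        coreWord_rowC_zero]
      simp only [List.append_assoc]
    · rw [show 3 * (n + (i - p)) = 6 * (y + 1) + 3 * (y + i - p - 1) by omega,
        show n + 3 * (i - p) = 3 * (y + i - p - 1) + 4 by omega,
        show n + 3 * j = 3 * (y + j) + 1 by omega, coreWord_rowC_four]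
      simp only [List.append_assoc, List.singleton_append]
    · rw [show 3 * (n + (i - p)) = 6 * 0 + 3 by omega, show n + 3 * (i - p) = 1 by omega,
        show n + 3 * j = 3 * j + 1 by omega, coreWord_c5_of_zero, show p = i by omega]
      simp only [List.append_assoc, List.singleton_append, List.replicate_zero, List.nil_append]
    · rw [show 3 * (n + (i - p)) = 6 * (y + 1) + 3 * (y + i - p) by omega,
        show n + 3 * (i - p) = 3 * (y + i - p) + 2 by omega,
        show n + 3 * j = 3 * (y + j) + 2 by omega, coreWord_rowC_two]
      simp only [List.append_assoc, List.singleton_append]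
  · have h := x.lab_cast
    have hM : tropM (-p) (n + i - p) (i - p - j) (-n) = j - p := by unfold tropM; omega
    have hP : tropP (-p) (n + i - p) (i - p - j) (-n) = j - p := by unfold tropP; omega
    have hQ : tropQ (-p) (n + i - p) (i - p - j) (-n) = 0 := by unfold tropQ; omega
    have hN : tropN (-p) (n + i - p) (i - p - j) (-n) = j - p - i := by unfold tropN; omega
    simp only [psiZ, psi, x, Nat.cast_zero, zero_sub, hM, hP, hQ, hN] at h
    dsimp only [x]
    omega

/-- The row of the element `f₀^p b` for `i ≤ p`, where `b` is labelled `(i, l - i, j)`. -/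
theorem exists_row_of_lt {i j p : ℕ} (hij : i ≤ j) (hl : i + j ≤ l) (hp : i < p) (hpj : p ≤ j) :
    ∃ x : GPt l, x.word = phiRow l i j p ∧ x.lab.i = i ∧ x.lab.k = l - i ∧ x.lab.j = j ∧
      x.lab.p = 0 ∧ x.lab.q = 0 ∧ x.lab.r = p := by
  obtain ⟨n, hn⟩ : ∃ n, l - i - j = n := ⟨_, rfl⟩
  let x : GPt l := ⟨0, i, 0, 3 * n + 6 * (p - i), n, n + 3 * (j + i - p), 0, n + 2 * p - 2 * i,
    p - i - j, 3 * i - 3 * p - n, by push_cast; omega, by push_cast; omega, by push_cast; omega,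
    by push_cast; omega⟩
  refine ⟨x, ?_, ?_⟩
  · rw [phiRow, if_neg (by omega), hn]
    change List.replicate i b1 ++ (coreWord 0 (3 * n + 6 * (p - i)) n (n + 3 * (j + i - p)) ++
      List.replicate 0 c1) = _
    rw [List.replicate_zero, List.append_nil]
    obtain ⟨y, hy⟩ : ∃ y, n / 3 = y := ⟨_, rfl⟩
    simp only [hy]
    split_ifs with h0 h1 h2
    · have e1 : coreWord 0 (3 * n + 6 * (p - i)) n (n + 3 * (j + i - p)) =
          coreWord 0 (6 * (p - i + y) + 3 * y) (3 * y) (3 * (y + j + i - p)) := by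
        congr 1 <;> omega
      rw [e1, coreWord_rowC_zero]
      simp only [List.append_assoc]
    · have e1 : coreWord 0 (3 * n + 6 * (p - i)) n (n + 3 * (j + i - p)) =
          coreWord 0 (6 * (p - i + y + 1) + 3 * (y - 1)) (3 * (y - 1) + 4)
            (3 * (y + j + i - p) + 1) := by
        congr 1 <;> omega
      rw [e1, coreWord_rowC_four]
      simp only [List.append_assoc, List.singleton_append]
    · have e1 : coreWord 0 (3 * n + 6 * (p - i)) n (n + 3 * (j + i - p)) =
          coreWord 0 (6 * (p - i) + 3) 1 (3 * (j + i - p) + 1) := by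
        congr 1 <;> omega
      rw [e1, coreWord_c5_of_zero]
      simp only [List.append_assoc, List.singleton_append]
    · have e1 : coreWord 0 (3 * n + 6 * (p - i)) n (n + 3 * (j + i - p)) =
          coreWord 0 (6 * (p - i + y + 1) + 3 * y) (3 * y + 2) (3 * (y + j + i - p) + 2) := by
        congr 1 <;> omega
      rw [e1, coreWord_rowC_two]
      simp only [List.append_assoc, List.singleton_append]
  · have h := x.lab_cast
    have hM : tropM (-i) (n + 2 * p - 2 * i) (p - i - j) (3 * i - 3 * p - n) = j - p := by
      unfold tropM; omega
    have hP : tropP (-i) (n + 2 * p - 2 * i) (p - i - j) (3 * i - 3 * p - n) = j - p := by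
      unfold tropP; omega
    have hQ : tropQ (-i) (n + 2 * p - 2 * i) (p - i - j) (3 * i - 3 * p - n) = 0 := by
      unfold tropQ; omega
    have hN : tropN (-i) (n + 2 * p - 2 * i) (p - i - j) (3 * i - 3 * p - n) = j - i - p := by
      unfold tropN; omega
    simp only [psiZ, psi, x, Nat.cast_zero, zero_sub, hM, hP, hQ, hN] at h
    dsimp only [x]
    omega

end GPt

end

open CrystalData

/-! ### The operators `E`, `F` and the bijection `Φ` -/

theorem partialMap_eq_some_iff {B : Type} {R : B → B → Prop}
    (hR : ∀ b c c', R b c → R b c' → c = c') {b c : B} : partialMap R b = some c ↔ R b c := by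
  unfold partialMap
  split_ifs with h
  · refine ⟨fun e => ?_, fun hc => congrArg some (hR _ _ _ h.choose_spec hc)⟩
    rw [← Option.some.inj e]
    exact h.choose_spec
  · exact ⟨fun e => by simp at e, fun hc => (h ⟨c, hc⟩).elim⟩

/-- Two partial maps match under a bijection as soon as their graphs do. -/
theorem eq_map_of_graph {B B' : Type} (Φ : B ≃ B') {g : B → Option B} {g' : B' → Option B'}
    {b : B} (h : ∀ b', g' (Φ b) = some (Φ b') ↔ g b = some b') : g' (Φ b) = (g b).map Φ := by
  ext c
  obtain ⟨b', rfl⟩ := Φ.surjective c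
  rw [h, Option.map_eq_some_iff]
  simp

theorem graph_of_eq_map {B B' : Type} (Φ : B ≃ B') {g : B → Option B} {g' : B' → Option B'}
    {b : B} (h : g' (Φ b) = (g b).map Φ) (b' : B) : g' (Φ b) = some (Φ b') ↔ g b = some b' := by
  rw [h, Option.map_eq_some_iff]
  simp

theorem opIter_map {B B' : Type} (Φ : B → B') {g : B → Option B} {g' : B' → Option B'}
    (h : ∀ b, g' (Φ b) = (g b).map Φ) (n : ℕ) (b : B) :
    opIter g' n (Φ b) = (opIter g n b).map Φ := by
  induction n with
  | zero => rfl
  | succ n ih =>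
    rw [opIter, opIter, ih]
    cases opIter g n b with
    | none => rfl
    | some c => exact h c

theorem setOf_opIter_map {B B' : Type} (Φ : B → B') {g : B → Option B} {g' : B' → Option B'}
    (h : ∀ b, g' (Φ b) = (g b).map Φ) (b : B) :
    {n | opIter g' n (Φ b) ≠ none} = {n | opIter g n b ≠ none} := by
  ext n
  simp [opIter_map Φ h]

theorem bind_comm_of_graph {B : Type} {g h : B → Option B}
    (H : ∀ b c d, g b = some c → h c = some d → ∃ c', h b = some c' ∧ g c' = some d)
    (H' : ∀ b c d, h b = some c → g c = some d → ∃ c', g b = some c' ∧ h c' = some d) (b : B) :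
    (g b).bind h = (h b).bind g := by
  ext d
  simp only [Option.bind_eq_some_iff]
  exact ⟨fun ⟨c, h1, h2⟩ => H b c d h1 h2, fun ⟨c, h1, h2⟩ => H' b c d h1 h2⟩

namespace ALab

variable {l : ℕ} {a b a' b' : ALab l}

/-- `E` does not depend on `r`. -/
theorem eTarget_iff_of_F0 (ha : a.F0 a') (hb : b.F0 b') :
    ETarget a.toZ b.toZ ↔ ETarget a'.toZ b'.toZ := by
  obtain ⟨a1, a2, a3, a4, a5, a6⟩ := ha
  obtain ⟨b1, b2, b3, b4, b5, b6⟩ := hb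
  simp only [ETarget, toZ, a1, a2, a3, a4, a5, a6, b1, b2, b3, b4, b5, b6]
  refine and_congr ?_ Iff.rfl
  omega

/-- `E` preserves the lengths of the `0`-strings of the elements killed by `e₀`. -/
theorem string_eq_of_eTarget (h : ETarget a.toZ b.toZ) :
    (b.r = a.r) ∧ (b.j + b.q - 2 * b.p : ℤ) = a.j + a.q - 2 * a.p := by
  obtain ⟨hr, h⟩ := h
  rcases h with ⟨-, h⟩ | ⟨-, h⟩ | ⟨-, h⟩ | ⟨-, h⟩ | ⟨-, h⟩ <;>
    simp only [toZ] at h hr <;> omega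

theorem exists_F0_of_eTarget_left (h : ETarget a.toZ b.toZ) (hb : b.F0 b') :
    ∃ a' : ALab l, a.F0 a' ∧ ETarget a'.toZ b'.toZ := by
  have h1 := string_eq_of_eTarget h
  have h2 := b'.r_le
  obtain ⟨a', ha⟩ := a.exists_F0 (by unfold F0 at hb; omega)
  exact ⟨a', ha, (eTarget_iff_of_F0 ha hb).1 h⟩

theorem exists_F0_of_eTarget_right (h : ETarget a.toZ b.toZ) (ha : a.F0 a') :
    ∃ b' : ALab l, b.F0 b' ∧ ETarget a'.toZ b'.toZ := by
  have h1 := string_eq_of_eTarget h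
  have h2 := a'.r_le
  obtain ⟨b', hb⟩ := b.exists_F0 (by unfold F0 at ha; omega)
  exact ⟨b', hb, (eTarget_iff_of_F0 ha hb).1 h⟩

theorem exists_F0_inv_of_eTarget_left (h : ETarget a'.toZ b'.toZ) (hb : b.F0 b') :
    ∃ a : ALab l, a.F0 a' ∧ ETarget a.toZ b.toZ := by
  have h1 := string_eq_of_eTarget h
  obtain ⟨a, ha⟩ := a'.exists_F0_inv (by unfold F0 at hb; omega)
  exact ⟨a, ha, (eTarget_iff_of_F0 ha hb).2 h⟩

theorem exists_F0_inv_of_eTarget_right (h : ETarget a'.toZ b'.toZ) (ha : a.F0 a') :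
    ∃ b : ALab l, b.F0 b' ∧ ETarget a.toZ b.toZ := by
  have h1 := string_eq_of_eTarget h
  obtain ⟨b, hb⟩ := b'.exists_F0_inv (by unfold F0 at ha; omega)
  exact ⟨b, hb, (eTarget_iff_of_F0 ha hb).2 h⟩

end ALab

section operators

variable {l : ℕ}

theorem eRel_functional {b c c' : ASet l} (h : ERel l b c) (h' : ERel l b c') : c = c' := by
  obtain ⟨b, rfl⟩ := ALab.toASet_surjective b
  obtain ⟨c, rfl⟩ := ALab.toASet_surjective c
  obtain ⟨c', rfl⟩ := ALab.toASet_surjective c'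
  rw [ALab.eRel_iff] at h h'
  rw [ALab.toZ_injective (ETarget.functional b.inCone h h')]

theorem eRel_injective {b b' c : ASet l} (h : ERel l b c) (h' : ERel l b' c) : b = b' := by
  obtain ⟨b, rfl⟩ := ALab.toASet_surjective b
  obtain ⟨b', rfl⟩ := ALab.toASet_surjective b'
  obtain ⟨c, rfl⟩ := ALab.toASet_surjective c
  rw [ALab.eRel_iff] at h h'
  rw [ALab.toZ_injective (ETarget.injective b.inCone b'.inCone h h')]

theorem eOp_eq_some_iff {b c : ASet l} : EOp l b = some c ↔ ERel l b c :=
  partialMap_eq_some_iff (R := ERel l) fun _ _ _ => eRel_functional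

theorem fOp_eq_some_iff {b c : ASet l} : FOp l b = some c ↔ ERel l c b :=
  partialMap_eq_some_iff (R := fun b c => ERel l c b) fun _ _ _ => eRel_injective

theorem eOp_toASet {c c' : ALab l} :
    EOp l c.toASet = some c'.toASet ↔ ETarget c.toZ c'.toZ := by
  rw [eOp_eq_some_iff, ALab.eRel_iff]

theorem fOp_toASet {c c' : ALab l} :
    FOp l c.toASet = some c'.toASet ↔ ETarget c'.toZ c.toZ := by
  rw [fOp_eq_some_iff, ALab.eRel_iff]

theorem e_zero_toASet {c c' : ALab l} :
    (aCrystal l).e .zero c.toASet = some c'.toASet ↔ c'.F0 c := by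
  rw [(aCrystal_isRegular l).e_eq_iff, ALab.f_zero_eq_some_iff]

theorem f_zero_eOp_comm (b : ASet l) :
    ((aCrystal l).f .zero b).bind (EOp l) = (EOp l b).bind ((aCrystal l).f .zero) := by
  refine bind_comm_of_graph (fun b c d h1 h2 => ?_) (fun b c d h1 h2 => ?_) b <;>
    obtain ⟨b, rfl⟩ := ALab.toASet_surjective b <;>
    obtain ⟨c, rfl⟩ := ALab.toASet_surjective c <;>
    obtain ⟨d, rfl⟩ := ALab.toASet_surjective d <;>
    simp only [eOp_toASet, ALab.f_zero_eq_some_iff] at h1 h2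
  · obtain ⟨c', h3, h4⟩ : ∃ c' : ALab l, c'.F0 d ∧ ETarget b.toZ c'.toZ :=
      ALab.exists_F0_inv_of_eTarget_right h2 h1
    exact ⟨c'.toASet, eOp_toASet.2 h4, ALab.f_zero_toASet h3⟩
  · obtain ⟨c', h3, h4⟩ := ALab.exists_F0_of_eTarget_left h1 h2
    exact ⟨c'.toASet, ALab.f_zero_toASet h3, eOp_toASet.2 h4⟩

theorem f_zero_fOp_comm (b : ASet l) :
    ((aCrystal l).f .zero b).bind (FOp l) = (FOp l b).bind ((aCrystal l).f .zero) := by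
  refine bind_comm_of_graph (fun b c d h1 h2 => ?_) (fun b c d h1 h2 => ?_) b <;>
    obtain ⟨b, rfl⟩ := ALab.toASet_surjective b <;>
    obtain ⟨c, rfl⟩ := ALab.toASet_surjective c <;>
    obtain ⟨d, rfl⟩ := ALab.toASet_surjective d <;>
    simp only [fOp_toASet, ALab.f_zero_eq_some_iff] at h1 h2
  · obtain ⟨c', h3, h4⟩ := ALab.exists_F0_inv_of_eTarget_left h2 h1
    exact ⟨c'.toASet, fOp_toASet.2 h4, ALab.f_zero_toASet h3⟩
  · obtain ⟨c', h3, h4⟩ := ALab.exists_F0_of_eTarget_right h1 h2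
    exact ⟨c'.toASet, ALab.f_zero_toASet h3, fOp_toASet.2 h4⟩

theorem e_zero_eOp_comm (b : ASet l) :
    ((aCrystal l).e .zero b).bind (EOp l) = (EOp l b).bind ((aCrystal l).e .zero) := by
  refine bind_comm_of_graph (fun b c d h1 h2 => ?_) (fun b c d h1 h2 => ?_) b <;>
    obtain ⟨b, rfl⟩ := ALab.toASet_surjective b <;>
    obtain ⟨c, rfl⟩ := ALab.toASet_surjective c <;>
    obtain ⟨d, rfl⟩ := ALab.toASet_surjective d <;>
    simp only [eOp_toASet, e_zero_toASet] at h1 h2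
  · obtain ⟨c', h3, h4⟩ := ALab.exists_F0_of_eTarget_right h2 h1
    exact ⟨c'.toASet, eOp_toASet.2 h4, e_zero_toASet.2 h3⟩
  · obtain ⟨c', h3, h4⟩ := ALab.exists_F0_inv_of_eTarget_left h1 h2
    exact ⟨c'.toASet, e_zero_toASet.2 h3, eOp_toASet.2 h4⟩

end operators

section bijection

variable {l : ℕ}

/-- The label map as a bijection. -/
noncomputable def GPt.aEquiv (l : ℕ) : GPt l ≃ ASet l :=
  Equiv.ofBijective (fun x => x.lab.toASet)
    ⟨ALab.toASet_injective.comp GPt.lab_injective,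
      ALab.toASet_surjective.comp GPt.lab_surjective⟩

/-- The points parametrize `𝒢^l`. -/
noncomputable def GPt.gEquiv (l : ℕ) : GPt l ≃ GSet l :=
  Equiv.ofBijective GPt.toGSet ⟨GPt.toGSet_injective, GPt.toGSet_surjective⟩

/-- The bijection `Φ`. -/
noncomputable def phiEquiv (l : ℕ) : ASet l ≃ GSet l := (GPt.aEquiv l).symm.trans (GPt.gEquiv l)

theorem phiEquiv_toASet (x : GPt l) : phiEquiv l x.lab.toASet = x.toGSet := by
  have h : (GPt.aEquiv l).symm x.lab.toASet = x := (GPt.aEquiv l).symm_apply_apply x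
  rw [phiEquiv, Equiv.trans_apply, h]
  rfl

theorem exists_point (b : ASet l) : ∃ x : GPt l, x.lab.toASet = b :=
  (GPt.aEquiv l).surjective b

theorem phiEquiv_e_one (b : ASet l) :
    (gCrystal l).e .one (phiEquiv l b) = ((aCrystal l).e .one b).map (phiEquiv l) := by
  refine eq_map_of_graph (phiEquiv l) fun b' => ?_
  obtain ⟨x, rfl⟩ := exists_point b
  obtain ⟨x', rfl⟩ := exists_point b'
  rw [phiEquiv_toASet, phiEquiv_toASet, GPt.e_one_eq_some_iff, (aCrystal_isRegular l).e_eq_iff,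
    ALab.f_one_eq_some_iff, GPt.f1_lab_iff]

theorem phiEquiv_f_one (b : ASet l) :
    (gCrystal l).f .one (phiEquiv l b) = ((aCrystal l).f .one b).map (phiEquiv l) := by
  refine eq_map_of_graph (phiEquiv l) fun b' => ?_
  rw [← (gCrystal_isRegular l).e_eq_iff, ← (aCrystal_isRegular l).e_eq_iff]
  exact graph_of_eq_map _ (phiEquiv_e_one b') b

theorem phiEquiv_e_two (b : ASet l) :
    (gCrystal l).e .two (phiEquiv l b) = (EOp l b).map (phiEquiv l) := by
  refine eq_map_of_graph (phiEquiv l) fun b' => ?_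
  obtain ⟨x, rfl⟩ := exists_point b
  obtain ⟨x', rfl⟩ := exists_point b'
  rw [phiEquiv_toASet, phiEquiv_toASet, GPt.e_two_eq_some_iff, eOp_toASet, GPt.eTarget_lab_iff]

theorem phiEquiv_f_two (b : ASet l) :
    (gCrystal l).f .two (phiEquiv l b) = (FOp l b).map (phiEquiv l) := by
  refine eq_map_of_graph (phiEquiv l) fun b' => ?_
  rw [← (gCrystal_isRegular l).e_eq_iff, fOp_eq_some_iff, ← eOp_eq_some_iff]
  exact graph_of_eq_map _ (phiEquiv_e_two b') b

theorem phiEquiv_wt_one (b : ASet l) :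
    (gCrystal l).wt (phiEquiv l b) .one = (aCrystal l).wt b .one := by
  obtain ⟨x, rfl⟩ := exists_point b
  rw [phiEquiv_toASet, GPt.wt_one_toGSet, ALab.wt_one_toASet, GPt.wt_one_lab]

theorem phiEquiv_wt_two (b : ASet l) : (gCrystal l).wt (phiEquiv l b) .two =
    -2 * (aCrystal l).wt b .one - (aCrystal l).wt b .zero := by
  obtain ⟨x, rfl⟩ := exists_point b
  rw [phiEquiv_toASet, GPt.wt_two_toGSet, ALab.wt_one_toASet, ALab.wt_zero_toASet,
    GPt.wt_one_lab, GPt.wt_zero_lab]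
  ring

theorem phiEquiv_row {i j p : ℕ} (_ : 2 * i ≤ l) (hij : i ≤ j) (hj : j ≤ l - i) (hp : p ≤ j) :
    ∃ b, aElt l i (l - i) j 0 0 p = some b ∧ (phiEquiv l b).row = phiRow l i j p := by
  have h : ∃ x : GPt l, x.word = phiRow l i j p ∧ x.lab.i = i ∧ x.lab.k = l - i ∧ x.lab.j = j ∧
      x.lab.p = 0 ∧ x.lab.q = 0 ∧ x.lab.r = p := by
    rcases le_or_gt p i with h | h
    · exact GPt.exists_row_of_le hij (by omega) h
    · exact GPt.exists_row_of_lt hij (by omega) h hp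
  obtain ⟨x, hw, h1, h2, h3, h4, h5, h6⟩ := h
  refine ⟨x.lab.toASet, ?_, ?_⟩
  · rw [← x.lab.aElt_eq, h1, h2, h3, h4, h5, h6]
  · rw [phiEquiv_toASet, ← hw]
    rfl

/-- An automorphism of `𝒢^l` compatible with `e₁` and `e₂` is the identity, since the lengths of the
`1`-strings through the highest weight elements tell these apart. -/
theorem apply_eq_self_of_comm (σ : GSet l ≃ GSet l)
    (h1 : ∀ b, (gCrystal l).e .one (σ b) = ((gCrystal l).e .one b).map σ)
    (h2 : ∀ b, (gCrystal l).e .two (σ b) = ((gCrystal l).e .two b).map σ) (b : GSet l) :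
    σ b = b := by
  have hf (b : GSet l) : (gCrystal l).f .one (σ b) = ((gCrystal l).f .one b).map σ := by
    refine eq_map_of_graph σ fun b' => ?_
    rw [← (gCrystal_isRegular l).e_eq_iff, ← (gCrystal_isRegular l).e_eq_iff]
    exact graph_of_eq_map _ (h1 b') b
  have hφ (b : GSet l) : (gCrystal l).φ .one (σ b) = (gCrystal l).φ .one b := by
    have e1 := (gCrystal_isRegular l).isCrystal.phi_max .one (σ b)
    rw [setOf_opIter_map σ hf] at e1
    exact e1.unique ((gCrystal_isRegular l).isCrystal.phi_max .one b)
  obtain ⟨x, rfl⟩ := GPt.toGSet_surjective b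
  induction x using GPt.raise_induction with
  | top x t1 t2 =>
    obtain ⟨y, hy⟩ := GPt.toGSet_surjective (σ x.toGSet)
    have t1' : ¬∃ y', y.E1 y' := by
      rintro ⟨y', h⟩
      rw [← GPt.e_one_eq_some_iff, hy] at h
      obtain ⟨b, hb⟩ := σ.surjective y'.toGSet
      obtain ⟨x', rfl⟩ := GPt.toGSet_surjective b
      rw [← hb, graph_of_eq_map σ (h1 _), GPt.e_one_eq_some_iff] at h
      exact t1 ⟨x', h⟩
    have t2' : ¬∃ y', y.E2 y' := by
      rintro ⟨y', h⟩
      rw [← GPt.e_two_eq_some_iff, hy] at h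
      obtain ⟨b, hb⟩ := σ.surjective y'.toGSet
      obtain ⟨x', rfl⟩ := GPt.toGSet_surjective b
      rw [← hb, graph_of_eq_map σ (h2 _), GPt.e_two_eq_some_iff] at h
      exact t2 ⟨x', h⟩
    have e1 := x.eq_top_of_not t1 t2
    have e2 := y.eq_top_of_not t1' t2'
    have e3 := hφ x.toGSet
    rw [← hy, GPt.phi_one_toGSet, GPt.phi_one_toGSet] at e3
    rw [← hy]
    congr 1
    ext <;> omega
  | e1 x x' h ih =>
    have h3 := graph_of_eq_map σ (h1 x.toGSet) x'.toGSet
    rw [ih, GPt.e_one_toGSet h] at h3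
    obtain ⟨y, hy⟩ := GPt.toGSet_surjective (σ x.toGSet)
    rw [← hy, GPt.e_one_eq_some_iff] at h3
    rw [← hy, h.injective (h3.2 rfl)]
  | e2 x x' h ih =>
    have h3 := graph_of_eq_map σ (h2 x.toGSet) x'.toGSet
    rw [ih, GPt.e_two_toGSet h] at h3
    obtain ⟨y, hy⟩ := GPt.toGSet_surjective (σ x.toGSet)
    rw [← hy, GPt.e_two_eq_some_iff] at h3
    rw [← hy, h.injective (h3.2 rfl)]

theorem eq_phiEquiv (Ψ : ASet l ≃ GSet l)
    (h1 : ∀ b, (gCrystal l).e .one (Ψ b) = ((aCrystal l).e .one b).map Ψ)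
    (h2 : ∀ b, (gCrystal l).f .two (Ψ b) = (FOp l b).map Ψ) : Ψ = phiEquiv l := by
  have h3 (b : ASet l) : (gCrystal l).e .two (Ψ b) = (EOp l b).map Ψ := by
    refine eq_map_of_graph Ψ fun b' => ?_
    rw [(gCrystal_isRegular l).e_eq_iff, eOp_eq_some_iff, ← fOp_eq_some_iff]
    exact graph_of_eq_map _ (h2 b') b
  have key : ∀ c, ((phiEquiv l).symm.trans Ψ) c = c := by
    refine apply_eq_self_of_comm _ (fun c => ?_) fun c => ?_
    · obtain ⟨b, rfl⟩ := (phiEquiv l).surjective c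
      rw [phiEquiv_e_one, Equiv.trans_apply, Equiv.symm_apply_apply, h1, Option.map_map]
      congr 1
      ext b
      simp
    · obtain ⟨b, rfl⟩ := (phiEquiv l).surjective c
      rw [phiEquiv_e_two, Equiv.trans_apply, Equiv.symm_apply_apply, h3, Option.map_map]
      congr 1
      ext b
      simp
  refine Equiv.ext fun b => ?_
  have := key (phiEquiv l b)
  rwa [Equiv.trans_apply, Equiv.symm_apply_apply] at this

end bijection

/-! ### The affine crystal -/

section affine

variable {l : ℕ}

theorem e0_apply (Φ : ASet l ≃ GSet l) (b : ASet l) :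
    e0 Φ (Φ b) = ((aCrystal l).e .zero b).map Φ := by
  rw [e0, Equiv.symm_apply_apply]

theorem f0_apply (Φ : ASet l ≃ GSet l) (b : ASet l) :
    f0 Φ (Φ b) = ((aCrystal l).f .zero b).map Φ := by
  rw [f0, Equiv.symm_apply_apply]

theorem isGreatest_e0 (Φ : ASet l ≃ GSet l) (b : ASet l) :
    IsGreatest {n | opIter (e0 Φ) n (Φ b) ≠ none} ((aCrystal l).ε .zero b) := by
  rw [setOf_opIter_map Φ (e0_apply Φ)]
  exact (aCrystal_isRegular l).isCrystal.eps_max .zero b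

theorem isGreatest_f0 (Φ : ASet l ≃ GSet l) (b : ASet l) :
    IsGreatest {n | opIter (f0 Φ) n (Φ b) ≠ none} ((aCrystal l).φ .zero b) := by
  rw [setOf_opIter_map Φ (f0_apply Φ)]
  exact (aCrystal_isRegular l).isCrystal.phi_max .zero b

theorem affineB_eps_zero (Φ : ASet l ≃ GSet l) (b : ASet l) :
    (affineB Φ).ε .zero (Φ b) = (aCrystal l).ε .zero b := (isGreatest_e0 Φ b).csSup_eq

theorem affineB_phi_zero (Φ : ASet l ≃ GSet l) (b : ASet l) :
    (affineB Φ).φ .zero (Φ b) = (aCrystal l).φ .zero b := (isGreatest_f0 Φ b).csSup_eq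

theorem affineB_wt_zero (Φ : ASet l ≃ GSet l) (b : ASet l) :
    (affineB Φ).wt (Φ b) .zero = (aCrystal l).wt b .zero := by
  change ((affineB Φ).φ .zero (Φ b) : ℤ) - (affineB Φ).ε .zero (Φ b) = _
  rw [affineB_eps_zero, affineB_phi_zero, (aCrystal_isRegular l).phi_eq]
  ring

theorem affineB_level_zero (b : GSet l) : (affineB (phiEquiv l)).wt b .zero +
    2 * (affineB (phiEquiv l)).wt b .one + (affineB (phiEquiv l)).wt b .two = 0 := by
  obtain ⟨b, rfl⟩ := (phiEquiv l).surjective b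
  have h1 := phiEquiv_wt_one b
  have h2 := phiEquiv_wt_two b
  have h0 := affineB_wt_zero (phiEquiv l) b
  change _ + 2 * (gCrystal l).wt (phiEquiv l b) .one + (gCrystal l).wt (phiEquiv l b) .two = 0
  rw [h0, h1, h2]
  ring

theorem affineB_isRegular : (affineB (phiEquiv l)).IsRegular cartanAff where
  diag i := by cases i <;> rfl
  phi_eq i b := by
    cases i with
    | zero =>
      change ((affineB (phiEquiv l)).φ .zero b : ℤ) = (affineB (phiEquiv l)).ε .zero b +
        ((affineB (phiEquiv l)).φ .zero b - (affineB (phiEquiv l)).ε .zero b)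
      ring
    | one => exact (gCrystal_isRegular l).phi_eq .one b
    | two => exact (gCrystal_isRegular l).phi_eq .two b
  e_eq_iff i b b' := by
    cases i with
    | zero =>
      obtain ⟨b, rfl⟩ := (phiEquiv l).surjective b
      obtain ⟨b', rfl⟩ := (phiEquiv l).surjective b'
      exact (graph_of_eq_map _ (e0_apply _ b) b').trans
        (((aCrystal_isRegular l).e_eq_iff .zero b b').trans
          (graph_of_eq_map _ (f0_apply _ b') b).symm)
    | one => exact (gCrystal_isRegular l).e_eq_iff .one b b'
    | two => exact (gCrystal_isRegular l).e_eq_iff .two b b'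
  wt_e i b b' h := by
    -- the coordinate of the weight at a node of the same diagram is known, the other one follows
    -- as the level vanishes
    have l1 := affineB_level_zero b
    have l2 := affineB_level_zero b'
    cases i with
    | zero =>
      obtain ⟨b, rfl⟩ := (phiEquiv l).surjective b
      obtain ⟨b', rfl⟩ := (phiEquiv l).surjective b'
      replace h := (graph_of_eq_map _ (e0_apply _ b) b').1 h
      have h0 := (aCrystal_isRegular l).wt_e _ _ _ h .zero
      have h1 := (aCrystal_isRegular l).wt_e _ _ _ h .one
      rw [← affineB_wt_zero (phiEquiv l), ← affineB_wt_zero (phiEquiv l)] at h0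
      rw [← phiEquiv_wt_one, ← phiEquiv_wt_one] at h1
      change (affineB (phiEquiv l)).wt _ .one = (affineB (phiEquiv l)).wt _ .one + -1 at h1
      change (affineB (phiEquiv l)).wt _ .zero = (affineB (phiEquiv l)).wt _ .zero + 2 at h0
      intro j
      cases j <;> simp only [cartanAff] <;> linarith
    | one =>
      have h1 := (gCrystal_isRegular l).wt_e _ _ _ h .one
      have h2 := (gCrystal_isRegular l).wt_e _ _ _ h .two
      change (affineB (phiEquiv l)).wt _ .one = (affineB (phiEquiv l)).wt _ .one + 2 at h1
      change (affineB (phiEquiv l)).wt _ .two = (affineB (phiEquiv l)).wt _ .two + -3 at h2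
      intro j
      cases j <;> simp only [cartanAff] <;> linarith
    | two =>
      have h1 := (gCrystal_isRegular l).wt_e _ _ _ h .one
      have h2 := (gCrystal_isRegular l).wt_e _ _ _ h .two
      change (affineB (phiEquiv l)).wt _ .one = (affineB (phiEquiv l)).wt _ .one + -1 at h1
      change (affineB (phiEquiv l)).wt _ .two = (affineB (phiEquiv l)).wt _ .two + 2 at h2
      intro j
      cases j <;> simp only [cartanAff] <;> linarith
  eps_e i b b' h := by
    cases i with
    | zero =>
      obtain ⟨b, rfl⟩ := (phiEquiv l).surjective b
      obtain ⟨b', rfl⟩ := (phiEquiv l).surjective b'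
      rw [affineB_eps_zero, affineB_eps_zero]
      exact (aCrystal_isRegular l).eps_e _ _ _ ((graph_of_eq_map _ (e0_apply _ b) b').1 h)
    | one => exact (gCrystal_isRegular l).eps_e .one b b' h
    | two => exact (gCrystal_isRegular l).eps_e .two b b' h
  e_none i b h := by
    cases i with
    | zero =>
      obtain ⟨b, rfl⟩ := (phiEquiv l).surjective b
      rw [affineB_eps_zero]
      replace h := (e0_apply _ b).symm.trans h
      exact (aCrystal_isRegular l).e_none _ _ (Option.map_eq_none_iff.1 h)
    | one => exact (gCrystal_isRegular l).e_none .one b h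
    | two => exact (gCrystal_isRegular l).e_none .two b h
  f_none i b h := by
    cases i with
    | zero =>
      obtain ⟨b, rfl⟩ := (phiEquiv l).surjective b
      rw [affineB_phi_zero]
      replace h := (f0_apply _ b).symm.trans h
      exact (aCrystal_isRegular l).f_none _ _ (Option.map_eq_none_iff.1 h)
    | one => exact (gCrystal_isRegular l).f_none .one b h
    | two => exact (gCrystal_isRegular l).f_none .two b h

/-- Commuting partial maps are transported to commuting partial maps. -/
theorem bind_comm_map {B B' : Type} (Φ : B ≃ B') {g h : B → Option B} {g' h' : B' → Option B'}
    (hg : ∀ b, g' (Φ b) = (g b).map Φ) (hh : ∀ b, h' (Φ b) = (h b).map Φ)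
    (H : ∀ b, (g b).bind h = (h b).bind g) (b : B') : (g' b).bind h' = (h' b).bind g' := by
  obtain ⟨b, rfl⟩ := Φ.surjective b
  have key : ∀ {g h : B → Option B} {g' h' : B' → Option B'},
      (∀ b, g' (Φ b) = (g b).map Φ) → (∀ b, h' (Φ b) = (h b).map Φ) →
      (g' (Φ b)).bind h' = ((g b).bind h).map Φ := by
    intro g h g' h' hg hh
    rw [hg]
    cases g b with
    | none => rfl
    | some c => exact hh c
  rw [key hg hh, key hh hg, H]

end affine

theorem mainTheorem9 (l : ℕ) (hl : 0 < l) :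
    -- `E` and `F` are well defined, mutually inverse, commute with `f₀`, and have the right strings
    (∀ b b' : ASet l, (EOp l b = some b' ↔ ERel l b b') ∧
        (EOp l b = some b' ↔ FOp l b' = some b)) ∧
    (∀ b : ASet l,
        ((aCrystal l).f .zero b).bind (EOp l) = (EOp l b).bind ((aCrystal l).f .zero)) ∧
    (∀ b : ASet l, ∃ m m' : ℕ,
        IsGreatest {n : ℕ | opIter (FOp l) n b ≠ none} m ∧
        IsGreatest {n : ℕ | opIter (EOp l) n b ≠ none} m' ∧
        (m : ℤ) - m' = -2 * (aCrystal l).wt b .one - (aCrystal l).wt b .zero) ∧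
    ∃ Φ : ASet l ≃ GSet l,
      -- `Φ` intertwines the operators at the node `1`, and `E`, `F` with those at the node `2`
      (∀ b, (gCrystal l).e .one (Φ b) = ((aCrystal l).e .one b).map Φ) ∧
      (∀ b, (gCrystal l).f .one (Φ b) = ((aCrystal l).f .one b).map Φ) ∧
      (∀ b, (gCrystal l).f .two (Φ b) = (FOp l b).map Φ) ∧
      (∀ b, (gCrystal l).e .two (Φ b) = (EOp l b).map Φ) ∧
      -- weights
      (∀ b, (gCrystal l).wt (Φ b) .one = (aCrystal l).wt b .one) ∧
      (∀ b, (gCrystal l).wt (Φ b) .two =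
        -2 * (aCrystal l).wt b .one - (aCrystal l).wt b .zero) ∧
      -- the values from which `Φ` is built
      (∀ i j p : ℕ, i ≤ l / 2 → i ≤ j → j ≤ l - i → p ≤ j →
        ∃ b, aElt l i (l - i) j 0 0 p = some b ∧ (Φ b).row = phiRow l i j p) ∧
      -- `Φ` is determined by its compatibility with `e₁` and `F`
      (∀ Ψ : ASet l ≃ GSet l,
        (∀ b, (gCrystal l).e .one (Ψ b) = ((aCrystal l).e .one b).map Ψ) →
        (∀ b, (gCrystal l).f .two (Ψ b) = (FOp l b).map Ψ) → Ψ = Φ) ∧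
      -- the resulting structure is a crystal for the affine Cartan matrix
      (affineB Φ).IsCrystal cartanAff ∧
      -- of level zero
      (∀ b, (affineB Φ).wt b .zero + 2 * (affineB Φ).wt b .one + (affineB Φ).wt b .two = 0) ∧
      -- the operators at the nodes `0` and `2` commute
      (∀ b, ((affineB Φ).f .two b).bind ((affineB Φ).f .zero) =
        ((affineB Φ).f .zero b).bind ((affineB Φ).f .two)) ∧
      (∀ b, ((affineB Φ).e .two b).bind ((affineB Φ).e .zero) =
        ((affineB Φ).e .zero b).bind ((affineB Φ).e .two)) ∧
      -- as a crystal for the nodes `0, 1` it is isomorphic to `𝒜` through `Φ`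
      (∀ (a : AIdx) (b : ASet l),
        (affineB Φ).e a.toAff (Φ b) = ((aCrystal l).e a b).map Φ ∧
        (affineB Φ).f a.toAff (Φ b) = ((aCrystal l).f a b).map Φ ∧
        (affineB Φ).wt (Φ b) a.toAff = (aCrystal l).wt b a ∧
        (affineB Φ).ε a.toAff (Φ b) = (aCrystal l).ε a b ∧
        (affineB Φ).φ a.toAff (Φ b) = (aCrystal l).φ a b) := by
  refine ⟨fun b b' => ⟨eOp_eq_some_iff, ?_⟩, f_zero_eOp_comm, fun b => ?_, phiEquiv l,
    phiEquiv_e_one, phiEquiv_f_one, phiEquiv_f_two, phiEquiv_e_two, phiEquiv_wt_one,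
    phiEquiv_wt_two, fun i j p hi hij hj hp => phiEquiv_row (by omega) hij hj hp, eq_phiEquiv,
    affineB_isRegular.isCrystal, affineB_level_zero, ?_, ?_, ?_⟩
  · rw [eOp_eq_some_iff, fOp_eq_some_iff]
  · -- the strings of `F`, `E` are those of `f₂`, `e₂` on `𝒢^l`
    have h1 := (gCrystal_isRegular l).isCrystal.phi_max .two (phiEquiv l b)
    have h2 := (gCrystal_isRegular l).isCrystal.eps_max .two (phiEquiv l b)
    rw [setOf_opIter_map _ phiEquiv_f_two] at h1
    rw [setOf_opIter_map _ phiEquiv_e_two] at h2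
    refine ⟨_, _, h1, h2, ?_⟩
    rw [(gCrystal_isRegular l).phi_eq, phiEquiv_wt_two]
    ring
  · exact bind_comm_map _ phiEquiv_f_two (f0_apply _) fun b => (f_zero_fOp_comm b).symm
  · exact bind_comm_map _ phiEquiv_e_two (e0_apply _) fun b => (e_zero_eOp_comm b).symm
  · rintro (_ | _) b
    · exact ⟨e0_apply _ b, f0_apply _ b, affineB_wt_zero _ b, affineB_eps_zero _ b,
        affineB_phi_zero _ b⟩
    · have h1 := (gCrystal_isRegular l).isCrystal.eps_max .one (phiEquiv l b)
      have h2 := (gCrystal_isRegular l).isCrystal.phi_max .one (phiEquiv l b)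
      rw [setOf_opIter_map _ phiEquiv_e_one] at h1
      rw [setOf_opIter_map _ phiEquiv_f_one] at h2
      exact ⟨phiEquiv_e_one b, phiEquiv_f_one b, phiEquiv_wt_one b,
        h1.unique ((aCrystal_isRegular l).isCrystal.eps_max .one b),
        h2.unique ((aCrystal_isRegular l).isCrystal.phi_max .one b)⟩
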